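/- All multigraphs are finite and loopless; parallel edges are allowed, and two parallel edges form a cycle, so a forest has no parallel edges. For an integer $D\ge 0$, an edge-version coloring with parameter $D$ of a multigraph $G$ is a partition $(M,F)$ of $V(G)$ (a part may be empty) such that the induced subgraph $G[M]$ is a forest in which every connected component has at most $D$ edges, and the induced subgraph $G[F]$ is a forest. Call $G$ $D$-critical if $G$ has no such coloring, but every proper subgraph of $G$ has one. (i) For each odd $D\ge 1$, every $D$-critical multigraph $G$ on at least three vertices satisfies $$|E(G)|\ \ge\ \frac{(4D+3)\,|V(G)|+2}{2(D+1)}.$$ (ii) For each even $D\ge 2$, every $D$-critical multigraph $G$ on at least three vertices satisfies $$|E(G)|\ \ge\ \frac{(4D+1)\,|V(G)|+2}{2D+1}.$$ Both bounds are sharp: for each odd $D\ge 1$ (respectively, each even $D\ge 2$) and every $N$ there is a $D$-critical multigraph on at least $\max\{N,3\}$ vertices for which equality holds in (i) (respectively, in (ii)). -/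

import Mathlib

open scoped Graph

namespace Graph

/-- A multigraph is a forest if it has no cycle. A cycle consists of `n + 1` distinct vertices
`v 0, …, v n` and `n + 1` distinct edges `e 0, …, e n` such that `e i` joins `v i` to `v (i + 1)`,
with indices read cyclically modulo `n + 1` (the addition of `Fin (n + 1)`).
Loops (`n = 0`) and pairs of parallel edges (`n = 1`) are cycles. -/
def IsForest {α β : Type*} (G : Graph α β) : Prop :=
  ¬ ∃ (n : ℕ) (v : Fin (n + 1) → α) (e : Fin (n + 1) → β),
    Function.Injective v ∧ Function.Injective e ∧ ∀ i, G.IsLink (e i) (v i) (v (i + 1))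

/-- The vertex set of the connected component of the vertex `x` in the multigraph `G`. -/
def componentSet {α β : Type*} (G : Graph α β) (x : α) : Set α :=
  {y | Relation.ReflTransGen G.Adj x y}

/-- `(M, F)` partitions `V(G)` (a part may be empty) in such a way that `G[M]` is a forest in which
every connected component has at most `D` edges and `G[F]` is a forest. -/
structure IsEdgeColoring {α β : Type*} (D : ℕ) (G : Graph α β) (M F : Set α) : Prop where
  union_eq : M ∪ F = V(G)
  disjoint : Disjoint M F
  forest_left : (G.induce M).IsForest
  component_le : ∀ x ∈ M,
    E((G.induce M).induce ((G.induce M).componentSet x)).encard ≤ (D : ℕ∞)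
  forest_right : (G.induce F).IsForest

/-- `G` admits a partition as in `Graph.IsEdgeColoring`. -/
def EdgeColorable {α β : Type*} (D : ℕ) (G : Graph α β) : Prop :=
  ∃ M F : Set α, IsEdgeColoring D G M F

/-- `G` admits no such partition, but every proper subgraph of `G` does. -/
def EdgeCritical {α β : Type*} (D : ℕ) (G : Graph α β) : Prop :=
  ¬ EdgeColorable D G ∧ ∀ H : Graph α β, H < G → EdgeColorable D H

end Graph

/-! Let every vertex `v` carry `w v` pendant edges, counted against `D` if `v` goes to `M`; weight
above `D` forces `v` into `F`. Take an edge cost `b` (`2D + 2` for odd `D`, `2D + 1` for even `D`)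
and a cost `u j` of weight `j`. The potential of `S` is the sum of `2b - 1 - u (w v)` over `S`,
minus `b` times the number of edges inside `S`. The lower bound is the weight-zero case of a
statement suited to induction: if all nonempty vertex sets have potential at least `-1`, the
weighted multigraph is colourable.

In a minimal counterexample the crucial fact is `Counterexample.gap`: a proper subset with at least
two vertices has potential at least `b`. Otherwise take such a set `S` of least potential and colour
it. Its `F`-part can be shrunk to one vertex forced into `F`, and its edges leaving `M` can be
turned into weights outside; the smaller instance so obtained is not colourable, so it has a set of
potential below `-1`, and adding `S` to that set contradicts the choice of `S` or the potential of
`V`. The surplus in the gap lemma then pays for local reductions: delete a few vertices of low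
degree, raise weights or add edges near them, colour what is left, and put the deleted vertices
back.

Twice the potential of `V` is the sum of the charges `2(2b - 1 - u (w v)) - b deg v`, and is at
least `-2`. For even `D` the reductions make every charge at most `-1`, while there are at least
three vertices. For odd `D = 2k + 1` only vertices of degree 3 and weight `k` have positive charge,
namely 2. They are independent, and every other vertex has charge at most `-2` and at most minus its
number of such neighbours; this leaves one five-vertex configuration, coloured by hand.

For sharpness, start from a small weighted multigraph without colouring whose potential is `-2` and
whose proper subsets have nonnegative potential. One unit of weight can be exchanged for a gadget on
two new vertices (`Saturated.attach_tight`), which can also join two such multigraphs. Repeating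
this removes all weight at arbitrarily large order. Criticality of the result follows from the lower
bound: a proper subgraph without colouring would contain a set that is too dense. -/

set_option linter.unusedSectionVars false

/-! ### Counting edges in multigraphs -/

/-- A loopless multigraph on `α`, given by its edge multiplicities. -/
structure MGraph (α : Type*) where
  m : α → α → ℕ
  symm : ∀ a b, m a b = m b a
  irrefl : ∀ a, m a a = 0

namespace MGraph

variable {α : Type*} [DecidableEq α]

/-- The number of edges joining `v` to the set `T`. -/
def deg (G : MGraph α) (v : α) (T : Finset α) : ℕ := ∑ b ∈ T, G.m v b

/-- The number of edges joining `A` to `B`, for disjoint `A` and `B`. -/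
def cross (G : MGraph α) (A B : Finset α) : ℕ := ∑ a ∈ A, G.deg a B

/-- The number of edges with both ends in `T`. -/
def e (G : MGraph α) (T : Finset α) : ℕ := (∑ a ∈ T, G.deg a T) / 2

theorem deg_empty (G : MGraph α) (v : α) : G.deg v ∅ = 0 := by simp [deg]

theorem deg_singleton (G : MGraph α) (v b : α) : G.deg v {b} = G.m v b := by simp [deg]

theorem deg_insert (G : MGraph α) (v : α) {b : α} {T : Finset α} (h : b ∉ T) :
    G.deg v (insert b T) = G.m v b + G.deg v T := by simp [deg, Finset.sum_insert h]

theorem deg_insert_self (G : MGraph α) (v : α) (T : Finset α) :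
    G.deg v (insert v T) = G.deg v T := by
  by_cases h : v ∈ T
  · rw [Finset.insert_eq_of_mem h]
  · rw [deg_insert G v h, G.irrefl, zero_add]

theorem deg_mono (G : MGraph α) (v : α) {A B : Finset α} (h : A ⊆ B) : G.deg v A ≤ G.deg v B :=
  Finset.sum_le_sum_of_subset h

theorem deg_union (G : MGraph α) (v : α) {A B : Finset α} (h : Disjoint A B) :
    G.deg v (A ∪ B) = G.deg v A + G.deg v B := Finset.sum_union h

theorem m_le_deg (G : MGraph α) (v : α) {b : α} {T : Finset α} (h : b ∈ T) :
    G.m v b ≤ G.deg v T := Finset.single_le_sum (f := fun b => G.m v b) (by simp) h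

theorem sum_deg_insert (G : MGraph α) {v : α} {T : Finset α} (h : v ∉ T) :
    ∑ a ∈ insert v T, G.deg a (insert v T) = ∑ a ∈ T, G.deg a T + 2 * G.deg v T := by
  rw [Finset.sum_insert h, deg_insert_self]
  have : ∑ a ∈ T, G.deg a (insert v T) = ∑ a ∈ T, (G.m v a + G.deg a T) :=
    Finset.sum_congr rfl fun a _ => by rw [deg_insert G a h, G.symm]
  rw [this, Finset.sum_add_distrib]
  have h2 : ∑ a ∈ T, G.m v a = G.deg v T := rfl
  omega

theorem two_mul_e (G : MGraph α) (T : Finset α) : 2 * G.e T = ∑ a ∈ T, G.deg a T := by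
  have : Even (∑ a ∈ T, G.deg a T) := by
    induction T using Finset.induction_on with
    | empty => simp
    | insert v T h ih => rw [sum_deg_insert G h]; exact ih.add (even_two_mul _)
  obtain ⟨k, hk⟩ := this
  unfold e; omega

theorem e_empty (G : MGraph α) : G.e ∅ = 0 := by simp [e]

theorem e_insert (G : MGraph α) {v : α} {T : Finset α} (h : v ∉ T) :
    G.e (insert v T) = G.e T + G.deg v T := by
  have := sum_deg_insert G h
  rw [← two_mul_e, ← two_mul_e] at this; omega

theorem e_singleton (G : MGraph α) (v : α) : G.e {v} = 0 := by
  have := G.e_insert (Finset.notMem_empty v)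
  simpa [e_empty, deg_empty] using this

theorem cross_empty_left (G : MGraph α) (B : Finset α) : G.cross ∅ B = 0 := by simp [cross]

theorem cross_insert_left (G : MGraph α) {v : α} {A : Finset α} (h : v ∉ A) (B : Finset α) :
    G.cross (insert v A) B = G.deg v B + G.cross A B := by simp [cross, Finset.sum_insert h]

theorem cross_comm (G : MGraph α) (A B : Finset α) : G.cross A B = G.cross B A := by
  unfold cross deg
  rw [Finset.sum_comm]
  exact Finset.sum_congr rfl fun b _ => Finset.sum_congr rfl fun a _ => G.symm _ _

theorem cross_mono (G : MGraph α) {A A' B B' : Finset α} (h : A ⊆ A') (h' : B ⊆ B') :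
    G.cross A B ≤ G.cross A' B' :=
  (Finset.sum_le_sum_of_subset h).trans (Finset.sum_le_sum fun a _ => G.deg_mono a h')

theorem cross_union_left (G : MGraph α) {A A' : Finset α} (h : Disjoint A A') (B : Finset α) :
    G.cross (A ∪ A') B = G.cross A B + G.cross A' B := Finset.sum_union h

theorem cross_union_right (G : MGraph α) (A : Finset α) {B B' : Finset α} (h : Disjoint B B') :
    G.cross A (B ∪ B') = G.cross A B + G.cross A B' := by
  rw [cross_comm, cross_union_left G h, cross_comm G B, cross_comm G B']

theorem e_union (G : MGraph α) {A B : Finset α} (h : Disjoint A B) :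
    G.e (A ∪ B) = G.e A + G.e B + G.cross A B := by
  induction A using Finset.induction_on with
  | empty => simp [e_empty, cross_empty_left]
  | insert v A hv ih =>
    rw [Finset.disjoint_insert_left] at h
    have h1 : v ∉ A ∪ B := by simp [hv, h.1]
    rw [Finset.insert_union, e_insert G h1, ih h.2, e_insert G hv, cross_insert_left G hv,
      deg_union G v h.2]
    ring

theorem e_mono (G : MGraph α) {A B : Finset α} (h : A ⊆ B) : G.e A ≤ G.e B := by
  rw [← Finset.union_sdiff_of_subset h, e_union G Finset.disjoint_sdiff]; omega

theorem e_add_e_le (G : MGraph α) (A B : Finset α) :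
    G.e A + G.e B ≤ G.e (A ∪ B) + G.e (A ∩ B) := by
  have h1 : A ∪ B = A ∪ (B \ A) := by simp
  have h2 : B = (A ∩ B) ∪ (B \ A) := by ext x; simp; tauto
  have h3 : Disjoint (A ∩ B) (B \ A) := by
    rw [Finset.disjoint_left]; intro x; simp; tauto
  have h4 := G.e_union h3
  rw [← h2] at h4
  have h5 := G.e_union (Finset.disjoint_sdiff : Disjoint A (B \ A))
  have h6 := G.cross_mono (Finset.inter_subset_left : A ∩ B ⊆ A) (Finset.Subset.refl (B \ A))
  rw [h1]; omega

/-! ### Forests and weighted colourings -/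

/-- `F` induces a forest, expressed by counting edges. -/
def Forest (G : MGraph α) (F : Finset α) : Prop :=
  ∀ T ⊆ F, T.Nonempty → G.e T + 1 ≤ T.card

/-- `M` induces a forest in which each component has at most `D` edges, where every vertex `v`
carries `w v` additional pendant edges. -/
def Bdd (G : MGraph α) (D : ℕ) (w : α → ℕ) (M : Finset α) : Prop :=
  ∀ T ⊆ M, T.Nonempty →
    G.e T + 1 ≤ T.card ∧ (G.e T + 1 = T.card → G.e T + ∑ v ∈ T, w v ≤ D)

/-- `(M, F)` is a colouring of `M ∪ F`. -/
structure Col (G : MGraph α) (D : ℕ) (w : α → ℕ) (M F : Finset α) : Prop where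
  disj : Disjoint M F
  bdd : G.Bdd D w M
  forest : G.Forest F

/-- `V` has a colouring. -/
def Colorable (G : MGraph α) (D : ℕ) (w : α → ℕ) (V : Finset α) : Prop :=
  ∃ M F, M ∪ F = V ∧ G.Col D w M F

theorem Forest.subset {G : MGraph α} {F F' : Finset α} (h : G.Forest F) (h' : F' ⊆ F) :
    G.Forest F' := fun T hT => h T (hT.trans h')

theorem Bdd.subset {G : MGraph α} {D : ℕ} {w : α → ℕ} {M M' : Finset α} (h : G.Bdd D w M)
    (h' : M' ⊆ M) : G.Bdd D w M' := fun T hT => h T (hT.trans h')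

theorem Bdd.weaken {G : MGraph α} {D : ℕ} {w w' : α → ℕ} {M : Finset α} (h : G.Bdd D w M)
    (hw : ∀ v ∈ M, w' v ≤ w v) : G.Bdd D w' M := fun T hT hne =>
  ⟨(h T hT hne).1, fun ht => le_trans
    (Nat.add_le_add_left (Finset.sum_le_sum fun v hv => hw v (hT hv)) _) ((h T hT hne).2 ht)⟩

theorem Forest.empty (G : MGraph α) : G.Forest ∅ := fun T hT hne => by
  rw [Finset.subset_empty] at hT; simp [hT] at hne

theorem Bdd.empty (G : MGraph α) (D : ℕ) (w : α → ℕ) : G.Bdd D w ∅ := fun T hT hne => by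
  rw [Finset.subset_empty] at hT; simp [hT] at hne

theorem Bdd.weight_le {G : MGraph α} {D : ℕ} {w : α → ℕ} {M : Finset α} (h : G.Bdd D w M)
    {v : α} (hv : v ∈ M) : w v ≤ D := by
  have := (h {v} (by simpa using hv) (by simp)).2 (by simp [e_singleton])
  simpa [e_singleton] using this

theorem Bdd.forest {G : MGraph α} {D : ℕ} {w : α → ℕ} {M : Finset α} (h : G.Bdd D w M) :
    G.Forest M := fun T hT hne => (h T hT hne).1

theorem Col.subset {G : MGraph α} {D : ℕ} {w : α → ℕ} {M F M' F' : Finset α}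
    (h : G.Col D w M F) (hM : M' ⊆ M) (hF : F' ⊆ F) : G.Col D w M' F' :=
  ⟨h.disj.mono hM hF, h.bdd.subset hM, h.forest.subset hF⟩

theorem Forest.insert {G : MGraph α} {F : Finset α} (h : G.Forest F) {v : α}
    (hd : G.deg v F ≤ 1) : G.Forest (insert v F) := by
  intro T hT hne
  by_cases hvT : v ∈ T
  · obtain ⟨T, hvT', rfl⟩ : ∃ T', v ∉ T' ∧ Insert.insert v T' = T :=
      ⟨T.erase v, Finset.notMem_erase v T, Finset.insert_erase hvT⟩
    have hTF : T ⊆ F := fun x hx => by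
      have := hT (Finset.mem_insert_of_mem hx)
      rw [Finset.mem_insert] at this
      exact this.resolve_left fun hh => hvT' (hh ▸ hx)
    rw [e_insert G hvT', Finset.card_insert_of_notMem hvT']
    rcases T.eq_empty_or_nonempty with rfl | hne'
    · simp [e_empty, deg_empty]
    · have := h T hTF hne'
      have := G.deg_mono v hTF
      omega
  · exact h T (fun x hx => (Finset.mem_insert.1 (hT hx)).resolve_left
      (fun hh => hvT (hh ▸ hx))) hne

/-- A tree through `v` is a tree in `M` plus one edge to a neighbour `y`. The slack `w' y - w y`
pays for that edge and for the pendant edges of `v`. -/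
theorem Bdd.insert {G : MGraph α} {D : ℕ} {w w' : α → ℕ} {M : Finset α} (h : G.Bdd D w' M)
    {v : α} (hd : G.deg v M ≤ 1) (hwv : w v ≤ D) (hw : ∀ y ∈ M, w y ≤ w' y)
    (hn : ∀ y ∈ M, G.m v y ≠ 0 → w y + w v + 1 ≤ w' y) : G.Bdd D w (insert v M) := by
  intro T hT hne
  by_cases hvT : v ∈ T
  · obtain ⟨T, hvT', rfl⟩ : ∃ T', v ∉ T' ∧ Insert.insert v T' = T :=
      ⟨T.erase v, Finset.notMem_erase v T, Finset.insert_erase hvT⟩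
    have hTF : T ⊆ M := fun x hx => by
      have := hT (Finset.mem_insert_of_mem hx)
      rw [Finset.mem_insert] at this
      exact this.resolve_left fun hh => hvT' (hh ▸ hx)
    rw [e_insert G hvT', Finset.card_insert_of_notMem hvT', Finset.sum_insert hvT']
    rcases T.eq_empty_or_nonempty with rfl | hne'
    · simpa [e_empty, deg_empty] using hwv
    · have h1 := h T hTF hne'
      have h2 := G.deg_mono v hTF
      refine ⟨by omega, fun ht => ?_⟩
      have h3 : G.deg v T = 1 := by omega
      obtain ⟨y, hy, hy'⟩ : ∃ y ∈ T, G.m v y ≠ 0 := by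
        by_contra hcon; push Not at hcon
        have : G.deg v T = 0 := Finset.sum_eq_zero hcon
        omega
      have h4 := h1.2 (by omega)
      have h5 : ∑ x ∈ T, w x + w v + 1 ≤ ∑ x ∈ T, w' x := by
        rw [← Finset.insert_erase hy, Finset.sum_insert (Finset.notMem_erase y T),
          Finset.sum_insert (Finset.notMem_erase y T)]
        have := Finset.sum_le_sum fun x (hx : x ∈ T.erase y) =>
          hw x (hTF (Finset.mem_of_mem_erase hx))
        have := hn y (hTF hy) hy'
        omega
      omega
  · have hTM : T ⊆ M := fun x hx => (Finset.mem_insert.1 (hT hx)).resolve_left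
      (fun hh => hvT (hh ▸ hx))
    have h1 := h.weaken hw T hTM hne
    exact h1

/-- Add one edge joining the distinct vertices `a` and `b`. -/
def addEdge (G : MGraph α) (a b : α) (hab : a ≠ b) : MGraph α where
  m x y := G.m x y + (if x = a ∧ y = b ∨ x = b ∧ y = a then 1 else 0)
  symm x y := by rw [G.symm]; congr 2; simp only [eq_iff_iff]; tauto
  irrefl x := by
    rw [G.irrefl, if_neg]
    rintro (⟨rfl, h⟩ | ⟨rfl, h⟩)
    · exact hab h
    · exact hab h.symm

theorem deg_addEdge (G : MGraph α) {a b : α} (hab : a ≠ b) (v : α) (T : Finset α) :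
    (G.addEdge a b hab).deg v T =
      G.deg v T + (if v = a ∧ b ∈ T ∨ v = b ∧ a ∈ T then 1 else 0) := by
  unfold deg addEdge
  simp only [Finset.sum_add_distrib]
  congr 1
  by_cases h1 : v = a
  · subst h1; simp [hab]
  · by_cases h2 : v = b
    · subst h2; simp [h1]
    · simp [h1, h2]

theorem e_addEdge (G : MGraph α) {a b : α} (hab : a ≠ b) (T : Finset α) :
    (G.addEdge a b hab).e T = G.e T + (if a ∈ T ∧ b ∈ T then 1 else 0) := by
  induction T using Finset.induction_on with
  | empty => simp [e_empty]
  | insert v T hv ih =>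
    rw [e_insert _ hv, e_insert _ hv, ih, deg_addEdge, add_assoc, add_assoc]
    congr 1
    rw [add_left_comm]; congr 1
    by_cases h1 : a = v
    · subst h1; simp [hv, hab, hab.symm]
    · by_cases h2 : b = v
      · subst h2; simp [hv, hab, hab.symm]
      · simp [h1, h2, Ne.symm h1, Ne.symm h2]

theorem Forest.of_addEdge {G : MGraph α} {a b : α} {hab : a ≠ b} {F : Finset α}
    (h : (G.addEdge a b hab).Forest F) : G.Forest F := fun T hT hne => by
  have := h T hT hne
  rw [e_addEdge] at this; omega

theorem Bdd.of_addEdge {G : MGraph α} {D : ℕ} {w : α → ℕ} {a b : α} {hab : a ≠ b}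
    {M : Finset α} (h : (G.addEdge a b hab).Bdd D w M) : G.Bdd D w M := fun T hT hne => by
  have h1 := h T hT hne
  rw [e_addEdge] at h1
  exact ⟨by omega, fun ht => by have := h1.2 (by omega); omega⟩

/-- Subdividing an edge of a forest yields a forest. -/
theorem Forest.subdivide {G : MGraph α} {a b : α} {hab : a ≠ b} {F : Finset α}
    (h : (G.addEdge a b hab).Forest F) {v : α}
    (hd : ∀ T ⊆ F, G.deg v T ≤ 1 + (if a ∈ T ∧ b ∈ T then 1 else 0)) : G.Forest (Insert.insert v F) := by
  intro T hT hne
  by_cases hvT : v ∈ T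
  · obtain ⟨T, hvT', rfl⟩ : ∃ T', v ∉ T' ∧ Insert.insert v T' = T :=
      ⟨T.erase v, Finset.notMem_erase v T, Finset.insert_erase hvT⟩
    have hTF : T ⊆ F := fun x hx => by
      have := hT (Finset.mem_insert_of_mem hx)
      rw [Finset.mem_insert] at this
      exact this.resolve_left fun hh => hvT' (hh ▸ hx)
    rw [e_insert G hvT', Finset.card_insert_of_notMem hvT']
    rcases T.eq_empty_or_nonempty with rfl | hne'
    · simp [e_empty, deg_empty]
    · have h1 := h T hTF hne'
      rw [e_addEdge] at h1
      have := hd T hTF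
      omega
  · exact h.of_addEdge T (fun x hx => (Finset.mem_insert.1 (hT hx)).resolve_left
      (fun hh => hvT (hh ▸ hx))) hne

end MGraph

/-! ### Weight profiles and the potential -/

namespace MGraph

variable {α : Type*} [DecidableEq α]

/-- Weight costs `u` with edge cost `b`, for components with at most `D` edges. -/
structure Profile (D b : ℕ) (u : ℕ → ℕ) : Prop where
  zero : u 0 = 0
  mono : Monotone u
  subadd : ∀ i j, u (i + j) ≤ u i + u j
  top : ∀ j, D + 1 ≤ j → u j = b
  dual : ∀ j ≤ D + 1, u j + u (D + 1 - j) = b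
  step : ∀ j, u (j + 1) ≤ u j + 2
  three_le : 3 ≤ b

theorem Profile.le {D b : ℕ} {u : ℕ → ℕ} (P : Profile D b u) (j : ℕ) : u j ≤ b := by
  rw [← P.top (max j (D + 1)) (le_max_right _ _)]
  exact P.mono (le_max_left _ _)

theorem Profile.mul_le {D b : ℕ} {u : ℕ → ℕ} (P : Profile D b u) (n i : ℕ) :
    u (i * n) ≤ u i * n := by
  induction n with
  | zero => simp [P.zero]
  | succ n ih => rw [Nat.mul_succ, Nat.mul_succ]; exact (P.subadd _ _).trans (by omega)

/-- The potential of the vertex set `S`. -/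
def pot (b : ℕ) (u : ℕ → ℕ) (G : MGraph α) (w : α → ℕ) (S : Finset α) : ℤ :=
  ∑ v ∈ S, (2 * (b : ℤ) - 1 - u (w v)) - b * G.e S

section pot

variable {D b : ℕ} {u : ℕ → ℕ} {G : MGraph α} {w : α → ℕ}

theorem pot_insert {v : α} {S : Finset α} (h : v ∉ S) :
    pot b u G w (insert v S) =
      pot b u G w S + (2 * (b : ℤ) - 1 - u (w v)) - b * G.deg v S := by
  unfold pot
  rw [Finset.sum_insert h, e_insert G h]; push_cast; ring

theorem pot_singleton (v : α) : pot b u G w {v} = 2 * (b : ℤ) - 1 - u (w v) := by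
  simp [pot, e_singleton]

theorem pot_union {A B : Finset α} (h : Disjoint A B) :
    pot b u G w (A ∪ B) = pot b u G w A + pot b u G w B - b * G.cross A B := by
  unfold pot
  rw [Finset.sum_union h, e_union G h]; push_cast; ring

/-- The vertex part is modular and edge counts are supermodular, so the potential is submodular. -/
theorem pot_union_add_inter (A B : Finset α) :
    pot b u G w (A ∪ B) + pot b u G w (A ∩ B) ≤ pot b u G w A + pot b u G w B := by
  unfold pot
  have h1 := Finset.sum_union_inter (s₁ := A) (s₂ := B)
    (f := fun v => (2 * (b : ℤ) - 1 - u (w v)))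
  have h2 : (b : ℤ) * (G.e A + G.e B) ≤ b * (G.e (A ∪ B) + G.e (A ∩ B)) :=
    mul_le_mul_of_nonneg_left (by exact_mod_cast G.e_add_e_le A B) (by positivity)
  linarith

theorem pot_raise (P : Profile D b u) (r : α → ℕ) (T : Finset α) :
    pot b u G w T - ∑ v ∈ T, (u (r v) : ℤ) ≤ pot b u G (fun v => w v + r v) T := by
  unfold pot
  have : ∑ v ∈ T, (2 * (b : ℤ) - 1 - u (w v)) - ∑ v ∈ T, (u (r v) : ℤ) ≤
      ∑ v ∈ T, (2 * (b : ℤ) - 1 - u (w v + r v)) := by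
    rw [← Finset.sum_sub_distrib]
    refine Finset.sum_le_sum fun v _ => ?_
    have := P.subadd (w v) (r v)
    omega
  linarith

theorem pot_addEdge {a c : α} (hac : a ≠ c) (T : Finset α) :
    pot b u (G.addEdge a c hac) w T =
      pot b u G w T - (if a ∈ T ∧ c ∈ T then (b : ℤ) else 0) := by
  unfold pot
  rw [e_addEdge]
  split_ifs <;> push_cast <;> ring

theorem pot_singleton_ge (P : Profile D b u) (v : α) : (b : ℤ) - 1 ≤ pot b u G w {v} := by
  rw [pot_singleton]
  have := P.le (w v)
  omega

end pot

/-! ### Combining colourings of disjoint vertex sets -/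

theorem deg_congr {G G' : MGraph α} {v : α} {T : Finset α} (h : ∀ a ∈ T, G'.m v a = G.m v a) :
    G'.deg v T = G.deg v T := Finset.sum_congr rfl h

theorem e_congr {G G' : MGraph α} {T : Finset α} (h : ∀ a ∈ T, ∀ c ∈ T, G'.m a c = G.m a c) :
    G'.e T = G.e T := by
  unfold e
  rw [Finset.sum_congr rfl fun a ha => deg_congr (h a ha)]

/-- A set meeting both sides spans at most its size minus two edges, so it is never a tree and the
bound `D` says nothing about it. -/
theorem colorable_union {G : MGraph α} {D : ℕ} {w : α → ℕ} {A B : Finset α}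
    (hAB : Disjoint A B) (h0 : G.cross A B = 0) (hA : G.Colorable D w A)
    (hB : G.Colorable D w B) : G.Colorable D w (A ∪ B) := by
  obtain ⟨M1, F1, rfl, h1⟩ := hA
  obtain ⟨M2, F2, rfl, h2⟩ := hB
  have split : ∀ {X Y T : Finset α}, X ⊆ M1 ∪ F1 → Y ⊆ M2 ∪ F2 → T ⊆ X ∪ Y →
      T = (T ∩ X) ∪ (T ∩ Y) ∧ Disjoint (T ∩ X) (T ∩ Y) ∧
        G.e T = G.e (T ∩ X) + G.e (T ∩ Y) := by
    intro X Y T hX hY hT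
    have hd : Disjoint (T ∩ X) (T ∩ Y) :=
      hAB.mono (Finset.inter_subset_right.trans hX) (Finset.inter_subset_right.trans hY)
    have heq : T = (T ∩ X) ∪ (T ∩ Y) := by
      rw [← Finset.inter_union_distrib_left]; exact (Finset.inter_eq_left.2 hT).symm
    refine ⟨heq, hd, ?_⟩
    have h3 := G.e_union hd
    have h4 := G.cross_mono (Finset.inter_subset_right.trans hX : T ∩ X ⊆ _)
      (Finset.inter_subset_right.trans hY : T ∩ Y ⊆ _)
    rw [← heq] at h3; omega
  refine ⟨M1 ∪ M2, F1 ∪ F2, ?_, ?_, ?_, ?_⟩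
  · ext x; simp; tauto
  · rw [Finset.disjoint_union_left, Finset.disjoint_union_right, Finset.disjoint_union_right]
    exact ⟨⟨h1.disj, hAB.mono Finset.subset_union_left Finset.subset_union_right⟩,
      (hAB.mono Finset.subset_union_right Finset.subset_union_left).symm, h2.disj⟩
  · intro T hT hne
    obtain ⟨heq, hd, he⟩ := split Finset.subset_union_left Finset.subset_union_left hT
    rcases (T ∩ M1).eq_empty_or_nonempty with h | h
    · exact h2.bdd T (by rw [heq, h, Finset.empty_union]; exact Finset.inter_subset_right) hne
    rcases (T ∩ M2).eq_empty_or_nonempty with h' | h'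
    · exact h1.bdd T (by rw [heq, h', Finset.union_empty]; exact Finset.inter_subset_right) hne
    have a1 := h1.bdd _ Finset.inter_subset_right h
    have a2 := h2.bdd _ Finset.inter_subset_right h'
    have := Finset.card_union_of_disjoint hd
    rw [← heq] at this
    exact ⟨by omega, fun _ => by omega⟩
  · intro T hT hne
    obtain ⟨heq, hd, he⟩ := split Finset.subset_union_right Finset.subset_union_right hT
    rcases (T ∩ F1).eq_empty_or_nonempty with h | h
    · exact h2.forest T (by rw [heq, h, Finset.empty_union]; exact Finset.inter_subset_right) hne
    rcases (T ∩ F2).eq_empty_or_nonempty with h' | h'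
    · exact h1.forest T
        (by rw [heq, h', Finset.union_empty]; exact Finset.inter_subset_right) hne
    have a1 := h1.forest _ Finset.inter_subset_right h
    have a2 := h2.forest _ Finset.inter_subset_right h'
    have := Finset.card_union_of_disjoint hd
    rw [← heq] at this
    omega

/-- Replace the neighbourhood of `x` by the joint neighbourhood of the set `F`. -/
def contract (G : MGraph α) (F : Finset α) (x : α) : MGraph α where
  m a c := if a = x then (if c = x then 0 else G.deg c F) else
    if c = x then G.deg a F else G.m a c
  symm a c := by by_cases h1 : a = x <;> by_cases h2 : c = x <;> simp [h1, h2, G.symm a c]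
  irrefl a := by by_cases h1 : a = x <;> simp [h1, G.irrefl]

theorem contract_e (G : MGraph α) (F : Finset α) {x : α} {T : Finset α} (h : x ∉ T) :
    (G.contract F x).e T = G.e T := e_congr fun a ha c hc => by
  have h1 : a ≠ x := fun hh => h (hh ▸ ha)
  have h2 : c ≠ x := fun hh => h (hh ▸ hc)
  simp [contract, h1, h2]

theorem contract_deg (G : MGraph α) (F : Finset α) {x : α} {T : Finset α} (h : x ∉ T) :
    (G.contract F x).deg x T = G.cross T F := Finset.sum_congr rfl fun a ha => by
  have h1 : a ≠ x := fun hh => h (hh ▸ ha)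
  simp [contract, h1]

/-- The weights forced on the outside of a coloured set with `M`-part `M`: every edge to `M` forbids
the `M`-side, except that `y` keeps the slack `j` when `x ∈ M`. -/
def outerWeight (G : MGraph α) (D : ℕ) (M : Finset α) (x y : α) (j : ℕ) (a : α) : ℕ :=
  (D + 1) * G.deg a M - (if a = y ∧ x ∈ M then j else 0)

/-- In the reduced instance `z` stands for all of `F` and is too heavy for `M`. Weights keep every
outside `M`-vertex off the old `M`, except possibly for a single edge `xy`. Across that edge the
capacities add up: the tree at `x` has total at most `D - j`, the tree at `y` at most `j - 1`, and
the edge contributes 1. -/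
theorem colorable_of_contract {G : MGraph α} {D : ℕ} {w : α → ℕ} {S R M F : Finset α}
    {x y z : α} {j : ℕ} (hSR : Disjoint S R) (hz : z ∈ S) (hj : j ≤ D + 1)
    (hxy : 1 ≤ G.m y x) (hMF : M ∪ F = S)
    (hc : G.Col D (fun v => w v + if v = x then j else 0) M F)
    (h : (G.contract F z).Colorable D
      (fun a => if a = z then D + 1 else w a + G.outerWeight D M x y j a) (insert z R)) :
    G.Colorable D w (S ∪ R) := by
  obtain ⟨M2, F2, hU, hc2⟩ := h
  have hzR : z ∉ R := Finset.disjoint_left.1 hSR hz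
  have hzM2 : z ∉ M2 := fun hh => by have := hc2.bdd.weight_le hh; simp at this
  have hzF2 : z ∈ F2 := by
    have : z ∈ M2 ∪ F2 := hU ▸ Finset.mem_insert_self z R
    exact (Finset.mem_union.1 this).resolve_left hzM2
  have hM2R : M2 ⊆ R := fun a ha => by
    have : a ∈ insert z R := hU ▸ Finset.mem_union_left _ ha
    exact (Finset.mem_insert.1 this).resolve_left fun hh => hzM2 (hh ▸ ha)
  have hF2R : F2.erase z ⊆ R := fun a ha => by
    have : a ∈ insert z R := hU ▸ Finset.mem_union_right _ (Finset.mem_of_mem_erase ha)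
    exact (Finset.mem_insert.1 this).resolve_left (Finset.ne_of_mem_erase ha)
  have hMS : M ⊆ S := hMF ▸ Finset.subset_union_left
  have hFS : F ⊆ S := hMF ▸ Finset.subset_union_right
  have split : ∀ {X Y T : Finset α}, X ⊆ S → Y ⊆ R → T ⊆ X ∪ Y →
      T = (T ∩ X) ∪ (T ∩ Y) ∧ Disjoint (T ∩ X) (T ∩ Y) := by
    intro X Y T hX hY hT
    refine ⟨?_, hSR.mono (Finset.inter_subset_right.trans hX)
      (Finset.inter_subset_right.trans hY)⟩
    rw [← Finset.inter_union_distrib_left]; exact (Finset.inter_eq_left.2 hT).symm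
  refine ⟨M ∪ M2, F ∪ F2.erase z, ?_, ?_, ?_, ?_⟩
  · ext a
    have h1 : a ∈ S ↔ a ∈ M ∨ a ∈ F := by rw [← hMF, Finset.mem_union]
    have h2 : a ∈ M2 ∨ a ∈ F2 ↔ a = z ∨ a ∈ R := by
      rw [← Finset.mem_union, hU, Finset.mem_insert]
    simp only [Finset.mem_union, Finset.mem_erase]
    by_cases haz : a = z
    · subst haz; simp [hz]; tauto
    · tauto
  · rw [Finset.disjoint_union_left, Finset.disjoint_union_right, Finset.disjoint_union_right]
    exact ⟨⟨hc.disj, hSR.mono hMS hF2R⟩, (hSR.mono hFS hM2R).symm,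
      hc2.disj.mono_right (Finset.erase_subset _ _)⟩
  · intro T hT hne
    obtain ⟨heq, hd⟩ := split hMS hM2R hT
    have hzT : z ∉ T ∩ M2 := fun hh => hzM2 (Finset.mem_inter.1 hh).2
    have hw2 : ∀ a ∈ T ∩ M2, (if a = z then D + 1 else w a + G.outerWeight D M x y j a) =
        w a + G.outerWeight D M x y j a := by
      intro a ha
      rw [if_neg]
      rintro rfl
      exact hzT ha
    rcases (T ∩ M2).eq_empty_or_nonempty with h' | h'
    · exact (hc.bdd.weaken (w' := w) (by intro v _; simp)) T
        (by rw [heq, h', Finset.union_empty]; exact Finset.inter_subset_right) hne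
    have a2 := hc2.bdd _ Finset.inter_subset_right h'
    rw [contract_e G F hzT, Finset.sum_congr rfl hw2] at a2
    rcases (T ∩ M).eq_empty_or_nonempty with h'' | h''
    · have hT2 : T ∩ M2 = T := by
        conv_rhs => rw [heq, h'', Finset.empty_union]
      rw [hT2] at a2
      refine ⟨a2.1, fun ht => le_trans (Nat.add_le_add_left (Finset.sum_le_sum ?_) _) (a2.2 ht)⟩
      intro a _; omega
    have a1 := hc.bdd _ Finset.inter_subset_right h''
    have hcard := Finset.card_union_of_disjoint hd
    rw [← heq] at hcard
    have he := G.e_union hd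
    rw [← heq, cross_comm] at he
    -- An edge to `M` costs weight `D + 1`, and only `y` receives a discount, of at most one edge.
    have key : ∀ a ∈ T ∩ M2, G.deg a M ≠ 0 → a = y ∧ x ∈ M ∧ G.deg a M = 1 := by
      intro a ha hdeg
      have h1 := hc2.bdd.weight_le (Finset.mem_inter.1 ha).2
      rw [hw2 a ha] at h1
      unfold outerWeight at h1
      have h2 : (D + 1) * 1 ≤ (D + 1) * G.deg a M := Nat.mul_le_mul_left _ (by omega)
      by_cases hs : a = y ∧ x ∈ M
      · rw [if_pos hs] at h1
        refine ⟨hs.1, hs.2, ?_⟩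
        by_contra hne1
        have h3 : (D + 1) * 2 ≤ (D + 1) * G.deg a M := Nat.mul_le_mul_left _ (by omega)
        omega
      · rw [if_neg hs] at h1; omega
    have hcross : G.cross (T ∩ M2) (T ∩ M) = 0 ∨
        (y ∈ T ∩ M2 ∧ x ∈ T ∩ M ∧ G.cross (T ∩ M2) (T ∩ M) = 1 ∧ G.deg y M = 1) := by
      by_cases hs : y ∈ T ∩ M2 ∧ x ∈ T ∩ M
      · have hxM := (Finset.mem_inter.1 hs.2).2
        have h1 := G.m_le_deg y hs.2
        have h2 := G.deg_mono y (Finset.inter_subset_right : T ∩ M ⊆ M)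
        have h3 := key y hs.1 (by omega)
        right
        refine ⟨hs.1, hs.2, ?_, h3.2.2⟩
        unfold cross
        rw [Finset.sum_eq_single_of_mem y hs.1]
        · omega
        · intro a ha hay
          by_contra hne0
          have h2 := G.deg_mono a (Finset.inter_subset_right : T ∩ M ⊆ M)
          exact hay (key a ha (by omega)).1
      · left
        refine Finset.sum_eq_zero fun a ha => ?_
        by_contra hne0
        have h2 := G.deg_mono a (Finset.inter_subset_right : T ∩ M ⊆ M)
        obtain ⟨rfl, hxM, h3⟩ := key a ha (by omega)
        have hxT : x ∉ T ∩ M := fun hh => hs ⟨ha, hh⟩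
        have h4 := G.deg_insert a hxT
        have h5 := G.deg_mono a (A := insert x (T ∩ M)) (B := M)
          (Finset.insert_subset hxM Finset.inter_subset_right)
        omega
    have hsum : ∑ v ∈ T, w v = ∑ v ∈ T ∩ M, w v + ∑ v ∈ T ∩ M2, w v := by
      conv_lhs => rw [heq]
      exact Finset.sum_union hd
    rcases hcross with h0 | ⟨hy, hx', h1, hdy⟩
    · exact ⟨by omega, fun ht => by omega⟩
    · refine ⟨by omega, fun ht => ?_⟩
      have b1 := a1.2 (by omega)
      have b2 := a2.2 (by omega)
      rw [Finset.sum_add_distrib, Finset.sum_ite_eq' (T ∩ M) x, if_pos hx'] at b1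
      rw [Finset.sum_add_distrib] at b2
      have b3 : G.outerWeight D M x y j y ≤ ∑ a ∈ T ∩ M2, G.outerWeight D M x y j a :=
        Finset.single_le_sum (f := fun a => G.outerWeight D M x y j a) (by simp) hy
      have b4 : G.outerWeight D M x y j y = D + 1 - j := by
        unfold outerWeight
        rw [hdy, if_pos ⟨rfl, (Finset.mem_inter.1 hx').2⟩, Nat.mul_one]
      omega
  · intro T hT hne
    obtain ⟨heq, hd⟩ := split hFS hF2R hT
    rcases (T ∩ F).eq_empty_or_nonempty with h'' | h''
    · have hT2 : T ∩ F2.erase z = T := by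
        conv_rhs => rw [heq, h'', Finset.empty_union]
      have hzT : z ∉ T := fun hh => by
        rw [← hT2] at hh
        exact Finset.notMem_erase z F2 (Finset.mem_inter.1 hh).2
      have := hc2.forest T (by
        rw [← hT2]; exact Finset.inter_subset_right.trans (Finset.erase_subset _ _)) hne
      rwa [contract_e G F hzT] at this
    · have a1 := hc.forest _ Finset.inter_subset_right h''
      have hzT : z ∉ T ∩ F2.erase z := fun hh =>
        Finset.notMem_erase z F2 (Finset.mem_inter.1 hh).2
      -- The forest condition with `z` added bounds the edges inside the outer part together with
      -- those to `F`. Adding the count for `T ∩ F` gives the count for `T`, since `z` accounts for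
      -- the extra one.
      have a2 := hc2.forest (insert z (T ∩ F2.erase z)) (Finset.insert_subset hzF2
        (Finset.inter_subset_right.trans (Finset.erase_subset _ _))) (by simp)
      rw [e_insert _ hzT, contract_e G F hzT, contract_deg G F hzT,
        Finset.card_insert_of_notMem hzT] at a2
      have hcard := Finset.card_union_of_disjoint hd
      rw [← heq] at hcard
      have he := G.e_union hd
      rw [← heq, cross_comm] at he
      have := G.cross_mono (Finset.Subset.refl (T ∩ F2.erase z))
        (Finset.inter_subset_right : T ∩ F ⊆ F)
      omega

end MGraph

/-! ### Minimal counterexamples and the gap lemma -/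

namespace MGraph

variable {α : Type*} [DecidableEq α]

theorem pot_congr {b : ℕ} {u : ℕ → ℕ} {G G' : MGraph α} {w w' : α → ℕ} {T : Finset α}
    (hw : ∀ a ∈ T, w' a = w a) (hG : G'.e T = G.e T) :
    pot b u G' w' T = pot b u G w T := by
  unfold pot
  rw [hG, Finset.sum_congr rfl fun a ha => by rw [hw a ha]]

/-- A vertex-critical weighted multigraph of too large potential, with no smaller such. -/
structure Counterexample (D b : ℕ) (u : ℕ → ℕ) (G : MGraph α) (w : α → ℕ) (V : Finset α) :
    Prop where
  ih : ∀ (G' : MGraph α) (w' : α → ℕ) (V' : Finset α), V'.card < V.card →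
    (∀ T ⊆ V', T.Nonempty → -1 ≤ pot b u G' w' T) → G'.Colorable D w' V'
  not_colorable : ¬ G.Colorable D w V
  crit : ∀ S ⊂ V, G.Colorable D w S
  pot_ge : -1 ≤ pot b u G w V

/-- Replacing edges to `M` by weight never costs more than the edges did. At `y` the duality `u j +
u (D + 1 - j) = b` shows that the discount `j` saves a further `u j`. -/
theorem outerWeight_cost {D b : ℕ} {u : ℕ → ℕ} (P : Profile D b u) {G : MGraph α}
    {M : Finset α} {x y : α} {j : ℕ} (hj : j ≤ D + 1) (hxy : 1 ≤ G.m y x) (a : α) :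
    u (G.outerWeight D M x y j a) + (if a = y ∧ x ∈ M then u j else 0) ≤ b * G.deg a M := by
  unfold outerWeight
  split_ifs with h
  · obtain ⟨rfl, hx⟩ := h
    have h1 := G.m_le_deg a hx
    obtain ⟨k, hk⟩ : ∃ k, G.deg a M = k + 1 := ⟨G.deg a M - 1, by omega⟩
    rw [hk, Nat.mul_succ, Nat.mul_succ, Nat.add_sub_assoc hj]
    have h2 := P.subadd ((D + 1) * k) (D + 1 - j)
    have h3 := P.mul_le k (D + 1)
    rw [P.top _ le_rfl] at h3
    have h4 := P.dual j hj
    omega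
  · have h3 := P.mul_le (G.deg a M) (D + 1)
    rw [P.top _ le_rfl] at h3
    simpa using h3

namespace Counterexample

variable {D b : ℕ} {u : ℕ → ℕ} {G : MGraph α} {w : α → ℕ} {V : Finset α}

theorem exists_edge (C : Counterexample D b u G w V) {S : Finset α} (hS : S ⊂ V)
    (hne : S.Nonempty) : ∃ x ∈ S, ∃ y ∈ V \ S, 1 ≤ G.m y x := by
  by_contra hcon
  push Not at hcon
  refine C.not_colorable ?_
  rw [← Finset.union_sdiff_of_subset hS.1]
  refine colorable_union Finset.disjoint_sdiff ?_ (C.crit S hS) (C.crit _ ?_)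
  · refine Finset.sum_eq_zero fun a ha => Finset.sum_eq_zero fun c hc => ?_
    have := hcon a ha c hc
    rw [G.symm]; omega
  · exact Finset.sdiff_ssubset hS.1 hne

/-- A colouring of `S` that leaves slack `j` at `x` yields a smaller instance without colouring,
hence a set `T` of potential below `-1`. Undoing the reduction, `S` together with the outer part of
`T` has smaller potential than `S`, so by minimality it is all of `V`. Comparing with `pot V ≥ -1`
bounds `pot S` below, and the slack contributes `u j` when `x` lies in `M`. -/
theorem gap_step (C : Counterexample D b u G w V) (P : Profile D b u) {S : Finset α}
    (hS : S ⊂ V) (h2 : 2 ≤ S.card)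
    (hmin : ∀ S' ⊂ V, 2 ≤ S'.card → pot b u G w S ≤ pot b u G w S') {x y : α} (hx : x ∈ S)
    (hy : y ∈ V \ S) (hxy : 1 ≤ G.m y x) {j : ℕ} (hj : j ≤ D + 1)
    (hc : G.Colorable D (fun v => w v + if v = x then j else 0) S) :
    (b : ℤ) ≤ pot b u G w S ∨ 1 + (u j : ℤ) ≤ pot b u G w S := by
  obtain ⟨M, F, hMF, hcol⟩ := hc
  set R := V \ S with hR
  have hSR : Disjoint S R := Finset.disjoint_sdiff
  have hV : S ∪ R = V := Finset.union_sdiff_of_subset hS.1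
  have hxR : x ∉ R := Finset.disjoint_left.1 hSR hx
  set G' := G.contract F x
  set w' : α → ℕ := fun a => if a = x then D + 1 else w a + G.outerWeight D M x y j a
  have hnc : ¬ G'.Colorable D w' (insert x R) := fun h => C.not_colorable
    (hV ▸ colorable_of_contract hSR hx hj hxy hMF hcol h)
  have hcard : (insert x R).card < V.card := by
    rw [Finset.card_insert_of_notMem hxR, hR, Finset.card_sdiff_of_subset hS.1]
    have := Finset.card_lt_card hS
    omega
  have hex : ∃ T ⊆ insert x R, T.Nonempty ∧ pot b u G' w' T < -1 := by
    by_contra hcon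
    push Not at hcon
    exact hnc (C.ih G' w' _ hcard hcon)
  obtain ⟨T, hT, hne, hpot⟩ := hex
  have hdMF : Disjoint M F := hcol.disj
  have bound : ∀ T2 ⊆ R, pot b u G w T2 - b * G.cross T2 M +
      (if y ∈ T2 ∧ x ∈ M then (u j : ℤ) else 0) ≤ pot b u G' w' T2 := by
    intro T2 hT2
    have hxT2 : x ∉ T2 := fun hh => hxR (hT2 hh)
    have h1 := pot_raise (G := G) (w := w) P (fun a => G.outerWeight D M x y j a) T2
    have h3 : pot b u G' w' T2 =
        pot b u G (fun a => w a + G.outerWeight D M x y j a) T2 := by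
      refine pot_congr (fun a ha => ?_) (contract_e G F hxT2)
      exact if_neg (by rintro rfl; exact hxT2 ha)
    have h4 : ∑ a ∈ T2, (u (G.outerWeight D M x y j a) : ℤ) +
        (if y ∈ T2 ∧ x ∈ M then (u j : ℤ) else 0) ≤ b * G.cross T2 M := by
      have h5 : ∑ a ∈ T2, (u (G.outerWeight D M x y j a) +
          (if a = y ∧ x ∈ M then u j else 0)) ≤ ∑ a ∈ T2, b * G.deg a M :=
        Finset.sum_le_sum fun a _ => outerWeight_cost P hj hxy a
      rw [Finset.sum_add_distrib, ← Finset.mul_sum] at h5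
      have h6 : ∑ a ∈ T2, (if a = y ∧ x ∈ M then u j else 0) =
          if y ∈ T2 ∧ x ∈ M then u j else 0 := by
        by_cases hxM : x ∈ M <;> simp [hxM]
      rw [h6] at h5
      have h7 : (∑ a ∈ T2, (u (G.outerWeight D M x y j a)) : ℤ) +
        ((if y ∈ T2 ∧ x ∈ M then u j else 0 : ℕ) : ℤ) ≤ ((b * G.cross T2 M : ℕ) : ℤ) := by
        exact_mod_cast h5
      push_cast at h7
      exact h7
    linarith
  have hun : ∀ T2 ⊆ R, pot b u G w (S ∪ T2) =
      pot b u G w S + pot b u G w T2 - b * G.cross T2 M - b * G.cross T2 F := by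
    intro T2 hT2
    rw [pot_union (hSR.mono_right hT2), cross_comm, ← hMF, cross_union_right _ _ hdMF]
    push_cast; ring
  have hfull : ∀ T2 ⊆ R, pot b u G w (S ∪ T2) < pot b u G w S → T2 = R := by
    intro T2 hT2 hlt
    by_contra hne2
    have hss : S ∪ T2 ⊂ V := by
      rw [← hV]
      refine Finset.ssubset_iff_subset_ne.2 ⟨Finset.union_subset_union_right hT2, fun hh => hne2 ?_⟩
      refine Finset.Subset.antisymm hT2 fun a ha => ?_
      have : a ∈ S ∪ T2 := hh ▸ Finset.mem_union_right _ ha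
      exact (Finset.mem_union.1 this).resolve_left fun h => Finset.disjoint_left.1 hSR h ha
    have := hmin _ hss (h2.trans (Finset.card_le_card Finset.subset_union_left))
    omega
  have hb := P.three_le
  -- If the contracted vertex lies in `T`, its own contribution is `2b - 1 - b = b - 1`, so the rest
  -- falls short by a full `b`.
  by_cases hxT : x ∈ T
  · obtain ⟨T2, hxT2, rfl⟩ : ∃ T', x ∉ T' ∧ insert x T' = T :=
      ⟨T.erase x, Finset.notMem_erase x T, Finset.insert_erase hxT⟩
    have hT2 : T2 ⊆ R := fun a ha =>
      (Finset.mem_insert.1 (hT (Finset.mem_insert_of_mem ha))).resolve_left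
        fun hh => hxT2 (hh ▸ ha)
    have h1 := bound T2 hT2
    have h3 := hun T2 hT2
    rw [pot_insert hxT2, contract_deg G F hxT2] at hpot
    have h4 : w' x = D + 1 := if_pos rfl
    rw [h4, P.top _ le_rfl] at hpot
    have h5 : (0 : ℤ) ≤ if y ∈ T2 ∧ x ∈ M then (u j : ℤ) else 0 := by positivity
    have h6 : T2 = R := hfull T2 hT2 (by linarith)
    rw [h6, hV] at h3
    rw [h6] at h1 hpot
    have h7 := C.pot_ge
    left
    split_ifs at h1 <;> linarith
  · have hT2 : T ⊆ R := fun a ha =>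
      (Finset.mem_insert.1 (hT ha)).resolve_left fun hh => hxT (hh ▸ ha)
    have h1 := bound T hT2
    have h3 := hun T hT2
    have h5 : (0 : ℤ) ≤ if y ∈ T ∧ x ∈ M then (u j : ℤ) else 0 := by positivity
    have h8 : (0 : ℤ) ≤ b * G.cross T F := by positivity
    have h6 : T = R := hfull T hT2 (by linarith)
    subst h6
    rw [hV] at h3
    have h7 := C.pot_ge
    -- Here `T` is all of `R`. The edge `xy` either gives the discount `u j` (`x ∈ M`) or is an
    -- uncounted edge to `F` worth `b`.
    by_cases hxM : x ∈ M
    · rw [if_pos ⟨hy, hxM⟩] at h1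
      right; linarith
    · have hxF : x ∈ F := (Finset.mem_union.1 (hMF ▸ hx)).resolve_left hxM
      have h9 : 1 ≤ G.cross R F :=
        (hxy.trans (G.m_le_deg y hxF)).trans
          (Finset.single_le_sum (f := fun a => G.deg a F) (by simp) hy)
      have h10 : (b : ℤ) * 1 ≤ b * G.cross R F :=
        mul_le_mul_of_nonneg_left (by exact_mod_cast h9) (by positivity)
      left; linarith

/-- Proper subsets with at least two vertices have potential at least `b`. -/
theorem gap (C : Counterexample D b u G w V) (P : Profile D b u) {S : Finset α}
    (hS : S ⊂ V) (h2 : 2 ≤ S.card) : (b : ℤ) ≤ pot b u G w S := by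
  obtain ⟨S0, hS0, hmin⟩ := Finset.exists_min_image
    (V.powerset.filter fun S => S ⊂ V ∧ 2 ≤ S.card) (pot b u G w)
    ⟨S, by simp [hS, h2, hS.1]⟩
  simp only [Finset.mem_filter, Finset.mem_powerset] at hS0 hmin
  have hmin' : ∀ S' ⊂ V, 2 ≤ S'.card → pot b u G w S0 ≤ pot b u G w S' :=
    fun S' h h' => hmin S' ⟨h.1, h, h'⟩
  refine le_trans ?_ (hmin' S hS h2)
  obtain ⟨x, hx, y, hy, hxy⟩ := C.exists_edge hS0.2.1
    (Finset.card_pos.1 (lt_of_lt_of_le (by norm_num) hS0.2.2))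
  by_contra hlt
  -- Bootstrapping on `j`: colourability with slack `j` gives `pot S0 ≥ 1 + u j`. As `u (j + 1) ≤ u
  -- j + 2`, raising the weight of `x` to slack `j + 1` leaves the potentials at least `-1`. At `j =
  -- D + 1` the bound exceeds `b`.
  have key : ∀ j ≤ D + 1, G.Colorable D (fun v => w v + if v = x then j else 0) S0 := by
    intro j
    induction j with
    | zero => intro _; simpa using C.crit S0 hS0.2.1
    | succ j ih =>
      intro hj
      have h1 := (C.gap_step P hS0.2.1 hS0.2.2 hmin' hx hy hxy (by omega)
        (ih (by omega))).resolve_left hlt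
      refine C.ih _ _ _ (Finset.card_lt_card hS0.2.1) fun T hT hne => ?_
      have h3 := P.step j
      have hb := P.three_le
      rcases Nat.lt_or_ge T.card 2 with h | h
      · obtain ⟨v, rfl⟩ := Finset.card_eq_one.1 (show T.card = 1 by
          have := hne.card_pos; omega)
        exact le_trans (by omega) (pot_singleton_ge P v)
      · have h4 := pot_raise (G := G) (w := w) P (fun v => if v = x then j + 1 else 0) T
        have h5 := hmin' T (Finset.ssubset_of_subset_of_ssubset hT hS0.2.1) h
        have h6 : ∑ v ∈ T, (u (if v = x then j + 1 else 0) : ℤ) ≤ u (j + 1) := by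
          have : ∀ v, (u (if v = x then j + 1 else 0) : ℤ) =
              if v = x then (u (j + 1) : ℤ) else 0 := by
            intro v; split_ifs <;> simp [P.zero]
          simp only [this, Finset.sum_ite_eq']
          split_ifs <;> simp
        omega
  have h1 := (C.gap_step P hS0.2.1 hS0.2.2 hmin' hx hy hxy le_rfl
    (key _ le_rfl)).resolve_left hlt
  rw [P.top _ le_rfl] at h1
  omega

end Counterexample

end MGraph

/-! ### Vertices of low degree in a minimal counterexample -/

namespace MGraph

variable {α : Type*} [DecidableEq α]

theorem Forest.singleton (G : MGraph α) (v : α) : G.Forest {v} :=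
  (Forest.empty G).insert (v := v) (by simp [deg_empty])

theorem Bdd.singleton (G : MGraph α) {D : ℕ} {w : α → ℕ} {v : α} (h : w v ≤ D) :
    G.Bdd D w {v} :=
  (Bdd.empty G D w).insert (v := v) (by simp [deg_empty]) h (by simp) (by simp)

theorem Col.insert_right {G : MGraph α} {D : ℕ} {w : α → ℕ} {M F : Finset α}
    (h : G.Col D w M F) {v : α} (hv : v ∉ M) (hd : G.deg v F ≤ 1) :
    G.Col D w M (insert v F) :=
  ⟨Finset.disjoint_insert_right.2 ⟨hv, h.disj⟩, h.bdd, h.forest.insert hd⟩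

theorem Col.insert_left {G : MGraph α} {D : ℕ} {w w' : α → ℕ} {M F : Finset α}
    (h : G.Col D w' M F) {v : α} (hv : v ∉ F) (hd : G.deg v M ≤ 1) (hwv : w v ≤ D)
    (hw : ∀ y ∈ M, w y ≤ w' y) (hn : ∀ y ∈ M, G.m v y ≠ 0 → w y + w v + 1 ≤ w' y) :
    G.Col D w (insert v M) F :=
  ⟨Finset.disjoint_insert_left.2 ⟨hv, h.disj⟩, h.bdd.insert hd hwv hw hn, h.forest⟩

theorem Col.weaken {G : MGraph α} {D : ℕ} {w w' : α → ℕ} {M F : Finset α}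
    (h : G.Col D w' M F) (hw : ∀ y ∈ M, w y ≤ w' y) : G.Col D w M F :=
  ⟨h.disj, h.bdd.weaken hw, h.forest⟩

/-- A vertex of degree at most three can be added to a colouring with enough slack at its simple
neighbours. -/
theorem Col.extend {G : MGraph α} {D : ℕ} {w w' : α → ℕ} {M F : Finset α}
    (h : G.Col D w' M F) {v : α} (hvM : v ∉ M) (hvF : v ∉ F) (hd : G.deg v (M ∪ F) ≤ 3)
    (hwv : w v ≤ D) (hw : ∀ y ∈ M, w y ≤ w' y)
    (hn : ∀ y ∈ M, G.m v y = 1 → 2 ≤ G.deg v F → w y + w v + 1 ≤ w' y) :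
    ∃ M' F', M' ∪ F' = insert v (M ∪ F) ∧ M' ⊆ insert v M ∧ F' ⊆ insert v F ∧
      G.Col D w M' F' := by
  rw [deg_union G v h.disj] at hd
  rcases Nat.lt_or_ge (G.deg v F) 2 with h1 | h1
  · exact ⟨M, insert v F, by rw [Finset.union_insert], Finset.subset_insert _ _,
      Finset.Subset.refl _, (h.weaken hw).insert_right hvM (by omega)⟩
  · refine ⟨insert v M, F, by rw [Finset.insert_union], Finset.Subset.refl _,
      Finset.subset_insert _ _, h.insert_left hvF (by omega) hwv hw fun y hy hm => ?_⟩
    have := G.m_le_deg v hy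
    exact hn y hy (by omega) h1

/-- By the handshake identity, each summand is the charge of a vertex in the discharging arguments.
-/
theorem two_mul_pot {b : ℕ} {u : ℕ → ℕ} {G : MGraph α} {w : α → ℕ} (V : Finset α) :
    2 * pot b u G w V = ∑ v ∈ V, (2 * (2 * (b : ℤ) - 1 - u (w v)) - b * G.deg v V) := by
  unfold pot
  have h := G.two_mul_e V
  have h' : (2 * G.e V : ℤ) = ∑ v ∈ V, (G.deg v V : ℤ) := by exact_mod_cast h
  rw [Finset.sum_sub_distrib (f := fun v => 2 * (2 * (b : ℤ) - 1 - u (w v))), ← Finset.mul_sum,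
    ← Finset.mul_sum, ← h']
  ring

theorem deg_erase_self (G : MGraph α) (v : α) (T : Finset α) :
    G.deg v (T.erase v) = G.deg v T := by
  by_cases h : v ∈ T
  · conv_rhs => rw [← Finset.insert_erase h, deg_insert_self]
  · rw [Finset.erase_eq_of_notMem h]

namespace Counterexample

variable {D b : ℕ} {u : ℕ → ℕ} {G : MGraph α} {w : α → ℕ} {V : Finset α}

theorem false_of_colorable_erase (C : Counterexample D b u G w V) {v : α} (hv : v ∈ V)
    (h : ∀ M F, M ∪ F = V.erase v → G.Col D w M F → v ∉ M → v ∉ F →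
      ∃ M' F', M' ∪ F' = insert v (M ∪ F) ∧ G.Col D w M' F') : False := by
  obtain ⟨M, F, hMF, hc⟩ := C.crit _ (Finset.erase_ssubset hv)
  have hv' : v ∉ M ∪ F := hMF ▸ Finset.notMem_erase v V
  rw [Finset.mem_union, not_or] at hv'
  obtain ⟨M', F', h1, h2⟩ := h M F hMF hc hv'.1 hv'.2
  rw [hMF, Finset.insert_erase hv] at h1
  exact C.not_colorable ⟨M', F', h1, h2⟩

theorem two_le_deg (C : Counterexample D b u G w V) {v : α} (hv : v ∈ V) :
    2 ≤ G.deg v V := by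
  by_contra hlt
  refine C.false_of_colorable_erase hv fun M F hMF hc hM hF => ?_
  refine ⟨M, insert v F, by rw [Finset.union_insert], hc.insert_right hM ?_⟩
  have h1 : G.deg v F ≤ G.deg v V := G.deg_mono v
    ((Finset.subset_union_right.trans hMF.subset).trans (Finset.erase_subset _ _))
  omega

theorem three_le_deg (C : Counterexample D b u G w V) {v : α} (hv : v ∈ V) (hw : w v ≤ D) :
    3 ≤ G.deg v V := by
  by_contra hlt
  refine C.false_of_colorable_erase hv fun M F hMF hc hM hF => ?_
  have h1 : G.deg v (M ∪ F) ≤ G.deg v V := G.deg_mono v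
    (hMF.subset.trans (Finset.erase_subset _ _))
  rw [deg_union G v hc.disj] at h1
  rcases Nat.lt_or_ge (G.deg v F) 2 with h2 | h2
  · exact ⟨M, insert v F, by rw [Finset.union_insert], hc.insert_right hM (by omega)⟩
  · refine ⟨insert v M, F, by rw [Finset.insert_union],
      hc.insert_left hF (by omega) hw (by simp) fun y hy hm => ?_⟩
    have := G.m_le_deg v hy
    omega

/-- Colourability of a proper subset after a modification, when the potentials of all its subsets
with at least two vertices stay large. -/
theorem colorable_of_pot (C : Counterexample D b u G w V) (P : Profile D b u) {V' : Finset α}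
    (hV' : V' ⊂ V) (G' : MGraph α) (w' : α → ℕ)
    (h : ∀ T ⊆ V', 2 ≤ T.card → -1 ≤ pot b u G' w' T) : G'.Colorable D w' V' := by
  refine C.ih G' w' V' (Finset.card_lt_card hV') fun T hT hne => ?_
  rcases Nat.lt_or_ge T.card 2 with h' | h'
  · obtain ⟨v, rfl⟩ := Finset.card_eq_one.1 (show T.card = 1 by
      have := hne.card_pos; omega)
    have := P.three_le
    exact le_trans (by omega) (pot_singleton_ge P v)
  · exact h T hT h'

/-- Extension of a coloring with raised simple neighbours of a vertex of degree three. -/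
theorem false_of_raise (C : Counterexample D b u G w V) {v : α} (hv : v ∈ V)
    (hd : G.deg v V = 3) (hw : w v ≤ D)
    (h : G.Colorable D (fun a => w a + if G.m v a = 1 then w v + 1 else 0) (V.erase v)) :
    False := by
  obtain ⟨M, F, hMF, hc⟩ := h
  have hv' : v ∉ M ∪ F := hMF ▸ Finset.notMem_erase v V
  rw [Finset.mem_union, not_or] at hv'
  obtain ⟨M', F', h1, -, -, h2⟩ := hc.extend (w := w) hv'.1 hv'.2
    (by rw [hMF, deg_erase_self, hd]) hw (by simp) (by
      intro y _ hm _
      rw [if_pos hm]; omega)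
  rw [hMF, Finset.insert_erase hv] at h1
  exact C.not_colorable ⟨M', F', h1, h2⟩

theorem sum_ite_one_le_deg (G : MGraph α) (v : α) (T : Finset α) :
    ∑ a ∈ T, (if G.m v a = 1 then 1 else 0) ≤ G.deg v T :=
  Finset.sum_le_sum fun a _ => by split_ifs <;> omega

theorem pot_raise_simple (P : Profile D b u) (v : α) (k : ℕ) (T : Finset α) :
    pot b u G w T - u k * (∑ a ∈ T, (if G.m v a = 1 then 1 else 0) : ℕ) ≤
      pot b u G (fun a => w a + if G.m v a = 1 then k else 0) T := by
  refine le_trans (le_of_eq ?_) (pot_raise P (fun a => if G.m v a = 1 then k else 0) T)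
  congr 1
  push_cast
  rw [Finset.mul_sum]
  refine Finset.sum_congr rfl fun a _ => ?_
  split_ifs <;> simp [P.zero]

/-- A multiple edge at `v` leaves at most one simple neighbour to raise, at a cost of at most `b`,
which the gap covers. -/
theorem m_le_one (C : Counterexample D b u G w V) (P : Profile D b u) {v : α} (hv : v ∈ V)
    (hd : G.deg v V = 3) (hw : w v ≤ D) {y : α} (hy : y ∈ V) : G.m v y ≤ 1 := by
  by_contra hm
  refine C.false_of_raise hv hd hw (C.colorable_of_pot P (Finset.erase_ssubset hv) _ _ ?_)
  intro T hT h2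
  have h1 := C.gap P (lt_of_le_of_lt hT (Finset.erase_ssubset hv)) h2
  refine le_trans ?_ (pot_raise_simple P v (w v + 1) T)
  have h3 : ∑ a ∈ T, (if G.m v a = 1 then 1 else 0) ≤ 1 := by
    have h4 : ∑ a ∈ T, (if G.m v a = 1 then 1 else 0) ≤
        ∑ a ∈ V.erase y, (if G.m v a = 1 then 1 else 0) := by
      rw [← Finset.sum_erase T (a := y) (if_neg (by omega))]
      exact Finset.sum_le_sum_of_subset
        (Finset.erase_subset_erase _ (hT.trans (Finset.erase_subset _ _)))
    have h5 := sum_ite_one_le_deg G v (V.erase y)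
    have h6 := G.deg_insert v (Finset.notMem_erase y V)
    rw [Finset.insert_erase hy] at h6
    omega
  have h7 : (u (w v + 1) : ℤ) * (∑ a ∈ T, (if G.m v a = 1 then 1 else 0) : ℕ) ≤ b * 1 :=
    mul_le_mul (by exact_mod_cast P.le _) (by exact_mod_cast h3) (by positivity) (by positivity)
  linarith

/-- If it failed, the three neighbours of `v` could be raised by `w v + 1` after deleting `v`. A set
`T` with one edge to `v` is covered by the gap. With two or three edges, comparison with `T ∪ {v}`
gives `pot T ≥ b + 1 + u (w v)` or `pot T ≥ b + u (w v)`; only in the last case can `T ∪ {v}` be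
`V`. -/
theorem lt_of_deg_eq_three (C : Counterexample D b u G w V) (P : Profile D b u) {v : α}
    (hv : v ∈ V) (hd : G.deg v V = 3) (hw : w v ≤ D) : b + u (w v) + 1 < 3 * u (w v + 1) := by
  by_contra hle
  refine C.false_of_raise hv hd hw (C.colorable_of_pot P (Finset.erase_ssubset hv) _ _ ?_)
  intro T hT h2
  have h1 := C.gap P (lt_of_le_of_lt hT (Finset.erase_ssubset hv)) h2
  refine le_trans ?_ (pot_raise_simple P v (w v + 1) T)
  have h3 := sum_ite_one_le_deg G v T
  have hvT : v ∉ T := fun hh => Finset.notMem_erase v V (hT hh)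
  have hTV : insert v T ⊆ V := Finset.insert_subset hv (hT.trans (Finset.erase_subset _ _))
  have hdT : G.deg v T ≤ 3 := hd ▸ G.deg_mono v (hT.trans (Finset.erase_subset _ _))
  have hub := P.le (w v + 1)
  have h4 := pot_insert (b := b) (u := u) (G := G) (w := w) hvT
  have hpos := C.pot_ge
  have hge : G.deg v T ≠ 3 → (b : ℤ) ≤ pot b u G w (insert v T) := by
    intro hne
    refine C.gap P (Finset.ssubset_iff_subset_ne.2 ⟨hTV, fun hh => hne ?_⟩)
      (by rw [Finset.card_insert_of_notMem hvT]; omega)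
    rw [← deg_insert_self, hh, hd]
  have hge' : -1 ≤ pot b u G w (insert v T) := by
    rcases eq_or_ne (insert v T) V with hh | hh
    · rw [hh]; exact hpos
    · have := C.gap P (Finset.ssubset_iff_subset_ne.2 ⟨hTV, hh⟩)
        (by rw [Finset.card_insert_of_notMem hvT]; omega)
      omega
  set c := ∑ a ∈ T, (if G.m v a = 1 then 1 else 0) with hc
  rw [show ((∑ a ∈ T, (if G.m v a = 1 then 1 else 0) : ℕ) : ℤ) = (c : ℤ) from rfl]
  obtain h0 | h0 | h0 : G.deg v T ≤ 1 ∨ G.deg v T = 2 ∨ G.deg v T = 3 := by omega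
  · have h7 : (u (w v + 1) : ℤ) * c ≤ b * 1 :=
      mul_le_mul (by exact_mod_cast hub) (by exact_mod_cast h3.trans h0) (by positivity)
        (by positivity)
    linarith
  · have h7 : (u (w v + 1) : ℤ) * c ≤ u (w v + 1) * 2 :=
      mul_le_mul_of_nonneg_left (by exact_mod_cast h3.trans h0.le) (by positivity)
    have := hge (by omega)
    rw [h0] at h4; push_cast at h4
    omega
  · have h7 : (u (w v + 1) : ℤ) * c ≤ u (w v + 1) * 3 :=
      mul_le_mul_of_nonneg_left (by exact_mod_cast h3.trans h0.le) (by positivity)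
    rw [h0] at h4; push_cast at h4
    omega

/-- On two vertices, one of weight at most `D` could go to `M` and the other to `F`. If both are
heavier, at least two edges join them and the potential is at most `-2`. -/
theorem three_le_card (C : Counterexample D b u G w V) (P : Profile D b u) : 3 ≤ V.card := by
  by_contra hlt
  have hne : V.Nonempty := by
    rw [Finset.nonempty_iff_ne_empty]
    rintro rfl
    exact C.not_colorable ⟨∅, ∅, rfl, by simp, Bdd.empty _ _ _, Forest.empty _⟩
  have hpos := hne.card_pos
  obtain h | h : V.card = 1 ∨ V.card = 2 := by omega
  · obtain ⟨v, rfl⟩ := Finset.card_eq_one.1 h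
    have := C.two_le_deg (Finset.mem_singleton_self v)
    rw [deg_singleton, G.irrefl] at this
    omega
  · obtain ⟨x, y, hxy, rfl⟩ := Finset.card_eq_two.1 h
    have key : ∀ {x y : α}, x ≠ y → w x ≤ D → G.Colorable D w {x, y} := fun {x y} hxy hw =>
      ⟨{x}, {y}, rfl, by simpa using hxy, Bdd.singleton G hw, Forest.singleton G y⟩
    rcases Nat.lt_or_ge D (w x) with hx | hx
    · rcases Nat.lt_or_ge D (w y) with hy | hy
      · have hp := C.pot_ge
        have hd := C.two_le_deg (Finset.mem_insert_self x {y})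
        rw [deg_insert_self] at hd
        rw [pot_insert (by simpa using hxy), pot_singleton, P.top _ hx, P.top _ hy] at hp
        have : (b : ℤ) * 2 ≤ b * G.deg x {y} :=
          mul_le_mul_of_nonneg_left (by exact_mod_cast hd) (by positivity)
        linarith
      · exact C.not_colorable (Finset.pair_comm x y ▸ key hxy.symm hy)
    · exact C.not_colorable (key hxy hx)

end Counterexample

/-! ### Even `D` -/

/-- The weight costs for `D = 2 * t`. -/
def evenCost (t j : ℕ) : ℕ := if j ≤ t then 2 * j else min (2 * j - 1) (4 * t + 1)

/-- Of `j` and `2t + 1 - j` exactly one is at most `t`. The drop by one beyond `t` therefore makes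
their costs sum to the odd number `4t + 1`. -/
theorem evenCost_profile {t : ℕ} (ht : 1 ≤ t) : Profile (2 * t) (4 * t + 1) (evenCost t) where
  zero := by simp [evenCost]
  mono i j h := by unfold evenCost; split_ifs <;> omega
  subadd i j := by unfold evenCost; split_ifs <;> omega
  top j h := by unfold evenCost; split_ifs <;> omega
  dual j h := by unfold evenCost; split_ifs <;> omega
  step j := by unfold evenCost; split_ifs <;> omega
  three_le := by omega

/-- All charges are at most `-1`. For degree 3 and weight at most `2t`, `lt_of_deg_eq_three` forces
weight at least `t`, and weight `t` gives exactly `-1`. The total is at most `-3`, against `2 * pot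
V ≥ -2`. -/
theorem even_no_counterexample {t : ℕ} (ht : 1 ≤ t) {G : MGraph α} {w : α → ℕ}
    {V : Finset α} (C : Counterexample (2 * t) (4 * t + 1) (evenCost t) G w V) : False := by
  have P := evenCost_profile ht
  have h3 := C.three_le_card P
  have h4 := two_mul_pot (b := 4 * t + 1) (u := evenCost t) (G := G) (w := w) V
  have h5 : ∑ v ∈ V, (2 * (2 * ((4 * t + 1 : ℕ) : ℤ) - 1 - evenCost t (w v)) -
      (4 * t + 1 : ℕ) * G.deg v V) ≤ ∑ v ∈ V, (-1 : ℤ) := by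
    refine Finset.sum_le_sum fun v hv => ?_
    have h2 := C.two_le_deg hv
    rcases Nat.lt_or_ge (2 * t) (w v) with hw | hw
    · rw [P.top _ hw]
      have : ((4 * t + 1 : ℕ) : ℤ) * 2 ≤ (4 * t + 1 : ℕ) * G.deg v V :=
        mul_le_mul_of_nonneg_left (by exact_mod_cast h2) (by positivity)
      push_cast at *; linarith
    · have h6 := C.three_le_deg hv hw
      rcases Nat.lt_or_ge (G.deg v V) 4 with h7 | h7
      · have h8 : G.deg v V = 3 := by omega
        have h9 := C.lt_of_deg_eq_three P hv h8 hw
        rw [h8]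
        unfold evenCost at *
        split_ifs at * <;> push_cast at * <;> omega
      · have : ((4 * t + 1 : ℕ) : ℤ) * 4 ≤ (4 * t + 1 : ℕ) * G.deg v V :=
          mul_le_mul_of_nonneg_left (by exact_mod_cast h7) (by positivity)
        push_cast at *; linarith
  rw [← h4, Finset.sum_const, nsmul_eq_mul] at h5
  have h6 := C.pot_ge
  have : (3 : ℤ) ≤ V.card := by exact_mod_cast h3
  linarith

end MGraph

/-! ### Odd `D`: vertices of positive charge -/

namespace MGraph

variable {α : Type*} [DecidableEq α]

/-- The weight costs for `D = 2 * k + 1`. -/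
def oddCost (k j : ℕ) : ℕ := min (2 * j) (4 * k + 4)

theorem oddCost_profile (k : ℕ) : Profile (2 * k + 1) (4 * k + 4) (oddCost k) where
  zero := by simp [oddCost]
  mono i j h := by unfold oddCost; omega
  subadd i j := by unfold oddCost; omega
  top j h := by unfold oddCost; omega
  dual j h := by unfold oddCost; omega
  step j := by unfold oddCost; omega
  three_le := by omega

/-- The vertices of positive charge. -/
structure Small (k : ℕ) (G : MGraph α) (w : α → ℕ) (V : Finset α) (v : α) : Prop where
  mem : v ∈ V
  deg_eq : G.deg v V = 3
  weight : w v = k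

/-- A vertex with two simple edges into `S`. -/
theorem exists_pair_of_deg_eq_two {G : MGraph α} {v : α} {S : Finset α} (h : G.deg v S = 2)
    (hm : ∀ a ∈ S, G.m v a ≤ 1) : ∃ y ∈ S, ∃ z ∈ S, y ≠ z ∧ G.m v y = 1 ∧ G.m v z = 1 ∧
      ∀ T ⊆ S, G.deg v T = (if y ∈ T then 1 else 0) + (if z ∈ T then 1 else 0) := by
  have hN : ∀ T ⊆ S, G.deg v T = (T.filter fun a => G.m v a = 1).card := by
    intro T hT
    rw [Finset.card_filter]
    refine Finset.sum_congr rfl fun a ha => ?_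
    have := hm a (hT ha)
    split_ifs <;> omega
  obtain ⟨y, z, hyz, hf⟩ := Finset.card_eq_two.1 ((hN S (Finset.Subset.refl _)).symm.trans h)
  have hy : y ∈ S.filter fun a => G.m v a = 1 := by rw [hf]; simp
  have hz : z ∈ S.filter fun a => G.m v a = 1 := by rw [hf]; simp
  rw [Finset.mem_filter] at hy hz
  refine ⟨y, hy.1, z, hz.1, hyz, hy.2, hz.2, fun T hT => ?_⟩
  have : G.deg v T = ∑ a ∈ T, ((if a = y then 1 else 0) + (if a = z then 1 else 0)) := by
    refine Finset.sum_congr rfl fun a ha => ?_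
    have h1 := hm a (hT ha)
    have h2 : a ∈ (S.filter fun a => G.m v a = 1) ↔ a = y ∨ a = z := by rw [hf]; simp
    rw [Finset.mem_filter] at h2
    by_cases hay : a = y
    · subst hay; simp [hyz, hy.2]
    · by_cases haz : a = z
      · subst haz; simp [hay, hz.2]
      · have : G.m v a ≠ 1 := fun hh => by
          rcases h2.1 ⟨hT ha, hh⟩ with h | h
          · exact hay h
          · exact haz h
        simp [hay, haz]; omega
  rw [this, Finset.sum_add_distrib, Finset.sum_ite_eq', Finset.sum_ite_eq']

namespace Counterexample

variable {k : ℕ} {G : MGraph α} {w : α → ℕ} {V : Finset α}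

theorem Small.m_le_one (C : Counterexample (2 * k + 1) (4 * k + 4) (oddCost k) G w V) {v : α}
    (hv : Small k G w V v) {y : α} (hy : y ∈ V) : G.m v y ≤ 1 :=
  C.m_le_one (oddCost_profile k) hv.mem hv.deg_eq (by rw [hv.weight]; omega) hy

/-- Delete both ends and raise the two other neighbours of `v` by `k + 1`, at total cost `b`. Then
reinsert `x`, still reserving `k + 1` at it, and finally `v`, whose neighbours all have the slack it
needs. -/
theorem small_not_adj (C : Counterexample (2 * k + 1) (4 * k + 4) (oddCost k) G w V) {v x : α}
    (hv : Small k G w V v) (hx : Small k G w V x) : G.m v x = 0 := by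
  by_contra hm
  have P := oddCost_profile k
  have hvx : v ≠ x := fun h => hm (h ▸ G.irrefl v)
  have hm1 : G.m v x = 1 := by have := Small.m_le_one C hv hx.mem; omega
  have hx' : x ∈ V.erase v := Finset.mem_erase.2 ⟨hvx.symm, hx.mem⟩
  have hss : (V.erase v).erase x ⊂ V :=
    lt_of_le_of_lt (Finset.erase_subset _ _) (Finset.erase_ssubset hv.mem)
  have hdv : G.deg v ((V.erase v).erase x) = 2 := by
    have := G.deg_insert v (Finset.notMem_erase x (V.erase v))
    rw [Finset.insert_erase hx', deg_erase_self, hv.deg_eq, hm1] at this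
    omega
  have hdx : G.deg x ((V.erase v).erase x) = 2 := by
    have := G.deg_insert x (Finset.notMem_erase v V)
    rw [Finset.insert_erase hv.mem, hx.deg_eq, G.symm, hm1] at this
    rw [deg_erase_self]; omega
  obtain ⟨M, F, hMF, hc⟩ := C.colorable_of_pot P hss G
    (fun a => w a + if G.m v a = 1 then k + 1 else 0) (by
      intro T hT h2
      have h1 := C.gap P (lt_of_le_of_lt hT hss) h2
      refine le_trans ?_ (pot_raise_simple P v (k + 1) T)
      have h3 := (sum_ite_one_le_deg G v T).trans (G.deg_mono v hT)
      rw [hdv] at h3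
      have h4 : oddCost k (k + 1) = 2 * k + 2 := by unfold oddCost; omega
      rw [h4]
      have h5 : ((2 * k + 2 : ℕ) : ℤ) * (∑ a ∈ T, (if G.m v a = 1 then 1 else 0) : ℕ) ≤
          (2 * k + 2 : ℕ) * (2 : ℕ) :=
        mul_le_mul_of_nonneg_left (by exact_mod_cast h3) (by positivity)
      push_cast at *
      linarith)
  have hxMF : x ∉ M ∪ F := hMF ▸ Finset.notMem_erase x _
  have hvMF : v ∉ M ∪ F := hMF ▸ fun h => Finset.notMem_erase v V (Finset.mem_of_mem_erase h)
  rw [Finset.mem_union, not_or] at hxMF hvMF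
  -- With the reserve, `x` has weight exactly `D`, so it fits in `M` as an isolated vertex. That is
  -- needed only when both its remaining edges go to `F`.
  have hxw : w x + (if G.m v x = 1 then k + 1 else 0) = 2 * k + 1 := by
    rw [if_pos hm1, hx.weight]; omega
  obtain ⟨M1, F1, hU, hv1, hv2, hc1⟩ : ∃ M1 F1, M1 ∪ F1 = V.erase v ∧ v ∉ M1 ∧ v ∉ F1 ∧
      G.Col (2 * k + 1) (fun a => w a + if G.m v a = 1 then k + 1 else 0) M1 F1 := by
    have h1 : G.deg x M + G.deg x F = 2 := by rw [← deg_union G x hc.disj, hMF, hdx]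
    rcases Nat.lt_or_ge (G.deg x F) 2 with h2 | h2
    · refine ⟨M, insert x F, ?_, hvMF.1, ?_, hc.insert_right hxMF.1 (by omega)⟩
      · rw [Finset.union_insert, hMF, Finset.insert_erase hx']
      · simp [hvx, hvMF.2]
    · refine ⟨insert x M, F, ?_, ?_, hvMF.2, hc.insert_left hxMF.2 (by omega) hxw.le
        (fun _ _ => le_rfl) fun y hy hy' => ?_⟩
      · rw [Finset.insert_union, hMF, Finset.insert_erase hx']
      · simp [hvx, hvMF.1]
      · have := G.m_le_deg x hy
        omega
  obtain ⟨M2, F2, h1, -, -, h2⟩ := hc1.extend (w := w) hv1 hv2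
    (by rw [hU, deg_erase_self, hv.deg_eq]) (by rw [hv.weight]; omega) (by simp) (by
      intro y _ hy _
      rw [if_pos hy, hv.weight]; omega)
  rw [hU, Finset.insert_erase hv.mem] at h1
  exact C.not_colorable ⟨M2, F2, h1, h2⟩

/-- With `v₁` and `v₂` deleted, `x` has a single edge left and can be put into `F`. Raising the
other neighbours of `v₁` and `v₂` by `k + 1` then lets both be reinserted. -/
theorem not_two_small_of_deg_eq_three
    (C : Counterexample (2 * k + 1) (4 * k + 4) (oddCost k) G w V) {x v₁ v₂ : α}
    (hx : x ∈ V) (hd : G.deg x V = 3) (hwx : k + 1 ≤ w x) (h1 : Small k G w V v₁)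
    (h2 : Small k G w V v₂) (h12 : v₁ ≠ v₂) (hm1 : G.m v₁ x ≠ 0) (hm2 : G.m v₂ x ≠ 0) :
    False := by
  have P := oddCost_profile k
  have hx1 : v₁ ≠ x := fun h => hm1 (h ▸ G.irrefl v₁)
  have hx2 : v₂ ≠ x := fun h => hm2 (h ▸ G.irrefl v₂)
  have hm1 : G.m v₁ x = 1 := by have := Small.m_le_one C h1 hx; omega
  have hm2 : G.m v₂ x = 1 := by have := Small.m_le_one C h2 hx; omega
  have hm12 := C.small_not_adj h1 h2
  set V' := ((V.erase x).erase v₁).erase v₂ with hV'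
  have hxV' : x ∉ V' := by simp [hV']
  have h1V' : v₁ ∉ V' := by simp [hV']
  have h2V' : v₂ ∉ V' := by simp [hV']
  have hss : V' ⊂ V := lt_of_le_of_lt ((Finset.erase_subset _ _).trans (Finset.erase_subset _ _))
    (Finset.erase_ssubset hx)
  have hVV' : insert x (insert v₁ (insert v₂ V')) = V := by
    rw [hV', Finset.insert_erase, Finset.insert_erase, Finset.insert_erase hx]
    · simp [hx1, h1.mem]
    · simp [hx2, h12.symm, h2.mem]
  have hd1 : G.deg v₁ V' = 2 := by
    have := h1.deg_eq
    rw [← hVV', deg_insert, deg_insert_self, deg_insert _ _ h2V', hm1, hm12] at this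
    · omega
    · simp [hx1.symm, hx2.symm, hxV']
  have hd2 : G.deg v₂ V' = 2 := by
    have := h2.deg_eq
    rw [← hVV', deg_insert, deg_insert, deg_insert_self, hm2, G.symm, hm12] at this
    · omega
    · simp [h12, h1V']
    · simp [hx1.symm, hx2.symm, hxV']
  have hdx : G.deg x V' = 1 := by
    have := hd
    rw [← hVV', deg_insert_self, deg_insert, deg_insert _ _ h2V', G.symm, hm1, G.symm,
      hm2] at this
    · omega
    · simp [h12, h1V']
  have hcost : oddCost k (k + 1) = 2 * k + 2 := by unfold oddCost; omega
  have huk : oddCost k k = 2 * k := by unfold oddCost; omega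
  have hux : 2 * k + 2 ≤ oddCost k (w x) := by unfold oddCost; omega
  obtain ⟨M, F, hMF, hc⟩ := C.colorable_of_pot P hss G
    (fun a => (w a + if G.m v₂ a = 1 then k + 1 else 0) + if G.m v₁ a = 1 then k + 1 else 0) (by
      intro T hT hT2
      have g0 := C.gap P (lt_of_le_of_lt hT hss) hT2
      refine le_trans ?_ (pot_raise_simple P v₁ (k + 1) T)
      refine le_trans ?_ (sub_le_sub_right (pot_raise_simple P v₂ (k + 1) T) _)
      have h3 := sum_ite_one_le_deg G v₁ T
      have h4 := sum_ite_one_le_deg G v₂ T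
      have h3' := hd1 ▸ G.deg_mono v₁ hT
      have h4' := hd2 ▸ G.deg_mono v₂ hT
      have hdx' := hdx ▸ G.deg_mono x hT
      set c₁ := ∑ a ∈ T, (if G.m v₁ a = 1 then 1 else 0) with hc1
      set c₂ := ∑ a ∈ T, (if G.m v₂ a = 1 then 1 else 0) with hc2
      rw [show ((∑ a ∈ T, (if G.m v₁ a = 1 then 1 else 0) : ℕ) : ℤ) = (c₁ : ℤ) from rfl,
        show ((∑ a ∈ T, (if G.m v₂ a = 1 then 1 else 0) : ℕ) : ℤ) = (c₂ : ℤ) from rfl, hcost]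
      have hxT : x ∉ T := fun h => hxV' (hT h)
      have h1T : v₁ ∉ T := fun h => h1V' (hT h)
      have h2T : v₂ ∉ T := fun h => h2V' (hT h)
      have single : ∀ {v : α}, Small k G w V v → v ≠ x → v ∉ T → G.deg v T = 2 →
          (6 * k + 5 : ℤ) ≤ pot (4 * k + 4) (oddCost k) G w T := by
        intro v hv hvx hvT hd
        have g1 := pot_insert (b := 4 * k + 4) (u := oddCost k) (G := G) (w := w) hvT
        have g2 := C.gap P (S := insert v T) ⟨Finset.insert_subset hv.mem (hT.trans hss.1),
          fun h => by
            have := h hx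
            simp [hvx.symm, hxT] at this⟩ (by rw [Finset.card_insert_of_notMem hvT]; omega)
        rw [hv.weight, huk, hd] at g1
        push_cast at *
        linarith
      -- Each raise costs `2k + 2 = b / 2`. Two are covered by the gap; three are covered by the gap
      -- for `T ∪ {vᵢ}`, where `vᵢ` has both its neighbours in `T`; for four, compare `T` with `T ∪
      -- {x, v₁, v₂}`, which may be `V`.
      obtain hs | hs | hs | hs : c₁ + c₂ ≤ 2 ∨ (c₁ + c₂ ≤ 3 ∧ G.deg v₁ T = 2) ∨
          (c₁ + c₂ ≤ 3 ∧ G.deg v₂ T = 2) ∨ (G.deg v₁ T = 2 ∧ G.deg v₂ T = 2) := by omega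
      · have : ((2 * k + 2 : ℕ) : ℤ) * ((c₁ + c₂ : ℕ) : ℤ) ≤ (2 * k + 2 : ℕ) * (2 : ℕ) :=
          mul_le_mul_of_nonneg_left (by exact_mod_cast hs) (by positivity)
        push_cast at *
        linarith
      · have : ((2 * k + 2 : ℕ) : ℤ) * ((c₁ + c₂ : ℕ) : ℤ) ≤ (2 * k + 2 : ℕ) * (3 : ℕ) :=
          mul_le_mul_of_nonneg_left (by exact_mod_cast hs.1) (by positivity)
        have := single h1 hx1 h1T hs.2
        push_cast at *
        linarith
      · have : ((2 * k + 2 : ℕ) : ℤ) * ((c₁ + c₂ : ℕ) : ℤ) ≤ (2 * k + 2 : ℕ) * (3 : ℕ) :=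
          mul_le_mul_of_nonneg_left (by exact_mod_cast hs.1) (by positivity)
        have := single h2 hx2 h2T hs.2
        push_cast at *
        linarith
      · have hle : c₁ + c₂ ≤ 4 := by omega
        have e1 : ((2 * k + 2 : ℕ) : ℤ) * ((c₁ + c₂ : ℕ) : ℤ) ≤ (2 * k + 2 : ℕ) * (4 : ℕ) :=
          mul_le_mul_of_nonneg_left (by exact_mod_cast hle) (by positivity)
        have i1 : v₁ ∉ insert v₂ T := by simp [h12, h1T]
        have i2 : x ∉ insert v₁ (insert v₂ T) := by simp [hx1.symm, hx2.symm, hxT]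
        have g1 := pot_insert (b := 4 * k + 4) (u := oddCost k) (G := G) (w := w) i2
        rw [pot_insert i1, pot_insert h2T, deg_insert _ _ i1, deg_insert _ _ h2T,
          deg_insert _ _ h2T, hm12, hs.1, hs.2, G.symm, hm1, G.symm, hm2, h1.weight, h2.weight,
          huk] at g1
        have hux' : ((2 * k + 2 : ℕ) : ℤ) ≤ oddCost k (w x) := by exact_mod_cast hux
        rcases eq_or_ne (insert x (insert v₁ (insert v₂ T))) V with hh | hh
        · have : G.deg x T = 1 := by
            have := hd
            rw [← hh, deg_insert_self, deg_insert _ _ i1, deg_insert _ _ h2T, G.symm, hm1,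
              G.symm, hm2] at this
            omega
          have g2 := C.pot_ge
          rw [hh, this] at g1
          push_cast at *
          linarith
        · have g2 := C.gap P (S := insert x (insert v₁ (insert v₂ T)))
            (Finset.ssubset_iff_subset_ne.2 ⟨?_, hh⟩)
            (hT2.trans (Finset.card_le_card fun a ha => by simp [ha]))
          · have g3 : (0 : ℤ) ≤ ((4 * k + 4 : ℕ) : ℤ) * G.deg x T := by positivity
            push_cast at *
            linarith
          · rw [← hVV']
            exact Finset.insert_subset_insert _ (Finset.insert_subset_insert _
              (Finset.insert_subset_insert _ hT)))
  have hxMF : x ∉ M ∪ F := hMF ▸ hxV'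
  have h1MF : v₁ ∉ M ∪ F := hMF ▸ h1V'
  have h2MF : v₂ ∉ M ∪ F := hMF ▸ h2V'
  rw [Finset.mem_union, not_or] at hxMF h1MF h2MF
  have hc1 := hc.insert_right hxMF.1 (by
    rw [← hdx, ← hMF]; exact G.deg_mono x Finset.subset_union_right)
  obtain ⟨M1, F1, hU1, hM1, hF1, hc2⟩ := hc1.extend (v := v₁)
    (w := fun a => w a + if G.m v₂ a = 1 then k + 1 else 0) h1MF.1 (by simp [hx1, h1MF.2])
    (h1.deg_eq ▸ G.deg_mono v₁ (by
      rw [Finset.union_insert, hMF]; exact Finset.insert_subset hx hss.1))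
    (by rw [G.symm, hm12, h1.weight]; simp; omega) (by simp) (by
      intro y _ hy _
      rw [if_pos hy, G.symm v₂ v₁, hm12, h1.weight]; simp)
  obtain ⟨M2, F2, hU2, -, -, hc3⟩ := hc2.extend (v := v₂) (w := w)
    (fun h => by
      have := hM1 h
      simp [h12.symm, h2MF.1] at this)
    (fun h => by
      have := hF1 h
      simp [h12.symm, hx2, h2MF.2] at this)
    (h2.deg_eq ▸ G.deg_mono v₂ (by
      rw [hU1, Finset.union_insert, hMF]
      exact Finset.insert_subset h1.mem (Finset.insert_subset hx hss.1)))
    (by rw [h2.weight]; omega) (by simp) (by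
      intro y _ hy _
      rw [if_pos hy, h2.weight]; omega)
  refine C.not_colorable ⟨M2, F2, ?_, hc3⟩
  rw [hU2, hU1, Finset.union_insert, hMF, ← hVV']
  ext a; simp; tauto

end Counterexample

end MGraph

/-! ### Odd `D`: vertices of degree four and weight zero -/

namespace MGraph

variable {α : Type*} [DecidableEq α]

theorem exists_of_deg_eq_one {G : MGraph α} {v : α} {S : Finset α} (h : G.deg v S = 1) :
    ∃ p ∈ S, ∀ T ⊆ S, G.deg v T = if p ∈ T then 1 else 0 := by
  obtain ⟨p, hp, hm⟩ : ∃ p ∈ S, G.m v p ≠ 0 := by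
    by_contra hcon; push Not at hcon
    have : G.deg v S = 0 := Finset.sum_eq_zero hcon
    omega
  refine ⟨p, hp, fun T hT => ?_⟩
  have h1 := G.deg_insert v (Finset.notMem_erase p S)
  rw [Finset.insert_erase hp] at h1
  split_ifs with hpT
  · have := G.m_le_deg v hpT
    have := G.deg_mono v hT
    omega
  · have := G.deg_mono v (Finset.subset_erase.2 ⟨hT, hpT⟩)
    omega

namespace Counterexample

variable {k : ℕ} {G : MGraph α} {w : α → ℕ} {V : Finset α}

set_option maxHeartbeats 1000000 in
-- Delete `x, v₁, v₂, v₃`, join the two other neighbours of `v₁` by an edge, do the same for `v₂`,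
-- and raise `p` by `k + 2`. In a colouring of the rest, put `x` into `M` with reserve `k + 1` and
-- `v₁, v₂` into `F`, where they subdivide the new edges; the reserve at `x` then accommodates `v₃`.
-- The hypotheses `hb1` and `hb2` improve the gap by one where one new edge and the raise of `p`
-- must be paid together.
theorem false_of_deg_eq_four
    (C : Counterexample (2 * k + 1) (4 * k + 4) (oddCost k) G w V) {x p v₁ v₂ v₃ : α}
    (hx : x ∈ V) (hd : G.deg x V = 4) (hwx : w x = 0) (h1 : Small k G w V v₁)
    (h2 : Small k G w V v₂) (h3 : Small k G w V v₃) (h12 : v₁ ≠ v₂) (h13 : v₁ ≠ v₃)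
    (h23 : v₂ ≠ v₃) (hm1 : G.m v₁ x ≠ 0) (hm2 : G.m v₂ x ≠ 0) (hm3 : G.m v₃ x ≠ 0)
    (hp : ∀ T ⊆ V, v₁ ∉ T → v₂ ∉ T → v₃ ∉ T → G.deg x T = if p ∈ T then 1 else 0)
    (hb1 : ∀ S ⊆ V, x ∈ S → p ∈ S → v₁ ∈ S → v₂ ∉ S → v₃ ∉ S →
      (4 * k + 5 : ℤ) ≤ pot (4 * k + 4) (oddCost k) G w S)
    (hb2 : ∀ S ⊆ V, x ∈ S → p ∈ S → v₂ ∈ S → v₁ ∉ S → v₃ ∉ S →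
      (4 * k + 5 : ℤ) ≤ pot (4 * k + 4) (oddCost k) G w S) : False := by
  have P := oddCost_profile k
  have hx1 : v₁ ≠ x := fun h => hm1 (h ▸ G.irrefl v₁)
  have hx2 : v₂ ≠ x := fun h => hm2 (h ▸ G.irrefl v₂)
  have hx3 : v₃ ≠ x := fun h => hm3 (h ▸ G.irrefl v₃)
  have hm1 : G.m v₁ x = 1 := by have := Small.m_le_one C h1 hx; omega
  have hm2 : G.m v₂ x = 1 := by have := Small.m_le_one C h2 hx; omega
  have hm3 : G.m v₃ x = 1 := by have := Small.m_le_one C h3 hx; omega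
  set V' := (((V.erase x).erase v₁).erase v₂).erase v₃ with hV'
  have hxV' : x ∉ V' := by simp [hV']
  have h1V' : v₁ ∉ V' := by simp [hV']
  have h2V' : v₂ ∉ V' := by simp [hV']
  have h3V' : v₃ ∉ V' := by simp [hV']
  have hss : V' ⊂ V := lt_of_le_of_lt ((Finset.erase_subset _ _).trans
    ((Finset.erase_subset _ _).trans (Finset.erase_subset _ _))) (Finset.erase_ssubset hx)
  have hVV' : insert v₃ (insert x (insert v₁ (insert v₂ V'))) = V := by
    ext a
    simp only [hV', Finset.mem_insert, Finset.mem_erase]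
    constructor
    · rintro (rfl | rfl | rfl | rfl | h)
      exacts [h3.mem, hx, h1.mem, h2.mem, h.2.2.2.2]
    · intro h
      by_cases e0 : a = v₃
      · exact Or.inl e0
      by_cases e1 : a = x
      · exact Or.inr (Or.inl e1)
      by_cases e2 : a = v₁
      · exact Or.inr (Or.inr (Or.inl e2))
      by_cases e3 : a = v₂
      · exact Or.inr (Or.inr (Or.inr (Or.inl e3)))
      exact Or.inr (Or.inr (Or.inr (Or.inr ⟨e0, e3, e2, e1, h⟩)))
  have pair : ∀ {v : α}, Small k G w V v → G.m v x = 1 → ∃ y ∈ V.erase x, ∃ z ∈ V.erase x,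
      y ≠ z ∧ G.m v y = 1 ∧ G.m v z = 1 ∧ ∀ T ⊆ V.erase x,
        G.deg v T = (if y ∈ T then 1 else 0) + (if z ∈ T then 1 else 0) := by
    intro v hv hm
    refine exists_pair_of_deg_eq_two ?_
      fun a ha => Small.m_le_one C hv (Finset.mem_of_mem_erase ha)
    have := G.deg_insert v (Finset.notMem_erase x V)
    rw [Finset.insert_erase hx, hv.deg_eq, hm] at this
    omega
  obtain ⟨y₁, -, z₁, -, hyz1, my1, mz1, hT1⟩ := pair h1 hm1
  obtain ⟨y₂, -, z₂, -, hyz2, my2, mz2, hT2⟩ := pair h2 hm2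
  have hm12 := C.small_not_adj h1 h2
  have hV'x : V' ⊆ V.erase x := (Finset.erase_subset _ _).trans
    ((Finset.erase_subset _ _).trans (Finset.erase_subset _ _))
  have hcost : oddCost k (k + 2) = 2 * k + 4 := by unfold oddCost; omega
  have huk : oddCost k k = 2 * k := by unfold oddCost; omega
  have hux : oddCost k (w x) = 0 := by rw [hwx]; rfl
  have hpV' : ∀ T ⊆ V', G.deg x T = if p ∈ T then 1 else 0 := fun T hT =>
    hp T (hT.trans hss.1) (fun h => h1V' (hT h)) (fun h => h2V' (hT h)) (fun h => h3V' (hT h))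
  obtain ⟨M, F, hMF, hc⟩ := C.colorable_of_pot P hss
    ((G.addEdge y₁ z₁ hyz1).addEdge y₂ z₂ hyz2) (fun a => w a + if a = p then k + 2 else 0) (by
      intro T hT hT2'
      have g0 := C.gap P (lt_of_le_of_lt hT hss) hT2'
      rw [pot_addEdge, pot_addEdge]
      have g1 := pot_raise (G := G) (w := w) P (fun a => if a = p then k + 2 else 0) T
      have g2 : ∑ v ∈ T, (oddCost k (if v = p then k + 2 else 0) : ℤ) =
          if p ∈ T then (2 * k + 4 : ℤ) else 0 := by
        have : ∀ v, (oddCost k (if v = p then k + 2 else 0) : ℤ) =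
            if v = p then (2 * k + 4 : ℤ) else 0 := by
          intro v; split_ifs
          · rw [hcost]; push_cast; rfl
          · simp [oddCost]
        simp only [this, Finset.sum_ite_eq']
      rw [g2] at g1
      have hxT : x ∉ T := fun h => hxV' (hT h)
      have h1T : v₁ ∉ T := fun h => h1V' (hT h)
      have h2T : v₂ ∉ T := fun h => h2V' (hT h)
      have h3T : v₃ ∉ T := fun h => h3V' (hT h)
      have hTV := hT.trans hss.1
      have d1 := hT1 T (hT.trans hV'x)
      have d2 := hT2 T (hT.trans hV'x)
      have dx := hpV' T hT
      have single : ∀ {v : α}, Small k G w V v → v ∉ T → v ≠ x → G.m v x = 1 →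
          G.deg v T = 2 → p ∈ T →
          (4 * k + 5 : ℤ) ≤ pot (4 * k + 4) (oddCost k) G w (insert x (insert v T)) →
          (6 * k + 7 : ℤ) ≤ pot (4 * k + 4) (oddCost k) G w T := by
        intro v hv hvT hvx hm hd hpT hle
        rw [pot_insert (by simp [hvx.symm, hxT]), pot_insert hvT, deg_insert _ _ hvT, dx,
          if_pos hpT, hd, G.symm, hm, hv.weight, huk, hux] at hle
        push_cast at *
        linarith
      have both : G.deg v₁ T = 2 → G.deg v₂ T = 2 → (8 * k + 7 : ℤ) +
          (4 * k + 4 : ℤ) * (if p ∈ T then 1 else 0) ≤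
            pot (4 * k + 4) (oddCost k) G w T := by
        intro e1 e2
        have i1 : v₁ ∉ insert v₂ T := by simp [h12, h1T]
        have i2 : x ∉ insert v₁ (insert v₂ T) := by simp [hx1.symm, hx2.symm, hxT]
        have g2 := C.gap P (S := insert x (insert v₁ (insert v₂ T))) ⟨by
            simp [Finset.insert_subset_iff, hx, h1.mem, h2.mem, hTV], fun h => by
            have := h h3.mem
            simp [hx3, h13.symm, h23.symm, h3T] at this⟩
          (hT2'.trans (Finset.card_le_card fun a ha => by simp [ha]))
        rw [pot_insert i2, pot_insert i1, pot_insert h2T, deg_insert _ _ i1, deg_insert _ _ h2T,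
          deg_insert _ _ h2T, hm12, e1, e2, G.symm, hm1, G.symm, hm2, h1.weight, h2.weight,
          huk, hux, dx] at g2
        split_ifs at g2 ⊢ <;> push_cast at g2 ⊢ <;> linarith
      -- A new edge inside `T` costs `b = 4k + 4`, and `p ∈ T` costs `2k + 4`. With one edge and
      -- `p`, the potential required is `6k + 7`, exactly what `single` supplies.
      by_cases c1 : y₁ ∈ T ∧ z₁ ∈ T <;> by_cases c2 : y₂ ∈ T ∧ z₂ ∈ T
      · have := both (by rw [d1, if_pos c1.1, if_pos c1.2]) (by rw [d2, if_pos c2.1, if_pos c2.2])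
        rw [if_pos c1, if_pos c2]
        split_ifs at this g1 <;> push_cast at * <;> linarith
      · rw [if_pos c1, if_neg c2]
        by_cases hpT : p ∈ T
        · have := single h1 h1T hx1 hm1 (by rw [d1, if_pos c1.1, if_pos c1.2]) hpT (hb1 _
            (by simp [Finset.insert_subset_iff, hx, h1.mem, hTV]) (by simp) (by simp [hpT])
            (by simp) (by simp [hx2, h12.symm, h2T]) (by simp [hx3, h13.symm, h3T]))
          rw [if_pos hpT] at g1
          push_cast at *; linarith
        · rw [if_neg hpT] at g1
          push_cast at *; linarith
      · rw [if_neg c1, if_pos c2]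
        by_cases hpT : p ∈ T
        · have := single h2 h2T hx2 hm2 (by rw [d2, if_pos c2.1, if_pos c2.2]) hpT (hb2 _
            (by simp [Finset.insert_subset_iff, hx, h2.mem, hTV]) (by simp) (by simp [hpT])
            (by simp) (by simp [hx1, h12, h1T]) (by simp [hx3, h23.symm, h3T]))
          rw [if_pos hpT] at g1
          push_cast at *; linarith
        · rw [if_neg hpT] at g1
          push_cast at *; linarith
      · rw [if_neg c1, if_neg c2]
        split_ifs at g1 <;> push_cast at * <;> linarith)
  have hxMF : x ∉ M ∪ F := hMF ▸ hxV'
  have h1MF : v₁ ∉ M ∪ F := hMF ▸ h1V'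
  have h2MF : v₂ ∉ M ∪ F := hMF ▸ h2V'
  have h3MF : v₃ ∉ M ∪ F := hMF ▸ h3V'
  have hMV' : M ⊆ V' := hMF ▸ Finset.subset_union_left
  have hFV' : F ⊆ V' := hMF ▸ Finset.subset_union_right
  rw [Finset.mem_union, not_or] at hxMF h1MF h2MF h3MF
  -- The raise `k + 2` at `p` is the edge `xp` plus the reserve `k + 1` at `x`.
  have hbdd : G.Bdd (2 * k + 1) (fun a => w a + if a = x then k + 1 else 0) (insert x M) := by
    refine hc.bdd.of_addEdge.of_addEdge.insert ?_ ?_ ?_ ?_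
    · rw [hpV' M hMV']; split_ifs <;> omega
    · simp only [if_true, hwx]; omega
    · intro y hy
      have : y ≠ x := fun h => hxMF.1 (h ▸ hy)
      simp [this]
    · intro y hy hxy
      have hyx : y ≠ x := fun h => hxMF.1 (h ▸ hy)
      have h4 := hpV' {y} (by simpa using hMV' hy)
      rw [deg_singleton] at h4
      have hyp : y = p := by
        by_contra hne
        rw [if_neg (by simpa using fun h => hne h.symm)] at h4
        exact hxy h4
      subst hyp
      simp [hyx, hwx]
  have hne1 : v₂ ≠ y₁ := fun h => by rw [← h, hm12] at my1; omega
  have hne2 : v₂ ≠ z₁ := fun h => by rw [← h, hm12] at mz1; omega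
  have hfor2 : (G.addEdge y₁ z₁ hyz1).Forest (insert v₂ F) := by
    refine hc.forest.subdivide fun T hT => ?_
    rw [deg_addEdge, if_neg (by rintro (⟨h, -⟩ | ⟨h, -⟩); exacts [hne1 h, hne2 h]), hT2 T ((hT.trans hFV').trans hV'x)]
    by_cases c1 : y₂ ∈ T <;> by_cases c2 : z₂ ∈ T <;> simp [c1, c2]
  have hfor1 : G.Forest (insert v₁ (insert v₂ F)) := by
    refine hfor2.subdivide fun T hT => ?_
    rw [hT1 T (hT.trans (Finset.insert_subset (Finset.mem_erase.2 ⟨hx2, h2.mem⟩)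
      (hFV'.trans hV'x)))]
    by_cases c1 : y₁ ∈ T <;> by_cases c2 : z₁ ∈ T <;> simp [c1, c2]
  have hcol : G.Col (2 * k + 1) (fun a => w a + if a = x then k + 1 else 0) (insert x M)
      (insert v₁ (insert v₂ F)) := by
    refine ⟨?_, hbdd, hfor1⟩
    simp [Finset.disjoint_insert_left, Finset.disjoint_insert_right, hx1, hx2, hxMF, h1MF, h2MF, hc.disj]
  have hU : insert x M ∪ insert v₁ (insert v₂ F) = insert x (insert v₁ (insert v₂ V')) := by
    rw [← hMF, Finset.insert_union, Finset.union_insert, Finset.union_insert]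
  have hUV : insert x M ∪ insert v₁ (insert v₂ F) ⊆ V := by
    rw [hU]; simp [Finset.insert_subset_iff, hx, h1.mem, h2.mem, hss.1]
  obtain ⟨M2, F2, hU2, -, -, hc3⟩ := hcol.extend (v := v₃) (w := w)
    (by simp [hx3, h3MF.1]) (by simp [h13.symm, h23.symm, h3MF.2])
    (h3.deg_eq ▸ G.deg_mono v₃ hUV)
    (by rw [h3.weight]; omega) (by simp) (by
      intro y hy hm3y hdF
      have hyx : y = x := by
        by_contra hne
        have e1 := G.deg_mono v₃ hUV
        rw [deg_union G v₃ hcol.disj, h3.deg_eq] at e1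
        have e2 := G.deg_insert v₃ hxMF.1
        have e3 := G.m_le_deg v₃ ((Finset.mem_insert.1 hy).resolve_left hne)
        omega
      rw [if_pos hyx, h3.weight]; omega)
  refine C.not_colorable ⟨M2, F2, ?_, hc3⟩
  rw [hU2, hU, hVV']

/-- Call `vᵢ` bad if some set containing `x`, `p`, `vᵢ` but neither other `vⱼ` has potential at most
`b`. Two bad vertices conflict, so two of the three are good and `false_of_deg_eq_four` applies with
those two subdivided. -/
theorem not_three_small_of_deg_eq_four
    (C : Counterexample (2 * k + 1) (4 * k + 4) (oddCost k) G w V) {x v₁ v₂ v₃ : α}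
    (hx : x ∈ V) (hd : G.deg x V = 4) (hwx : w x = 0) (h1 : Small k G w V v₁)
    (h2 : Small k G w V v₂) (h3 : Small k G w V v₃) (h12 : v₁ ≠ v₂) (h13 : v₁ ≠ v₃)
    (h23 : v₂ ≠ v₃) (hm1 : G.m v₁ x ≠ 0) (hm2 : G.m v₂ x ≠ 0) (hm3 : G.m v₃ x ≠ 0) :
    False := by
  have P := oddCost_profile k
  obtain ⟨p, hpV, hp⟩ : ∃ p ∈ ((V.erase v₁).erase v₂).erase v₃,
      ∀ T ⊆ ((V.erase v₁).erase v₂).erase v₃, G.deg x T = if p ∈ T then 1 else 0 := by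
    refine exists_of_deg_eq_one ?_
    have e1 := G.deg_insert x (Finset.notMem_erase v₁ V)
    have e2 := G.deg_insert x (Finset.notMem_erase v₂ (V.erase v₁))
    have e3 := G.deg_insert x (Finset.notMem_erase v₃ ((V.erase v₁).erase v₂))
    rw [Finset.insert_erase h1.mem] at e1
    rw [Finset.insert_erase (by simp [h12.symm, h2.mem])] at e2
    rw [Finset.insert_erase (by simp [h13.symm, h23.symm, h3.mem])] at e3
    have f1 := Small.m_le_one C h1 hx
    have f2 := Small.m_le_one C h2 hx
    have f3 := Small.m_le_one C h3 hx
    rw [G.symm] at f1 f2 f3 hm1 hm2 hm3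
    omega
  have hp' : ∀ T ⊆ V, v₁ ∉ T → v₂ ∉ T → v₃ ∉ T → G.deg x T = if p ∈ T then 1 else 0 :=
    fun T hT i1 i2 i3 => hp T (by
      simp only [Finset.subset_erase]; exact ⟨⟨⟨hT, i1⟩, i2⟩, i3⟩)
  have hpx : p ≠ x := by
    rintro rfl
    have := hp {p} (by simpa using hpV)
    simp [deg_singleton, G.irrefl] at this
  -- Submodularity: `S ∪ S'` misses `d`, so it has potential at least `b`. In `S ∩ S'` the vertex
  -- `x` has only its edge to `p`, so that set has potential at least `(b - 1) + (b - 1)`. The sum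
  -- exceeds `2b`.
  have conflict : ∀ {a c d : α}, ({a, c, d} : Finset α) = {v₁, v₂, v₃} → d ∈ V → ∀ S S',
      S ⊆ V → x ∈ S → p ∈ S → c ∉ S → d ∉ S → S' ⊆ V → x ∈ S' → p ∈ S' →
      a ∉ S' → d ∉ S' →
      pot (4 * k + 4) (oddCost k) G w S < 4 * k + 5 →
      pot (4 * k + 4) (oddCost k) G w S' < 4 * k + 5 → False := by
    intro a c d hacd hdV S S' hS xS pS cS dS hS' xS' pS' aS' dS' hl hl'
    have hmem : ∀ u ∈ ({v₁, v₂, v₃} : Finset α), u ∉ S ∩ S' := by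
      intro u hu huS
      rw [← hacd] at hu
      rw [Finset.mem_inter] at huS
      simp only [Finset.mem_insert, Finset.mem_singleton] at hu
      rcases hu with rfl | rfl | rfl
      · exact aS' huS.2
      · exact cS huS.1
      · exact dS huS.1
    have g1 := pot_union_add_inter (b := 4 * k + 4) (u := oddCost k) (G := G) (w := w) S S'
    have hxI : x ∈ S ∩ S' := by simp [xS, xS']
    have hpI : p ∈ (S ∩ S').erase x := by simp [pS, pS', hpx]
    have hIV : (S ∩ S').erase x ⊂ V := lt_of_le_of_lt
      (Finset.erase_subset_erase _ (Finset.inter_subset_left.trans hS)) (Finset.erase_ssubset hx)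
    have g2 : (4 * k + 3 : ℤ) ≤ pot (4 * k + 4) (oddCost k) G w ((S ∩ S').erase x) := by
      rcases Nat.lt_or_ge ((S ∩ S').erase x).card 2 with h | h
      · obtain ⟨v, hv⟩ := Finset.card_eq_one.1 (show ((S ∩ S').erase x).card = 1 by
          have := Finset.card_pos.2 ⟨p, hpI⟩; omega)
        rw [hv]
        have := pot_singleton_ge (G := G) (w := w) P v
        push_cast at *; linarith
      · have := C.gap P hIV h
        push_cast at *; linarith
    have g3 := pot_insert (b := 4 * k + 4) (u := oddCost k) (G := G) (w := w)
      (Finset.notMem_erase x (S ∩ S'))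
    rw [Finset.insert_erase hxI, hwx, P.zero, deg_erase_self,
      hp' _ (Finset.inter_subset_left.trans hS) (hmem _ (by simp)) (hmem _ (by simp))
        (hmem _ (by simp)), if_pos (Finset.mem_of_mem_erase hpI)] at g3
    have g4 := C.gap P (S := S ∪ S') ⟨Finset.union_subset hS hS', fun h => by
        have := h hdV
        simp [dS, dS'] at this⟩ (by
      refine le_trans ?_ (Finset.card_le_card (show ({x, p} : Finset α) ⊆ S ∪ S' by
        intro u; simp only [Finset.mem_insert, Finset.mem_singleton, Finset.mem_union]
        rintro (rfl | rfl)
        · exact Or.inl xS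
        · exact Or.inl pS))
      rw [Finset.card_pair hpx.symm])
    push_cast at *
    linarith
  by_cases b1 : ∀ S ⊆ V, x ∈ S → p ∈ S → v₁ ∈ S → v₂ ∉ S → v₃ ∉ S →
      (4 * k + 5 : ℤ) ≤ pot (4 * k + 4) (oddCost k) G w S
  · by_cases b2 : ∀ S ⊆ V, x ∈ S → p ∈ S → v₂ ∈ S → v₁ ∉ S → v₃ ∉ S →
        (4 * k + 5 : ℤ) ≤ pot (4 * k + 4) (oddCost k) G w S
    · exact C.false_of_deg_eq_four hx hd hwx h1 h2 h3 h12 h13 h23 hm1 hm2 hm3 hp' b1 b2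
    · push Not at b2
      obtain ⟨S, s1, s2, s3, s4, s5, s6, s7⟩ := b2
      refine C.false_of_deg_eq_four hx hd hwx h1 h3 h2 h13 h12 h23.symm hm1 hm3 hm2
        (fun T hT i1 i2 i3 => hp' T hT i1 i3 i2)
        (fun S a1 a2 a3 a4 a5 a6 => b1 S a1 a2 a3 a4 a6 a5) fun S' a1 a2 a3 a4 a5 a6 => ?_
      by_contra hlt
      exact conflict (a := v₂) (c := v₃) (d := v₁) (by ext; simp; tauto) h1.mem S S' s1 s2 s3 s6
        s5 a1 a2 a3 a6 a5 s7 (not_le.1 hlt)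
  · push Not at b1
    obtain ⟨S, s1, s2, s3, s4, s5, s6, s7⟩ := b1
    refine C.false_of_deg_eq_four hx hd hwx h2 h3 h1 h23 h12.symm h13.symm hm2 hm3 hm1
      (fun T hT i1 i2 i3 => hp' T hT i3 i1 i2) (fun S' a1 a2 a3 a4 a5 a6 => ?_)
      fun S' a1 a2 a3 a4 a5 a6 => ?_
    · by_contra hlt
      exact conflict (a := v₁) (c := v₂) (d := v₃) rfl h3.mem S S' s1 s2 s3 s5
        s6 a1 a2 a3 a6 a5 s7 (not_le.1 hlt)
    · by_contra hlt
      exact conflict (a := v₁) (c := v₃) (d := v₂) (by ext; simp; tauto) h2.mem S S' s1 s2 s3 s6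
        s5 a1 a2 a3 a6 a5 s7 (not_le.1 hlt)

end Counterexample

end MGraph

/-! ### Odd `D`: discharging -/

namespace MGraph

variable {α : Type*} [DecidableEq α]

theorem Forest.path {G : MGraph α} {p q r : α} (hpr : p ≠ r) (hp : G.m p r ≤ 1)
    (hq : G.m q p + G.m q r ≤ 1) : G.Forest {q, p, r} := by
  refine Forest.insert (Forest.insert (Forest.singleton G r) ?_) ?_
  · rwa [deg_singleton]
  · rwa [deg_insert _ _ (by simpa using hpr), deg_singleton]

theorem Bdd.pair {G : MGraph α} {D : ℕ} {w : α → ℕ} {p q : α} (hm : G.m p q ≤ 1)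
    (hp : w p ≤ D) (hq : w q ≤ D) (h : G.m p q = 1 → w p + w q + 1 ≤ D) : G.Bdd D w {p, q} := by
  refine Bdd.insert (w' := fun a => if G.m p q = 1 then w p + w q + 1 else w a)
    (Bdd.singleton G ?_) (by rwa [deg_singleton]) hp ?_ ?_
  · split_ifs with h1
    · exact h h1
    · exact hq
  · intro y hy
    rw [Finset.mem_singleton] at hy
    subst hy
    split_ifs <;> omega
  · intro y hy hmy
    rw [Finset.mem_singleton] at hy
    subst hy
    rw [if_pos (by omega)]; omega

namespace Counterexample

variable {k : ℕ} {G : MGraph α} {w : α → ℕ} {V : Finset α}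

/-- Each vertex outside `A` can give 1 to every neighbour in `A`. The tight cases have charge `-2`:
a heavy vertex of degree 2, degree 3 with weight `k + 1`, or degree 4 with weight 0. The two
preceding reductions limit the neighbours in `A` in the last two cases; elsewhere the degree
suffices. -/
theorem charge_le (C : Counterexample (2 * k + 1) (4 * k + 4) (oddCost k) G w V)
    {A : Finset α} (hA : ∀ v, v ∈ A ↔ Small k G w V v) {x : α} (hx : x ∈ V) (hxA : x ∉ A) {c : ℤ}
    (hc : c = 2 * (2 * ((4 * k + 4 : ℕ) : ℤ) - 1 - oddCost k (w x)) -
      (4 * k + 4 : ℕ) * G.deg x V) :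
    c ≤ -2 ∧ c ≤ -(G.deg x A : ℤ) ∧
      (-2 ≤ c → G.deg x A = 2 → G.deg x V = 2 ∨ G.deg x V = 4 ∧ w x = 0) := by
  have P := oddCost_profile k
  have hAV : A ⊆ V := fun v hv => ((hA v).1 hv).mem
  have hdA : G.deg x A ≤ G.deg x V := G.deg_mono x hAV
  have hcard : G.deg x A = (A.filter fun v => G.m v x ≠ 0).card := by
    rw [Finset.card_filter]
    refine Finset.sum_congr rfl fun v hv => ?_
    have := Small.m_le_one C ((hA v).1 hv) hx
    rw [G.symm]
    split_ifs <;> omega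
  have hw0 : (0 : ℤ) ≤ w x := by positivity
  have h2 := C.two_le_deg hx
  rcases Nat.lt_or_ge (2 * k + 1) (w x) with hw | hw
  · rw [P.top _ hw] at hc
    obtain ⟨d, hd⟩ : ∃ d, G.deg x V = d + 2 := ⟨G.deg x V - 2, by omega⟩
    rw [hd] at hc hdA ⊢
    push_cast at hc
    have hkd : (0 : ℤ) ≤ (k : ℤ) * d := by positivity
    refine ⟨by nlinarith, by nlinarith, fun h _ => Or.inl ?_⟩
    have : (d : ℤ) ≤ 0 := by nlinarith
    omega
  · have h3 := C.three_le_deg hx hw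
    have hu : (oddCost k (w x) : ℤ) = 2 * w x := by
      have : oddCost k (w x) = 2 * w x := by unfold oddCost; omega
      rw [this]; push_cast; rfl
    rw [hu] at hc
    obtain hd | hd | hd : G.deg x V = 3 ∨ G.deg x V = 4 ∨ 5 ≤ G.deg x V := by omega
    · have h4 := C.lt_of_deg_eq_three P hx hd hw
      have hk : w x ≠ k := fun h => hxA ((hA x).2 ⟨hx, hd, h⟩)
      have hk1 : k + 1 ≤ w x := by
        unfold oddCost at h4; omega
      have hle : G.deg x A ≤ 1 := by
        by_contra hlt
        rw [hcard, not_le] at hlt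
        obtain ⟨v₁, g1, v₂, g2, h12⟩ := Finset.one_lt_card.1 hlt
        rw [Finset.mem_filter, hA] at g1 g2
        exact C.not_two_small_of_deg_eq_three hx hd hk1 g1.1 g2.1 h12 g1.2 g2.2
      rw [hd] at hc
      push_cast at hc
      exact ⟨by omega, by omega, fun _ h => by omega⟩
    · rw [hd] at hc
      push_cast at hc
      rcases Nat.eq_zero_or_pos (w x) with h0 | h0
      · have hle : G.deg x A ≤ 2 := by
          by_contra hlt
          rw [hcard, not_le] at hlt
          obtain ⟨v₁, v₂, v₃, g1, g2, g3, h12, h13, h23⟩ := Finset.two_lt_card_iff.1 hlt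
          rw [Finset.mem_filter, hA] at g1 g2 g3
          exact C.not_three_small_of_deg_eq_four hx hd h0 g1.1 g2.1 g3.1 h12 h13 h23 g1.2 g2.2
            g3.2
        exact ⟨by omega, by omega, fun _ _ => Or.inr ⟨hd, h0⟩⟩
      · exact ⟨by omega, by omega, fun _ _ => by omega⟩
    · obtain ⟨d, hd'⟩ : ∃ d, G.deg x V = d + 5 := ⟨G.deg x V - 5, by omega⟩
      rw [hd'] at hc hdA
      push_cast at hc
      have hkd : (0 : ℤ) ≤ (k : ℤ) * d := by positivity
      exact ⟨by nlinarith, by nlinarith, fun h _ => by nlinarith⟩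

theorem false_of_double (C : Counterexample (2 * k + 1) (4 * k + 4) (oddCost k) G w V)
    {v₁ v₂ x₁ x₂ x₃ : α} (h1 : Small k G w V v₁)
    (hV : V = {x₁, v₁} ∪ {x₂, x₃, v₂}) (hdisj : Disjoint ({x₁, v₁} : Finset α) {x₂, x₃, v₂})
    (h3 : x₃ ≠ v₂) (hm : G.m v₁ x₁ ≤ 1) (hm2 : G.m v₂ x₂ ≤ 1) (hm3 : G.m v₂ x₃ ≤ 1)
    (h23 : G.m x₂ x₃ = 0) (hw : w x₁ = 0) : False := by
  refine C.not_colorable ⟨_, _, hV.symm, hdisj, Bdd.pair ?_ ?_ ?_ ?_, Forest.path h3 ?_ ?_⟩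
  · rwa [G.symm]
  · omega
  · rw [h1.weight]; omega
  · intro _; rw [h1.weight, hw]; omega
  · rwa [G.symm]
  · rw [h23, G.symm x₂]; omega

theorem deg_eq_sum_of_card (C : Counterexample (2 * k + 1) (4 * k + 4) (oddCost k) G w V)
    {v : α} (hv : Small k G w V v) {B : Finset α} (hB : B ⊆ V) (hd : G.deg v B = 3) :
    3 ≤ B.card ∧ (B.card = 3 → ∀ x ∈ B, G.m v x = 1) := by
  have h : ∀ x ∈ B, G.m v x ≤ 1 := fun x hx => Small.m_le_one C hv (hB hx)
  have h1 : G.deg v B ≤ ∑ x ∈ B, 1 := Finset.sum_le_sum h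
  rw [Finset.sum_const, smul_eq_mul, mul_one] at h1
  refine ⟨by omega, fun h3 => ?_⟩
  refine (Finset.sum_eq_sum_iff_of_le h).1 ?_
  rw [Finset.sum_const, smul_eq_mul, mul_one, h3]
  exact hd

end Counterexample

/-- If the `xᵢ` are independent, they form `F`. If `x₁x₂` is a simple edge with weight-zero ends, it
forms `M`. Otherwise some weight-zero `xᵢ`, whose two companions are nonadjacent, goes to `M` with
`v₁`; that tree has total `k + 1`, and `F` is a path. -/
theorem Counterexample.false_of_five {k : ℕ} {G : MGraph α} {w : α → ℕ} {V : Finset α}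
    (C : Counterexample (2 * k + 1) (4 * k + 4) (oddCost k) G w V) {v₁ v₂ x₁ x₂ x₃ : α}
    (s1 : Small k G w V v₁) (s2 : Small k G w V v₂) (hV : V = {v₁, v₂} ∪ {x₁, x₂, x₃})
    (hv : v₁ ≠ v₂) (h12 : x₁ ≠ x₂) (h13 : x₁ ≠ x₃) (h23 : x₂ ≠ x₃)
    (n11 : v₁ ≠ x₁) (n12 : v₁ ≠ x₂) (n13 : v₁ ≠ x₃) (n21 : v₂ ≠ x₁) (n22 : v₂ ≠ x₂)
    (n23 : v₂ ≠ x₃) (m11 : G.m v₁ x₁ = 1) (m12 : G.m v₁ x₂ = 1) (m13 : G.m v₁ x₃ = 1)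
    (m21 : G.m v₂ x₁ = 1) (m22 : G.m v₂ x₂ = 1) (m23 : G.m v₂ x₃ = 1)
    (f1 : G.m x₁ x₂ + G.m x₁ x₃ = 0 ∨ G.m x₁ x₂ + G.m x₁ x₃ = 2 ∧ w x₁ = 0)
    (f2 : G.m x₁ x₂ + G.m x₂ x₃ = 0 ∨ G.m x₁ x₂ + G.m x₂ x₃ = 2 ∧ w x₂ = 0)
    (f3 : G.m x₁ x₃ + G.m x₂ x₃ = 0 ∨ G.m x₁ x₃ + G.m x₂ x₃ = 2 ∧ w x₃ = 0) : False := by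
  have hmv := C.small_not_adj s1 s2
  obtain g | g | g | g | g : (G.m x₁ x₂ = 0 ∧ G.m x₁ x₃ = 0 ∧ G.m x₂ x₃ = 0) ∨
      (G.m x₁ x₂ = 1 ∧ w x₁ = 0 ∧ w x₂ = 0) ∨
      (G.m x₂ x₃ = 0 ∧ w x₁ = 0) ∨ (G.m x₁ x₃ = 0 ∧ w x₂ = 0) ∨
      (G.m x₁ x₂ = 0 ∧ w x₃ = 0) := by omega
  · refine C.not_colorable ⟨_, _, hV.symm, ?_, ?_, ?_⟩
    · simp; grind
    · exact Bdd.pair (by omega) (by rw [s1.weight]; omega) (by rw [s2.weight]; omega) (by omega)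
    · exact Forest.path h23 (by omega) (by omega)
  · refine C.not_colorable ⟨{x₁, x₂}, {v₁, x₃, v₂}, ?_, ?_, ?_, ?_⟩
    · rw [hV]; ext a; simp only [Finset.mem_union, Finset.mem_insert, Finset.mem_singleton]; grind
    · simp; grind
    · exact Bdd.pair (by omega) (by omega) (by omega) (by omega)
    · exact Forest.path n23.symm (by rw [G.symm]; omega) (by omega)
  · exact C.false_of_double s1 (x₁ := x₁) (x₂ := x₂) (x₃ := x₃)
      (by rw [hV]; ext a; simp only [Finset.mem_union, Finset.mem_insert, Finset.mem_singleton]; grind) (by simp; grind)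
      n23.symm m11.le m22.le m23.le g.1 g.2
  · exact C.false_of_double s1 (x₁ := x₂) (x₂ := x₁) (x₃ := x₃)
      (by rw [hV]; ext a; simp only [Finset.mem_union, Finset.mem_insert, Finset.mem_singleton]; grind) (by simp; grind)
      n23.symm m12.le m21.le m23.le g.1 g.2
  · exact C.false_of_double s1 (x₁ := x₃) (x₂ := x₁) (x₃ := x₂)
      (by rw [hV]; ext a; simp only [Finset.mem_union, Finset.mem_insert, Finset.mem_singleton]; grind)
      (by simp; grind)
      n22.symm m13.le m21.le m22.le g.1 g.2

theorem odd_no_counterexample {k : ℕ} {G : MGraph α} {w : α → ℕ} {V : Finset α}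
    (C : Counterexample (2 * k + 1) (4 * k + 4) (oddCost k) G w V) : False := by
  classical
  have P := oddCost_profile k
  have hn := C.three_le_card P
  set A := V.filter fun v => Small k G w V v with hAdef
  have hA : ∀ v, v ∈ A ↔ Small k G w V v := fun v => by
    rw [hAdef, Finset.mem_filter]
    exact ⟨fun h => h.2, fun h => ⟨h.mem, h⟩⟩
  set B := V \ A with hBdef
  have hAV : A ⊆ V := Finset.filter_subset _ _
  have hBV : B ⊆ V := Finset.sdiff_subset
  have hAB : Disjoint A B := Finset.disjoint_sdiff
  have hU : A ∪ B = V := Finset.union_sdiff_of_subset hAV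
  set ch : α → ℤ := fun v => 2 * (2 * ((4 * k + 4 : ℕ) : ℤ) - 1 - oddCost k (w v)) -
      (4 * k + 4 : ℕ) * G.deg v V with hch
  have hsum : 2 * pot (4 * k + 4) (oddCost k) G w V = ∑ v ∈ A, ch v + ∑ v ∈ B, ch v := by
    rw [two_mul_pot, ← Finset.sum_union hAB, hU]
  have hB : ∀ x ∈ B, _ := fun x hx => C.charge_le hA (hBV hx) (Finset.mem_sdiff.1 hx).2
    (c := ch x) rfl
  have hchA : ∑ v ∈ A, ch v = 2 * A.card := by
    rw [Finset.sum_congr rfl (g := fun _ => (2 : ℤ)), Finset.sum_const, nsmul_eq_mul, mul_comm]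
    intro v hv
    have hv := (hA v).1 hv
    have huk : oddCost k k = 2 * k := by unfold oddCost; omega
    simp only [hch, hv.deg_eq, hv.weight, huk]
    push_cast; ring
  have hdA : ∀ v ∈ A, G.deg v A = 0 := fun v hv => Finset.sum_eq_zero fun a ha =>
    C.small_not_adj ((hA v).1 hv) ((hA a).1 ha)
  have hdB : ∀ v ∈ A, G.deg v B = 3 := fun v hv => by
    have := deg_union G v hAB
    rw [hU, hdA v hv, ((hA v).1 hv).deg_eq] at this
    omega
  have hcross : ∑ x ∈ B, G.deg x A = 3 * A.card := by
    change G.cross B A = _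
    rw [cross_comm]
    change ∑ v ∈ A, G.deg v B = _
    rw [Finset.sum_congr rfl hdB, Finset.sum_const, smul_eq_mul, mul_comm]
  have hb1 : ∑ x ∈ B, ch x ≤ ∑ x ∈ B, -(G.deg x A : ℤ) := Finset.sum_le_sum fun x hx => (hB x hx).2.1
  have hb2 : ∑ x ∈ B, ch x ≤ ∑ x ∈ B, (-2 : ℤ) := Finset.sum_le_sum fun x hx => (hB x hx).1
  have hcross' : (∑ x ∈ B, (G.deg x A : ℤ)) = 3 * A.card := by exact_mod_cast hcross
  rw [Finset.sum_neg_distrib, hcross'] at hb1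
  have hb2' := hb2
  rw [Finset.sum_const, nsmul_eq_mul] at hb2
  have hcard : A.card + B.card = V.card := by rw [← hU, Finset.card_union_of_disjoint hAB]
  have hpot := C.pot_ge
  have hdeg : ∀ v ∈ A, _ := fun v hv => C.deg_eq_sum_of_card ((hA v).1 hv) hBV (hdB v hv)
  -- The total charge is at least `-2`. Charges on `B` sum to at most `-3|A|` and at most `-2|B|`,
  -- so `|A| ≤ 2` and `|B| ≤ |A| + 1`; a vertex of `A` has three distinct neighbours in `B`.
  have hs : A.card = 2 ∧ B.card = 3 := by
    have : A.card ≠ 0 → 3 ≤ B.card := fun h => by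
      obtain ⟨v, hv⟩ := Finset.card_pos.1 (Nat.pos_of_ne_zero h)
      exact (hdeg v hv).1
    omega
  -- `A` contributes 4, so the three charges on `B`, each at most `-2`, sum to at least `-6`.
  have heq : ∀ x ∈ B, ch x = -2 := by
    refine (Finset.sum_eq_sum_iff_of_le fun x hx => (hB x hx).1).1 (le_antisymm hb2' ?_)
    rw [Finset.sum_const, nsmul_eq_mul, hs.2]
    rw [hs.1] at hchA
    push_cast at *
    linarith
  have hadj : ∀ v ∈ A, ∀ x ∈ B, G.m v x = 1 := fun v hv => (hdeg v hv).2 hs.2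
  have hxA : ∀ x ∈ B, G.deg x A = 2 := fun x hx => by
    rw [← hs.1, Finset.card_eq_sum_ones]
    exact Finset.sum_congr rfl fun v hv => by rw [G.symm]; exact hadj v hv x hx
  have hxB : ∀ x ∈ B, G.deg x B = 0 ∨ G.deg x B = 2 ∧ w x = 0 := fun x hx => by
    have h1 := (hB x hx).2.2 (heq x hx).ge (hxA x hx)
    have h2 := deg_union G x hAB
    rw [hU, hxA x hx] at h2
    omega
  obtain ⟨v₁, v₂, hv, hAeq⟩ := Finset.card_eq_two.1 hs.1
  obtain ⟨x₁, x₂, x₃, h12, h13, h23, hBeq⟩ := Finset.card_eq_three.1 hs.2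
  have hv1 : v₁ ∈ A := by rw [hAeq]; simp
  have hv2 : v₂ ∈ A := by rw [hAeq]; simp
  have hx1 : x₁ ∈ B := by rw [hBeq]; simp
  have hx2 : x₂ ∈ B := by rw [hBeq]; simp
  have hx3 : x₃ ∈ B := by rw [hBeq]; simp
  have ne : ∀ {v x}, v ∈ A → x ∈ B → v ≠ x := fun hv hx h =>
    Finset.disjoint_left.1 hAB hv (h ▸ hx)
  have s1 := (hA _).1 hv1
  have s2 := (hA _).1 hv2
  have e1 : G.deg x₁ B = G.m x₁ x₂ + G.m x₁ x₃ := by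
    rw [hBeq, deg_insert_self, deg_insert _ _ (by simpa using h23), deg_singleton]
  have e2 : G.deg x₂ B = G.m x₁ x₂ + G.m x₂ x₃ := by
    rw [hBeq, Finset.insert_comm, deg_insert_self, deg_insert _ _ (by simpa using h13),
      deg_singleton, G.symm]
  have e3 : G.deg x₃ B = G.m x₁ x₃ + G.m x₂ x₃ := by
    rw [hBeq, deg_insert _ _ (by simp [h12, h13]), deg_insert _ _ (by simpa using h23),
      deg_singleton, G.irrefl, G.symm x₃ x₁, G.symm x₃ x₂, add_zero]
  have f1 := hxB x₁ hx1
  have f2 := hxB x₂ hx2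
  have f3 := hxB x₃ hx3
  rw [e1] at f1
  rw [e2] at f2
  rw [e3] at f3
  exact C.false_of_five s1 s2 (by rw [← hU, hAeq, hBeq]) hv h12 h13 h23 (ne hv1 hx1)
    (ne hv1 hx2) (ne hv1 hx3) (ne hv2 hx1) (ne hv2 hx2) (ne hv2 hx3) (hadj _ hv1 _ hx1)
    (hadj _ hv1 _ hx2) (hadj _ hv1 _ hx3) (hadj _ hv2 _ hx1) (hadj _ hv2 _ hx2)
    (hadj _ hv2 _ hx3) f1 f2 f3

end MGraph

/-! ### The density bound for edge multiplicities -/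

namespace MGraph

variable {α : Type*} [DecidableEq α]

theorem colorable_of_no_counterexample {D b : ℕ} {u : ℕ → ℕ}
    (h : ∀ (G : MGraph α) (w : α → ℕ) (V : Finset α), ¬ Counterexample D b u G w V) (n : ℕ) :
    ∀ (G : MGraph α) (w : α → ℕ) (V : Finset α), V.card = n →
      (∀ T ⊆ V, T.Nonempty → -1 ≤ pot b u G w T) → G.Colorable D w V := by
  induction n using Nat.strong_induction_on with
  | _ n ih =>
    rintro G w V rfl hpot
    by_contra hnc
    refine h G w V ⟨fun G' w' V' hc hp => ih _ hc G' w' V' rfl hp, hnc, fun S hS => ?_, ?_⟩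
    · exact ih _ (Finset.card_lt_card hS) G w S rfl fun T hT => hpot T (hT.trans hS.1)
    · refine hpot V (Finset.Subset.refl _) ?_
      rw [Finset.nonempty_iff_ne_empty]
      rintro rfl
      exact hnc ⟨∅, ∅, rfl, by simp, Bdd.empty _ _ _, Forest.empty _⟩

/-- The cost `b` of an edge in the potential, in which a vertex contributes `2 * b - 1`. -/
def edgeCost (D : ℕ) : ℕ := if Even D then 2 * D + 1 else 2 * D + 2

/-- A vertex-critical multigraph is dense. -/
theorem dense_of_critical {D : ℕ} (hD : 1 ≤ D) {G : MGraph α} {V : Finset α}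
    (h : ¬ G.Colorable D 0 V) (hc : ∀ S ⊂ V, G.Colorable D 0 S) :
    (2 * edgeCost D - 1) * V.card + 2 ≤ edgeCost D * G.e V := by
  by_contra hcon
  have key : ∀ {u : ℕ → ℕ}, Profile D (edgeCost D) u →
      (∀ (G : MGraph α) (w : α → ℕ) (V : Finset α), ¬ Counterexample D (edgeCost D) u G w V) →
      False := by
    intro u P hno
    refine hno G 0 V ⟨fun G' w' V' _ => colorable_of_no_counterexample hno _ G' w' V' rfl, h, hc,
      ?_⟩
    have h2 := P.three_le
    obtain ⟨c, hc⟩ : ∃ c, edgeCost D = c + 1 := ⟨edgeCost D - 1, by omega⟩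
    unfold pot
    simp only [Pi.zero_apply, P.zero, Finset.sum_const, nsmul_eq_mul]
    rw [hc] at hcon ⊢
    rw [show 2 * (c + 1) - 1 = 2 * c + 1 by omega] at hcon
    zify at hcon
    push_cast
    linarith
  rcases Nat.even_or_odd' D with ⟨t, rfl | rfl⟩
  · have hb : edgeCost (2 * t) = 4 * t + 1 := by
      unfold edgeCost; rw [if_pos (even_two_mul t)]; ring
    rw [hb] at key
    have ht : 1 ≤ t := by omega
    exact key (evenCost_profile ht) fun _ _ _ C => even_no_counterexample ht C
  · have hb : edgeCost (2 * t + 1) = 4 * t + 4 := by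
      unfold edgeCost; rw [if_neg (by simp)]; ring
    rw [hb] at key
    exact key (oddCost_profile t) fun _ _ _ C => odd_no_counterexample C

/-- A multigraph without colouring has a dense set of vertices. -/
theorem exists_dense {D : ℕ} (hD : 1 ≤ D) {G : MGraph α} {V : Finset α}
    (h : ¬ G.Colorable D 0 V) : ∃ S ⊆ V, S.Nonempty ∧
      (2 * edgeCost D - 1) * S.card + 2 ≤ edgeCost D * G.e S := by
  classical
  obtain ⟨S, hS, hmin⟩ := Finset.exists_min_image
    (V.powerset.filter fun S => ¬ G.Colorable D 0 S) Finset.card ⟨V, by simp [h]⟩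
  simp only [Finset.mem_filter, Finset.mem_powerset] at hS hmin
  refine ⟨S, hS.1, ?_, dense_of_critical hD hS.2 fun T hT => ?_⟩
  · rw [Finset.nonempty_iff_ne_empty]
    rintro rfl
    exact hS.2 ⟨∅, ∅, rfl, by simp, Bdd.empty _ _ _, Forest.empty _⟩
  · by_contra hnc
    have := hmin T ⟨hT.1.trans hS.1, hnc⟩
    have := Finset.card_lt_card hT
    omega

end MGraph

/-! ### Translation between multigraphs and edge multiplicities -/

namespace Graph

variable {α β : Type*}

/-- The edge multiplicities of a loopless multigraph. -/
noncomputable def toMGraph (G : Graph α β) (hL : G.Loopless) : MGraph α where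
  m a b := {e | G.IsLink e a b}.ncard
  symm a b := by simp only [G.isLink_comm]
  irrefl a := by
    have : {e | G.IsLink e a a} = ∅ := by
      ext e
      simp only [Set.mem_ofPred_eq, Set.mem_empty_iff_false, iff_false]
      exact fun h => hL.not_isLoopAt e a h
    rw [this, Set.ncard_empty]

variable [DecidableEq α] {G : Graph α β} {hL : G.Loopless}

theorem ncard_links_eq_deg (hE : E(G).Finite) (v : α) (T : Finset α) :
    {e | ∃ y ∈ T, G.IsLink e v y}.ncard = (G.toMGraph hL).deg v T := by
  have hfin : ∀ T : Finset α, {e | ∃ y ∈ T, G.IsLink e v y}.Finite := fun T =>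
    hE.subset fun e ⟨y, _, h⟩ => h.edge_mem
  induction T using Finset.induction_on with
  | empty => simp [MGraph.deg_empty]
  | insert b T hb ih =>
    have h1 : {e | ∃ y ∈ insert b T, G.IsLink e v y} =
        {e | G.IsLink e v b} ∪ {e | ∃ y ∈ T, G.IsLink e v y} := by
      ext e; simp
    have h2 : {e | G.IsLink e v b}.Finite := hE.subset fun e h => IsLink.edge_mem h
    rw [h1, Set.ncard_union_eq ?_ h2 (hfin T), ih, MGraph.deg_insert _ _ hb]
    · rfl
    · rw [Set.disjoint_left]
      rintro e h ⟨y, hy, h'⟩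
      exact hb (IsLink.right_unique h h' ▸ hy)

theorem ncard_edgeSet_induce (hE : E(G).Finite) (T : Finset α) :
    E(G.induce T).ncard = (G.toMGraph hL).e T := by
  induction T using Finset.induction_on with
  | empty => simp [MGraph.e_empty, edgeSet_induce]
  | insert v T hv ih =>
    have h1 : E(G.induce (insert v T : Finset α)) =
        E(G.induce T) ∪ {e | ∃ y ∈ T, G.IsLink e v y} := by
      ext e
      simp only [edgeSet_induce, Finset.coe_insert, Set.mem_insert_iff, Finset.mem_coe,
        Set.mem_ofPred_eq, Set.mem_union]
      constructor
      · rintro ⟨x, y, h, rfl | hx, rfl | hy⟩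
        · exact absurd h (hL.not_isLoopAt e _)
        · exact Or.inr ⟨y, hy, h⟩
        · exact Or.inr ⟨x, hx, h.symm⟩
        · exact Or.inl ⟨x, y, h, hx, hy⟩
      · rintro (⟨x, y, h, hx, hy⟩ | ⟨y, hy, h⟩)
        · exact ⟨x, y, h, Or.inr hx, Or.inr hy⟩
        · exact ⟨v, y, h, Or.inl rfl, Or.inr hy⟩
    rw [h1, Set.ncard_union_eq ?_ (hE.subset ?_) (hE.subset ?_), ih,
      ncard_links_eq_deg (hL := hL) hE, MGraph.e_insert _ hv]
    · rw [Set.disjoint_left]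
      rintro e ⟨x, y, h, hx, hy⟩ ⟨z, hz, h'⟩
      rcases h'.left_eq_or_eq h with rfl | rfl
      · exact hv hx
      · exact hv hy
    · rintro e ⟨x, y, h, -⟩
      exact h.edge_mem
    · rintro e ⟨y, -, h⟩
      exact h.edge_mem

/-- A cycle is a vertex set spanning at least as many edges as it has vertices. -/
theorem isForest_induce_of_forest (hE : E(G).Finite) {F : Finset α}
    (h : (G.toMGraph hL).Forest F) : (G.induce F).IsForest := by
  rintro ⟨n, v, e, hv, he, hl⟩
  have h1 := h (Finset.univ.image v) (fun x hx => by
    obtain ⟨i, -, rfl⟩ := Finset.mem_image.1 hx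
    exact (hl i).2.1) (by simp)
  rw [Finset.card_image_of_injective _ hv, Finset.card_univ, Fintype.card_fin,
    ← ncard_edgeSet_induce (hL := hL) hE] at h1
  have h2 : Set.range e ⊆ E(G.induce (Finset.univ.image v : Finset α)) := by
    rintro _ ⟨i, rfl⟩
    exact ⟨v i, v (i + 1), (hl i).1, by simp, by simp⟩
  have h3 := Set.ncard_le_ncard h2 (hE.subset fun e ⟨x, y, h, _⟩ => h.edge_mem)
  rw [← Set.image_univ, Set.ncard_image_of_injective _ he, Set.ncard_univ, Nat.card_fin] at h3
  omega

/-- A finite vertex set of minimum degree at least two contains a cycle. -/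
theorem not_isForest_of_two_le_deg (hE : E(G).Finite) {F T : Finset α} (hTF : T ⊆ F)
    (hne : T.Nonempty) (hd : ∀ v ∈ T, 2 ≤ (G.toMGraph hL).deg v T) :
    ¬ (G.induce F).IsForest := by
  intro hF
  apply hF
  obtain ⟨x₀, hx₀⟩ := hne
  have next : ∀ x ∈ T, ∀ e, ∃ e' y, e' ≠ e ∧ y ∈ T ∧ G.IsLink e' x y := by
    intro x hx e
    have h1 := hd x hx
    rw [← ncard_links_eq_deg (hL := hL) hE] at h1
    obtain ⟨e', ⟨y, hy, hl⟩, hne⟩ := Set.exists_ne_of_one_lt_ncard h1 e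
    exact ⟨e', y, hne, hy, hl⟩
  obtain ⟨e₀, he₀⟩ : ∃ e, e ∈ E(G) := by
    have h1 := hd x₀ hx₀
    rw [← ncard_links_eq_deg (hL := hL) hE] at h1
    obtain ⟨e, y, hy, hl⟩ := (Set.one_lt_ncard_iff_nontrivial_and_finite.1 h1).1.nonempty
    exact ⟨e, hl.edge_mem⟩
  choose! ne ny hne hny hnl using next
  -- A walk in `T` that never repeats the edge just used; a state is the current vertex with the
  -- last edge, and `e₀` is an arbitrary start. It is cut at its first return to a visited vertex.
  let st : ℕ → α × β := fun i => Nat.rec (x₀, e₀) (fun _ p => (ny p.1 p.2, ne p.1 p.2)) i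
  have hstT : ∀ i, (st i).1 ∈ T := by
    intro i
    induction i with
    | zero => exact hx₀
    | succ i ih => exact hny _ ih _
  have hlink : ∀ i, G.IsLink (st (i + 1)).2 (st i).1 (st (i + 1)).1 := fun i =>
    hnl _ (hstT i) _
  have hnb : ∀ i, (st (i + 1)).2 ≠ (st i).2 := fun i => hne _ (hstT i) _
  have hex : ∃ j, ∃ i < j, (st i).1 = (st j).1 := by
    obtain ⟨i, j, hij, h⟩ := Finite.exists_ne_map_eq_of_infinite
      (fun i : ℕ => (⟨(st i).1, hstT i⟩ : T))
    rw [Subtype.mk.injEq] at h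
    rcases Nat.lt_or_gt_of_ne hij with h' | h'
    · exact ⟨j, i, h', h⟩
    · exact ⟨i, j, h', h.symm⟩
  classical
  obtain ⟨i, hij, hx⟩ := Nat.find_spec hex
  have hmin : ∀ a b, a < b → b < Nat.find hex → (st a).1 ≠ (st b).1 := fun a b hab hb h =>
    Nat.find_min hex hb ⟨a, hab, h⟩
  set j := Nat.find hex
  obtain ⟨n, hn⟩ : ∃ n, j = i + n + 1 := ⟨j - i - 1, by omega⟩
  have hinj : ∀ a b, a ≤ n → b ≤ n → (st (i + a)).1 = (st (i + b)).1 → a = b := by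
    intro a b ha hb h
    rcases Nat.lt_trichotomy a b with h' | h' | h'
    · exact absurd h (hmin _ _ (by omega) (by omega))
    · exact h'
    · exact absurd h.symm (hmin _ _ (by omega) (by omega))
  refine ⟨n, fun k => (st (i + k)).1, fun k => (st (i + k + 1)).2, ?_, ?_, ?_⟩
  · intro a b h
    exact Fin.ext (hinj a b (by omega) (by omega) h)
  -- An edge used twice in the same direction repeats a vertex. In opposite directions, the two uses
  -- are consecutive, which the walk forbids.
  · have key : ∀ a b : ℕ, a < b → b ≤ n → (st (i + a + 1)).2 ≠ (st (i + b + 1)).2 := by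
      intro a b hab hb h
      have h1 := hlink (i + a)
      have h2 := hlink (i + b)
      rw [h] at h1
      rcases h1.eq_and_eq_or_eq_and_eq h2 with ⟨h3, -⟩ | ⟨-, h4⟩
      · have := hinj a b (by omega) hb h3
        omega
      · have h5 := hinj (a + 1) b (by omega) hb h4
        subst h5
        exact hnb (i + a + 1) h.symm
    intro a b h
    rcases Nat.lt_trichotomy a b with h' | h' | h'
    · exact absurd h (key _ _ h' (by omega))
    · exact Fin.ext h'
    · exact absurd h.symm (key _ _ h' (by omega))
  · intro k
    refine ⟨?_, hTF (hstT _), hTF (hstT _)⟩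
    have h1 := hlink (i + k)
    rcases Nat.lt_or_ge k n with hk | hk
    · have h2 : ((k + 1 : Fin (n + 1)) : ℕ) = k + 1 := by
        rw [Fin.val_add_one, if_neg]
        rintro rfl
        simp at hk
      simp only [h2]
      exact h1
    · have h2 : k = Fin.last n := Fin.ext (by simp; omega)
      subst h2
      simp only [Fin.last_add_one, Fin.val_zero, Fin.val_last, add_zero] at h1 ⊢
      rw [hx, hn]
      exact h1

/-- A smallest set violating the count has minimum degree at least two, since deleting a vertex of
degree at most one preserves the violation. Such a set contains a cycle. -/
theorem forest_of_isForest_induce (hE : E(G).Finite) {F : Finset α}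
    (h : (G.induce F).IsForest) : (G.toMGraph hL).Forest F := by
  by_contra hcon
  unfold MGraph.Forest at hcon
  push Not at hcon
  obtain ⟨T₀, h1, h2, h3⟩ := hcon
  obtain ⟨T, hT, hmin⟩ := Finset.exists_min_image
    (F.powerset.filter fun T => T.Nonempty ∧ T.card < (G.toMGraph hL).e T + 1) Finset.card
    ⟨T₀, by simp [h1, h2]; omega⟩
  simp only [Finset.mem_filter, Finset.mem_powerset] at hT hmin
  refine not_isForest_of_two_le_deg (hL := hL) hE hT.1 hT.2.1 (fun v hv => ?_) h
  by_contra hlt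
  have h4 := (G.toMGraph hL).e_insert (Finset.notMem_erase v T)
  have h5 := Finset.card_erase_of_mem hv
  have h6 := Finset.card_pos.2 ⟨v, hv⟩
  rw [Finset.insert_erase hv, MGraph.deg_erase_self] at h4
  rcases (T.erase v).eq_empty_or_nonempty with h7 | h7
  · rw [h7, MGraph.e_empty] at h4
    rw [h7, Finset.card_empty] at h5
    have h8 : (G.toMGraph hL).deg v T = 0 := by
      rw [← MGraph.deg_erase_self, h7, MGraph.deg_empty]
    omega
  · have := hmin (T.erase v) ⟨(Finset.erase_subset _ _).trans hT.1, h7, by omega⟩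
    omega

theorem m_ne_zero_iff_adj (hE : E(G).Finite) {a b : α} :
    (G.toMGraph hL).m a b ≠ 0 ↔ G.Adj a b := by
  change Set.ncard _ ≠ 0 ↔ _
  have h2 : {e | G.IsLink e a b}.Finite := hE.subset fun e h => IsLink.edge_mem h
  rw [← Nat.pos_iff_ne_zero, Set.ncard_pos h2]
  rfl

theorem induce_induce_of_subset (G : Graph α β) {M C : Set α} (hC : C ⊆ M) :
    (G.induce M).induce C = G.induce C := by
  refine Graph.ext rfl fun e x y => ?_
  simp only [induce_isLink]
  exact ⟨fun h => ⟨h.1.1, h.2⟩, fun h => ⟨⟨h.1, hC h.2.1, hC h.2.2⟩, h.2⟩⟩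

theorem componentSet_subset {M : Set α} {x : α} (hx : x ∈ M) :
    (G.induce M).componentSet x ⊆ M := by
  intro y hy
  induction hy with
  | refl => exact hx
  | tail _ h _ => exact h.right_mem

/-- A component has at least as many edges as vertices, less one. -/
theorem card_component_le (hE : E(G).Finite) {M : Set α} {x : α} {C : Finset α}
    (hC : (C : Set α) = (G.induce M).componentSet x) : C.card ≤ (G.toMGraph hL).e C + 1 := by
  have hxC : x ∈ C := by
    rw [← Finset.mem_coe, hC]; exact Relation.ReflTransGen.refl
  obtain ⟨T, hT, hmax⟩ := Finset.exists_max_image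
    (C.powerset.filter fun T => x ∈ T ∧ T.card ≤ (G.toMGraph hL).e T + 1) Finset.card
    ⟨{x}, by simp [hxC]⟩
  simp only [Finset.mem_filter, Finset.mem_powerset] at hT hmax
  by_cases hTC : C ⊆ T
  · rw [Finset.Subset.antisymm hTC hT.1]; exact hT.2.2
  exfalso
  obtain ⟨y, hy, hyT⟩ := Finset.not_subset.1 hTC
  obtain ⟨a, ha, c, hcT, hcC, hac⟩ : ∃ a ∈ T, ∃ c, c ∉ T ∧ c ∈ C ∧ (G.induce M).Adj a c := by
    by_contra hcon
    push Not at hcon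
    apply hyT
    rw [← Finset.mem_coe, hC] at hy
    have : ∀ z, Relation.ReflTransGen (G.induce M).Adj x z → z ∈ T := by
      intro z hz
      induction hz with
      | refl => exact hT.2.1
      | tail h1 h2 ih =>
        by_contra hzT
        refine hcon _ ih _ hzT ?_ h2
        rw [← Finset.mem_coe, hC]
        exact h1.tail h2
    exact this y hy
  have h1 : (G.toMGraph hL).m c a ≠ 0 := (m_ne_zero_iff_adj hE).2 (by
    obtain ⟨e, he⟩ := hac
    exact ⟨e, he.1.symm⟩)
  have h2 := (G.toMGraph hL).m_le_deg c ha
  have h3 := (G.toMGraph hL).e_insert hcT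
  have h4 := Finset.card_insert_of_notMem hcT
  have h5 := hmax (insert c T) ⟨Finset.insert_subset hcC hT.1, by simp [hT.2.1], by omega⟩
  omega

/-- In a forest, the sets with one more vertex than edges are the trees. Components are such sets,
and each such set lies in one component, so bounding all of them is the same as bounding the
components. -/
theorem bdd_iff (hE : E(G).Finite) {D : ℕ} {M : Finset α} :
    (G.toMGraph hL).Bdd D 0 M ↔ (G.induce M).IsForest ∧ ∀ x ∈ (M : Set α),
      E((G.induce M).induce ((G.induce M).componentSet x)).encard ≤ (D : ℕ∞) := by
  have hcomp : ∀ x ∈ M, ∃ C : Finset α, (C : Set α) = (G.induce M).componentSet x ∧ C ⊆ M ∧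
      E((G.induce M).induce ((G.induce M).componentSet x)).encard =
        ((G.toMGraph hL).e C : ℕ∞) := by
    intro x hx
    have h1 : (G.induce M).componentSet x ⊆ M := componentSet_subset (by simpa using hx)
    have h2 : ((G.induce M).componentSet x).Finite := M.finite_toSet.subset h1
    refine ⟨h2.toFinset, h2.coe_toFinset, by simpa using h1, ?_⟩
    rw [induce_induce_of_subset G h1, ← ncard_edgeSet_induce (hL := hL) hE, h2.coe_toFinset,
      Set.Finite.cast_ncard_eq]
    exact hE.subset fun e ⟨x, y, h, _⟩ => h.edge_mem
  constructor
  · intro h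
    refine ⟨isForest_induce_of_forest hE h.forest, fun x hx => ?_⟩
    obtain ⟨C, hC, hCM, he⟩ := hcomp x hx
    rw [he]
    have hxC : x ∈ C := by
      rw [← Finset.mem_coe, hC]; exact Relation.ReflTransGen.refl
    have h1 := h C hCM ⟨x, hxC⟩
    have h2 := card_component_le (hL := hL) hE hC
    have h3 := h1.2 (by omega)
    simp only [Pi.zero_apply, Finset.sum_const_zero, add_zero] at h3
    exact_mod_cast h3
  · rintro ⟨h1, h2⟩ T hT ⟨x, hx⟩
    have hf := forest_of_isForest_induce (hL := hL) hE h1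
    refine ⟨hf T hT ⟨x, hx⟩, fun ht => ?_⟩
    obtain ⟨C, hC, hCM, he⟩ := hcomp x (hT hx)
    have h3 := h2 x (hT hx)
    rw [he] at h3
    have h3 : (G.toMGraph hL).e C ≤ D := by exact_mod_cast h3
    have hxC : x ∈ C := by
      rw [← Finset.mem_coe, hC]; exact Relation.ReflTransGen.refl
    -- If `T` left `C`, its two pieces would be forests with no edge between them, so `T` would span
    -- at most `|T| - 2` edges.
    have hTC : T ⊆ C := by
      by_contra hcon
      have hne : (T \ C).Nonempty := Finset.sdiff_nonempty.2 hcon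
      have e1 := hf (T ∩ C) (Finset.inter_subset_left.trans hT)
        ⟨x, Finset.mem_inter.2 ⟨hx, hxC⟩⟩
      have e2 := hf (T \ C) (Finset.sdiff_subset.trans hT) hne
      have hd : Disjoint (T ∩ C) (T \ C) := by
        rw [Finset.disjoint_left]; intro a; simp; tauto
      have hU : (T ∩ C) ∪ (T \ C) = T := by ext a; simp; tauto
      have e3 := (G.toMGraph hL).e_union hd
      have e4 := Finset.card_union_of_disjoint hd
      rw [hU] at e3 e4
      have e5 : (G.toMGraph hL).cross (T ∩ C) (T \ C) = 0 := by
        refine Finset.sum_eq_zero fun a ha => Finset.sum_eq_zero fun c hc => ?_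
        by_contra hm
        rw [Finset.mem_inter] at ha
        rw [Finset.mem_sdiff] at hc
        obtain ⟨e, he⟩ := (m_ne_zero_iff_adj hE).1 hm
        refine hc.2 ?_
        rw [← Finset.mem_coe, hC]
        have haC : a ∈ (G.induce M).componentSet x := by rw [← hC]; exact ha.2
        exact Relation.ReflTransGen.tail haC ⟨e, he, hT ha.1, hT hc.1⟩
      omega
    have := (G.toMGraph hL).e_mono hTC
    simp only [Pi.zero_apply, Finset.sum_const_zero, add_zero]
    omega

theorem edgeColorable_iff (hE : E(G).Finite) {D : ℕ} {V : Finset α} (hV : (V : Set α) = V(G)) :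
    G.EdgeColorable D ↔ (G.toMGraph hL).Colorable D 0 V := by
  constructor
  · rintro ⟨M, F, h⟩
    have hM : M.Finite := V.finite_toSet.subset (by
      rw [hV, ← h.union_eq]; exact Set.subset_union_left)
    have hF : F.Finite := V.finite_toSet.subset (by
      rw [hV, ← h.union_eq]; exact Set.subset_union_right)
    lift M to Finset α using hM
    lift F to Finset α using hF
    refine ⟨M, F, ?_, ?_, ?_, ?_⟩
    · have := h.union_eq
      rw [← hV] at this
      exact_mod_cast this
    · exact_mod_cast h.disjoint
    · exact (bdd_iff hE).2 ⟨h.forest_left, h.component_le⟩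
    · exact forest_of_isForest_induce hE h.forest_right
  · rintro ⟨M, F, hU, h⟩
    have hb := (bdd_iff hE).1 h.bdd
    refine ⟨M, F, ?_, by exact_mod_cast h.disj, hb.1, hb.2, isForest_induce_of_forest hE h.forest⟩
    rw [← hV, ← hU]; simp

end Graph

namespace Graph

variable {α β : Type*}

theorem EdgeCritical.dense {D : ℕ} (hD : 1 ≤ D) {G : Graph α β} (hV : V(G).Finite)
    (hE : E(G).Finite) (hL : G.Loopless) (h : G.EdgeCritical D) :
    (2 * MGraph.edgeCost D - 1) * V(G).ncard + 2 ≤ MGraph.edgeCost D * E(G).ncard := by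
  classical
  have hc : (hV.toFinset : Set α) = V(G) := hV.coe_toFinset
  have key := MGraph.dense_of_critical (V := hV.toFinset) (G := G.toMGraph hL) hD
    (fun hcol => h.1 ((edgeColorable_iff hE hc).2 hcol)) fun S hS => ?_
  · rwa [← ncard_edgeSet_induce hE, hc, induce_vertexSet, ← Set.ncard_coe_finset, hc] at key
  · have hSV : (S : Set α) ⊂ V(G) := by rw [← hc]; exact_mod_cast hS
    have h1 : (G.induce S).EdgeColorable D := h.2 _ (lt_of_le_of_ne (induce_le hSV.1) fun heq =>
      hSV.ne (congrArg Graph.vertexSet heq))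
    have hL' : (G.induce S).Loopless := ⟨fun e x hx => hL.not_isLoopAt e x hx.1⟩
    have hE' : E(G.induce S).Finite := hE.subset fun e ⟨x, y, h, _⟩ => h.edge_mem
    obtain ⟨M, F, hU, h2⟩ := (edgeColorable_iff (hL := hL') hE' (V := S) rfl).1 h1
    have he : ∀ T ⊆ S, ((G.induce S).toMGraph hL').e T = (G.toMGraph hL).e T := by
      intro T hT
      rw [← ncard_edgeSet_induce hE, ← ncard_edgeSet_induce hE',
        induce_induce_of_subset G (by exact_mod_cast hT)]
    refine ⟨M, F, hU, h2.disj, fun T hT => ?_, fun T hT => ?_⟩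
    · rw [← he T (hT.trans (hU ▸ Finset.subset_union_left))]
      exact h2.bdd T hT
    · rw [← he T (hT.trans (hU ▸ Finset.subset_union_right))]
      exact h2.forest T hT

end Graph

/-! ### Sharpness: tight weighted multigraphs and the gadget -/

namespace MGraph

variable {α : Type*} [DecidableEq α]

/-- The potential with linear weight costs. -/
def lin (b : ℕ) (G : MGraph α) (w : α → ℕ) (S : Finset α) : ℤ := pot b (fun j => 2 * j) G w S

/-- A weighted multigraph without colouring, all of whose proper subsets are sparse. -/
structure Tight (D b : ℕ) (G : MGraph α) (w : α → ℕ) (V : Finset α) : Prop where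
  not_colorable : ¬ G.Colorable D w V
  lin_eq : lin b G w V = -2
  lin_nonneg : ∀ S ⊂ V, 0 ≤ lin b G w S

/-- Lower the weight of `x` by one. -/
def lower (w : α → ℕ) (x : α) (v : α) : ℕ := w v - if v = x then 1 else 0

variable {D b : ℕ} {G G' : MGraph α} {w w' : α → ℕ} {V : Finset α} {x y p q : α}

theorem lower_of_ne {v : α} (h : v ≠ x) : lower w x v = w v := by simp [lower, h]

theorem sum_lower {T : Finset α} (hx : x ∈ T) (hwx : 1 ≤ w x) :
    ∑ v ∈ T, lower w x v + 1 = ∑ v ∈ T, w v := by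
  rw [← Finset.insert_erase hx, Finset.sum_insert (Finset.notMem_erase _ _),
    Finset.sum_insert (Finset.notMem_erase _ _),
    Finset.sum_congr rfl fun v hv => lower_of_ne (Finset.ne_of_mem_erase hv)]
  simp only [lower, if_true]
  omega

theorem lin_lower (T : Finset α) (hwx : 1 ≤ w x) :
    lin b G (lower w x) T = lin b G w T + if x ∈ T then 2 else 0 := by
  split_ifs with hx
  · have h1 := sum_lower hx hwx
    unfold lin pot
    simp only [Finset.sum_sub_distrib]
    push_cast
    simp only [← Finset.mul_sum]
    zify at h1
    rw [← h1]; ring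
  · rw [add_zero]
    exact pot_congr (fun a ha => lower_of_ne fun h => hx (h ▸ ha)) rfl

theorem Col.congr {M F : Finset α} (h : G.Col D w M F) (hw : ∀ v ∈ M ∪ F, w' v = w v)
    (hG : ∀ T ⊆ M ∪ F, G'.e T = G.e T) : G'.Col D w' M F := by
  refine ⟨h.disj, fun T hT hne => ?_, fun T hT hne => ?_⟩
  · rw [hG T (hT.trans Finset.subset_union_left), Finset.sum_congr rfl fun v hv =>
      hw v (Finset.subset_union_left (hT hv))]
    exact h.bdd T hT hne
  · rw [hG T (hT.trans Finset.subset_union_right)]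
    exact h.forest T hT hne

theorem Tight.congr (h : Tight D b G w V) (hw : ∀ v ∈ V, w' v = w v)
    (hG : ∀ T ⊆ V, G'.e T = G.e T) : Tight D b G' w' V := by
  refine ⟨?_, ?_, fun S hS => ?_⟩
  · rintro ⟨M, F, rfl, hc⟩
    exact h.not_colorable ⟨M, F, rfl, hc.congr (fun v hv => (hw v hv).symm)
      fun T hT => (hG T hT).symm⟩
  · rw [← h.lin_eq]
    exact pot_congr hw (hG V (Finset.Subset.refl _))
  · refine (h.lin_nonneg S hS).trans_eq (Eq.symm ?_)
    exact pot_congr (fun a ha => hw a (hS.1 ha)) (hG S hS.1)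

/-- Every colouring with the weight of `x` lowered has `x` in a full component. -/
theorem Tight.exists_full (h : Tight D b G w V) (hwx : 1 ≤ w x)
    {M F : Finset α} (hU : M ∪ F = V) (hc : G.Col D (lower w x) M F) :
    ∃ T ⊆ M, x ∈ T ∧ G.e T + 1 = T.card ∧ G.e T + ∑ v ∈ T, lower w x v = D := by
  have h1 : ¬ G.Bdd D w M := fun hb => h.not_colorable ⟨M, F, hU, hc.disj, hb, hc.forest⟩
  unfold Bdd at h1
  push Not at h1
  obtain ⟨T, hT, hne, h2⟩ := h1
  have h3 := hc.bdd T hT hne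
  obtain ⟨h4, h5⟩ := h2 h3.1
  have h6 := h3.2 h4
  by_cases hxT : x ∈ T
  · have := sum_lower hxT hwx
    exact ⟨T, hT, hxT, h4, by omega⟩
  · rw [Finset.sum_congr rfl fun v hv => lower_of_ne (by rintro rfl; exact hxT hv)] at h6
    omega

/-- A weighted multigraph in which `x` and `y` lie in full components of every colouring. -/
structure Saturated (D b : ℕ) (G : MGraph α) (w : α → ℕ) (V : Finset α) (x y : α) : Prop where
  left_mem : x ∈ V
  right_mem : y ∈ V
  nonneg : ∀ S ⊆ V, 0 ≤ lin b G w S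
  two_le : ∀ S ⊂ V, x ∈ S → y ∈ S → 2 ≤ lin b G w S
  lin_eq : lin b G w V = 0
  full : ∀ M F, M ∪ F = V → G.Col D w M F → ∀ z, z = x ∨ z = y →
    ∃ T ⊆ M, z ∈ T ∧ G.e T + 1 = T.card ∧ G.e T + ∑ v ∈ T, w v = D

theorem Saturated.congr (h : Saturated D b G w V x y) (hw : ∀ v ∈ V, w' v = w v)
    (hG : ∀ T ⊆ V, G'.e T = G.e T) : Saturated D b G' w' V x y := by
  have hlin : ∀ S ⊆ V, lin b G' w' S = lin b G w S := fun S hS =>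
    pot_congr (fun a ha => hw a (hS ha)) (hG S hS)
  refine ⟨h.left_mem, h.right_mem, fun S hS => ?_, fun S hS hx hy => ?_, ?_, ?_⟩
  · rw [hlin S hS]; exact h.nonneg S hS
  · rw [hlin S hS.1]; exact h.two_le S hS hx hy
  · rw [hlin V (Finset.Subset.refl _)]; exact h.lin_eq
  · rintro M F rfl hc z hz
    obtain ⟨T, hT, hzT, h1⟩ := h.full M F rfl (hc.congr (fun v hv => (hw v hv).symm)
      fun T hT => (hG T hT).symm) z hz
    have hT' := hT.trans (Finset.subset_union_left (s₂ := F))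
    refine ⟨T, hT, hzT, ?_⟩
    rw [hG T hT', Finset.sum_congr rfl fun v hv => hw v (hT' hv)]
    exact h1

theorem Tight.saturated (h : Tight D b G w V) (hx : x ∈ V) (hwx : 1 ≤ w x) :
    Saturated D b G (lower w x) V x x where
  left_mem := hx
  right_mem := hx
  nonneg S hS := by
    rw [lin_lower S hwx]
    rcases eq_or_ne S V with rfl | hne
    · rw [h.lin_eq, if_pos hx]; norm_num
    · have := h.lin_nonneg S (Finset.ssubset_iff_subset_ne.2 ⟨hS, hne⟩)
      split_ifs <;> omega
  two_le S hS hxS _ := by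
    rw [lin_lower S hwx, if_pos hxS]
    have := h.lin_nonneg S hS
    omega
  lin_eq := by rw [lin_lower V hwx, if_pos hx, h.lin_eq]; norm_num
  full M F hU hc z hz := by
    obtain rfl : z = x := hz.elim id id
    exact h.exists_full hwx hU hc

theorem Saturated.union {V₁ V₂ : Finset α} {x₁ x₂ : α} (h1 : Saturated D b G w V₁ x₁ x₁)
    (h2 : Saturated D b G w V₂ x₂ x₂) (hd : Disjoint V₁ V₂) (h0 : G.cross V₁ V₂ = 0) :
    Saturated D b G w (V₁ ∪ V₂) x₁ x₂ := by
  have hlin : ∀ S ⊆ V₁ ∪ V₂, lin b G w S = lin b G w (S ∩ V₁) + lin b G w (S ∩ V₂) := by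
    intro S hS
    have e1 : Disjoint (S ∩ V₁) (S ∩ V₂) :=
      hd.mono Finset.inter_subset_right Finset.inter_subset_right
    have e2 : S = (S ∩ V₁) ∪ (S ∩ V₂) := by
      rw [← Finset.inter_union_distrib_left]; exact (Finset.inter_eq_left.2 hS).symm
    have e3 := G.cross_mono (Finset.inter_subset_right : S ∩ V₁ ⊆ V₁)
      (Finset.inter_subset_right : S ∩ V₂ ⊆ V₂)
    have e4 : G.cross (S ∩ V₁) (S ∩ V₂) = 0 := by omega
    conv_lhs => rw [e2]
    unfold lin
    rw [pot_union e1, e4]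
    simp
  refine ⟨Finset.mem_union_left _ h1.left_mem, Finset.mem_union_right _ h2.left_mem, ?_, ?_, ?_,
    ?_⟩
  · intro S hS
    rw [hlin S hS]
    exact add_nonneg (h1.nonneg _ Finset.inter_subset_right) (h2.nonneg _ Finset.inter_subset_right)
  · intro S hS hx1 hx2
    rw [hlin S hS.1]
    have n1 := h1.nonneg (S ∩ V₁) Finset.inter_subset_right
    have n2 := h2.nonneg (S ∩ V₂) Finset.inter_subset_right
    by_cases c1 : S ∩ V₁ = V₁
    · by_cases c2 : S ∩ V₂ = V₂
      · exact absurd (Finset.union_subset (Finset.inter_eq_right.1 c1)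
          (Finset.inter_eq_right.1 c2)) hS.2
      · have hm := Finset.mem_inter.2 ⟨hx2, h2.left_mem⟩
        have := h2.two_le _ (Finset.ssubset_iff_subset_ne.2 ⟨Finset.inter_subset_right, c2⟩) hm hm
        omega
    · have hm := Finset.mem_inter.2 ⟨hx1, h1.left_mem⟩
      have := h1.two_le _ (Finset.ssubset_iff_subset_ne.2 ⟨Finset.inter_subset_right, c1⟩) hm hm
      omega
  · rw [hlin _ (Finset.Subset.refl _), Finset.inter_eq_right.2 Finset.subset_union_left,
      Finset.inter_eq_right.2 Finset.subset_union_right, h1.lin_eq, h2.lin_eq, add_zero]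
  · intro M F hU hc z hz
    have hr : ∀ W ⊆ V₁ ∪ V₂, (M ∩ W) ∪ (F ∩ W) = W ∧ G.Col D w (M ∩ W) (F ∩ W) := fun W hW =>
      ⟨by rw [← Finset.union_inter_distrib_right, hU, Finset.inter_eq_right.2 hW],
        hc.subset Finset.inter_subset_left Finset.inter_subset_left⟩
    rcases hz with rfl | rfl
    · obtain ⟨g1, g2⟩ := hr V₁ Finset.subset_union_left
      obtain ⟨T, hT, h⟩ := h1.full _ _ g1 g2 z (Or.inl rfl)
      exact ⟨T, hT.trans Finset.inter_subset_left, h⟩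
    · obtain ⟨g1, g2⟩ := hr V₂ Finset.subset_union_right
      obtain ⟨T, hT, h⟩ := h2.full _ _ g1 g2 z (Or.inl rfl)
      exact ⟨T, hT.trans Finset.inter_subset_left, h⟩

/-- Join `p` and `q` by a double edge, `p` to `x` and `q` to `y`. -/
def attach (G : MGraph α) (x y p q : α) (hpq : p ≠ q) (hpx : p ≠ x) (hqy : q ≠ y) : MGraph α :=
  (((G.addEdge p q hpq).addEdge p q hpq).addEdge p x hpx).addEdge q y hqy

/-- In a colouring, neither `p` nor `q` can lie in `M`, since it would enlarge a full component at
`x` or `y`; both in `F`, they form a cycle of length two. Two vertices and four edges change the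
potential by `2(2b - 1) - 4b = -2`. -/
theorem Saturated.attach_tight (h : Saturated D b G w V x y) (hG : ∀ a ∉ V, ∀ c, G.m a c = 0)
    (hpV : p ∉ V) (hqV : q ∉ V) (hpq : p ≠ q) (hpx : p ≠ x) (hqy : q ≠ y) (hwp : w p = 0)
    (hwq : w q = 0) (hb : 2 ≤ b) :
    Tight D b (G.attach x y p q hpq hpx hqy) w (insert p (insert q V)) := by
  set G' := G.attach x y p q hpq hpx hqy with hG'
  have hpy : p ≠ y := fun hh => hpV (hh ▸ h.right_mem)
  have hqx : q ≠ x := fun hh => hqV (hh ▸ h.left_mem)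
  have hdeg0 : ∀ a ∉ V, ∀ S, G.deg a S = 0 := fun a ha S => Finset.sum_eq_zero fun c _ => hG a ha c
  have he : ∀ S ⊆ V, G'.e S = G.e S := by
    intro S hS
    have e1 : p ∉ S := fun hh => hpV (hS hh)
    have e2 : q ∉ S := fun hh => hqV (hS hh)
    simp [hG', attach, e_addEdge, e1, e2]
  have hdp : ∀ S ⊆ V, G'.deg p S = if x ∈ S then 1 else 0 := by
    intro S hS
    have e1 : p ∉ S := fun hh => hpV (hS hh)
    have e2 : q ∉ S := fun hh => hqV (hS hh)
    simp [hG', attach, deg_addEdge, e1, e2, hpq, hpx, hpy, hdeg0 p hpV]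
  have hdq : ∀ S ⊆ V, G'.deg q S = if y ∈ S then 1 else 0 := by
    intro S hS
    have e1 : p ∉ S := fun hh => hpV (hS hh)
    have e2 : q ∉ S := fun hh => hqV (hS hh)
    simp [hG', attach, deg_addEdge, e1, e2, hpq.symm, hqx, hqy, hdeg0 q hqV]
  have hmpq : G'.m p q = 2 := by
    have := hG p hpV q
    simp [hG', attach, addEdge, hpq, hpx, hpy, hqx, hqy, this]
  have hlin : ∀ S ⊆ V, lin b G' w S = lin b G w S := fun S hS => pot_congr (fun _ _ => rfl) (he S hS)
  have hlp : ∀ S ⊆ V, lin b G' w (insert p S) =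
      lin b G w S + (2 * b - 1) - b * (if x ∈ S then 1 else 0) := by
    intro S hS
    rw [← hlin S hS]
    unfold lin
    rw [pot_insert fun hh => hpV (hS hh), hdp S hS, hwp]
    split_ifs <;> simp
  have hlq : ∀ S ⊆ V, lin b G' w (insert q S) =
      lin b G w S + (2 * b - 1) - b * (if y ∈ S then 1 else 0) := by
    intro S hS
    rw [← hlin S hS]
    unfold lin
    rw [pot_insert fun hh => hqV (hS hh), hdq S hS, hwq]
    split_ifs <;> simp
  have hlpq : ∀ S ⊆ V, lin b G' w (insert p (insert q S)) =
      lin b G w S + 2 * b - 2 - b * (if x ∈ S then 1 else 0) - b * (if y ∈ S then 1 else 0) := by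
    intro S hS
    have e2 : q ∉ S := fun hh => hqV (hS hh)
    have e3 : p ∉ insert q S := by
      rw [Finset.mem_insert, not_or]; exact ⟨hpq, fun hh => hpV (hS hh)⟩
    have e1 := hlq S hS
    unfold lin at e1 ⊢
    rw [pot_insert e3, e1, deg_insert _ _ e2, hdp S hS, hwp, hmpq]
    split_ifs <;> push_cast <;> ring
  refine ⟨?_, ?_, ?_⟩
  · rintro ⟨M, F, hU, hc⟩
    have hVU : V ⊆ M ∪ F := by
      rw [hU]; exact (Finset.subset_insert _ _).trans (Finset.subset_insert _ _)
    have hU' : M ∩ V ∪ F ∩ V = V := by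
      rw [← Finset.union_inter_distrib_right, Finset.inter_eq_right.2 hVU]
    have hc' : G.Col D w (M ∩ V) (F ∩ V) := by
      refine (hc.subset Finset.inter_subset_left Finset.inter_subset_left).congr
        (fun _ _ => rfl) fun T hT => (he T ?_).symm
      rwa [hU'] at hT
    have key : ∀ a z, z = x ∨ z = y → a ∉ V → 1 ≤ G'.m a z → w a = 0 → a ∉ M := by
      intro a z hz ha hm hwa haM
      obtain ⟨T, hT, hzT, h1, h2⟩ := h.full _ _ hU' hc' z hz
      have hTV : T ⊆ V := hT.trans Finset.inter_subset_right
      have haT : a ∉ T := fun hh => ha (hTV hh)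
      have h3 := hc.bdd (insert a T)
        (Finset.insert_subset haM (hT.trans Finset.inter_subset_left)) (by simp)
      have h4 := G'.m_le_deg a hzT
      rw [e_insert _ haT, he T hTV, Finset.card_insert_of_notMem haT, Finset.sum_insert haT,
        hwa] at h3
      have h5 := h3.2 (by omega)
      omega
    have hpF : p ∈ F := by
      have : p ∈ M ∪ F := by rw [hU]; simp
      refine (Finset.mem_union.1 this).resolve_left (key p x (Or.inl rfl) hpV ?_ hwp)
      have := hdp {x} (by simpa using h.left_mem)
      rw [deg_singleton] at this
      simp [this]
    have hqF : q ∈ F := by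
      have : q ∈ M ∪ F := by rw [hU]; simp
      refine (Finset.mem_union.1 this).resolve_left (key q y (Or.inr rfl) hqV ?_ hwq)
      have := hdq {y} (by simpa using h.right_mem)
      rw [deg_singleton] at this
      simp [this]
    have h6 := hc.forest {p, q} (by
      intro a ha
      rw [Finset.mem_insert, Finset.mem_singleton] at ha
      rcases ha with rfl | rfl
      · exact hpF
      · exact hqF) (by simp)
    rw [e_insert _ (by simpa using hpq), e_singleton, deg_singleton, hmpq,
      Finset.card_pair hpq] at h6
    omega
  · rw [hlpq V (Finset.Subset.refl _), if_pos h.left_mem, if_pos h.right_mem, h.lin_eq]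
    ring
  -- A proper subset loses that full `-2` only if it contains `p, q, x, y`; then its part in `V` is
  -- proper and has potential at least 2 by `two_le`.
  · intro S hS
    have hb' : (2 : ℤ) ≤ b := by exact_mod_cast hb
    have hS0 : (S.erase p).erase q ⊆ V := by
      intro a ha
      rw [Finset.mem_erase, Finset.mem_erase] at ha
      have := hS.1 ha.2.2
      simpa [ha.1, ha.2.1] using this
    set S0 := (S.erase p).erase q with hS0def
    have n0 := h.nonneg S0 hS0
    by_cases hp : p ∈ S <;> by_cases hq : q ∈ S
    · have hSeq : S = insert p (insert q S0) := by
        rw [hS0def, Finset.insert_erase (by simp [hpq.symm, hq]), Finset.insert_erase hp]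
      have hne : S0 ≠ V := by
        intro hh
        rw [hh] at hSeq
        exact hS.ne hSeq
      rw [hSeq, hlpq S0 hS0]
      by_cases hx : x ∈ S0 <;> by_cases hy : y ∈ S0
      · have := h.two_le S0 (Finset.ssubset_iff_subset_ne.2 ⟨hS0, hne⟩) hx hy
        rw [if_pos hx, if_pos hy]; linarith
      all_goals simp only [hx, hy, if_true, if_false]; linarith
    · have hSeq : S = insert p S0 := by
        rw [hS0def, Finset.erase_eq_of_notMem (by simp [hq]), Finset.insert_erase hp]
      rw [hSeq, hlp S0 hS0]
      split_ifs <;> linarith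
    · have hSeq : S = insert q S0 := by
        rw [hS0def, Finset.erase_eq_of_notMem hp, Finset.insert_erase hq]
      rw [hSeq, hlq S0 hS0]
      split_ifs <;> linarith
    · have hSeq : S = S0 := by
        rw [hS0def, Finset.erase_eq_of_notMem (by simp [hq]), Finset.erase_eq_of_notMem hp]
      rw [hSeq, hlin S0 hS0]
      exact n0

/-- The disjoint union of the restrictions of `G₁` to `V₁` and of `G₂` to `V₂`. -/
def glue (G₁ G₂ : MGraph α) (V₁ V₂ : Finset α) : MGraph α where
  m a c := if a ∈ V₁ ∧ c ∈ V₁ then G₁.m a c else if a ∈ V₂ ∧ c ∈ V₂ then G₂.m a c else 0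
  symm a c := by rw [G₁.symm a c, G₂.symm a c]; simp only [and_comm]
  irrefl a := by rw [G₁.irrefl, G₂.irrefl]; simp

theorem glue_e_left (G₁ G₂ : MGraph α) {V₁ V₂ T : Finset α} (hT : T ⊆ V₁) :
    (glue G₁ G₂ V₁ V₂).e T = G₁.e T :=
  e_congr fun _ ha _ hc => if_pos ⟨hT ha, hT hc⟩

theorem glue_e_right (G₁ G₂ : MGraph α) {V₁ V₂ T : Finset α} (hd : Disjoint V₁ V₂)
    (hT : T ⊆ V₂) : (glue G₁ G₂ V₁ V₂).e T = G₂.e T :=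
  e_congr fun a ha c hc => by
    have := Finset.disjoint_right.1 hd (hT ha)
    simp [glue, this, hT ha, hT hc]

theorem glue_cross (G₁ G₂ : MGraph α) {V₁ V₂ : Finset α} (hd : Disjoint V₁ V₂) :
    (glue G₁ G₂ V₁ V₂).cross V₁ V₂ = 0 :=
  Finset.sum_eq_zero fun a ha => Finset.sum_eq_zero fun c hc => by
    have h1 := Finset.disjoint_right.1 hd hc
    have h2 := Finset.disjoint_left.1 hd ha
    simp [glue, h1, h2]

theorem glue_m_eq_zero (G₁ G₂ : MGraph α) {V₁ V₂ : Finset α} {a : α} (h : a ∉ V₁ ∪ V₂) (c : α) :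
    (glue G₁ G₂ V₁ V₂).m a c = 0 := by
  rw [Finset.mem_union, not_or] at h
  simp [glue, h.1, h.2]

/-- Some weighted multigraph with `n` vertices in `ℕ` and total weight `s` is tight. -/
def ExistsTight (D b n s : ℕ) : Prop :=
  ∃ (G : MGraph ℕ) (w : ℕ → ℕ) (V : Finset ℕ), Tight D b G w V ∧ V.card = n ∧ ∑ v ∈ V, w v = s

theorem exists_fresh (V : Finset ℕ) (n : ℕ) : ∃ W : Finset ℕ, W.card = n ∧ Disjoint V W := by
  obtain ⟨N, hN⟩ := V.exists_nat_subset_range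
  refine ⟨(Finset.range n).map (addRightEmbedding N), by simp, ?_⟩
  rw [Finset.disjoint_left]
  intro a ha haW
  have := Finset.mem_range.1 (hN ha)
  simp only [Finset.mem_map, Finset.mem_range, addRightEmbedding_apply] at haW
  obtain ⟨c, -, rfl⟩ := haW
  omega

/-- Lowering the weight at `x` raises the potential from `-2` to 0 and saturates `x`. The gadget,
with both new vertices attached to `x`, restores `-2`. -/
theorem ExistsTight.lower_weight {n s : ℕ} (hb : 2 ≤ b) (h : ExistsTight D b n (s + 1)) :
    ExistsTight D b (n + 2) s := by
  obtain ⟨G, w, V, ht, hn, hs⟩ := h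
  obtain ⟨x, hx, hwx⟩ : ∃ x ∈ V, 1 ≤ w x := by
    by_contra hcon
    push Not at hcon
    have : ∑ v ∈ V, w v = 0 := Finset.sum_eq_zero fun v hv => by have := hcon v hv; omega
    omega
  obtain ⟨W, hW, hd⟩ := exists_fresh V 2
  obtain ⟨p, q, hpq, rfl⟩ := Finset.card_eq_two.1 hW
  have hpV : p ∉ V := Finset.disjoint_right.1 hd (by simp)
  have hqV : q ∉ V := Finset.disjoint_right.1 hd (by simp)
  set w₁ : ℕ → ℕ := fun a => if a ∈ V then w a else 0
  have hw1 : ∀ a ∈ V, w₁ a = w a := fun a ha => if_pos ha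
  have hwx' : 1 ≤ w₁ x := by rw [hw1 x hx]; exact hwx
  -- Gluing with the empty set erases every edge not inside `V`, so that `p` and `q` start isolated.
  have ht' : Tight D b (glue G G V ∅) w₁ V := ht.congr hw1 fun T hT => glue_e_left G G hT
  have hpx : p ≠ x := fun hh => hpV (hh ▸ hx)
  have hqx : q ≠ x := fun hh => hqV (hh ▸ hx)
  have hlp : lower w₁ x p = 0 := by rw [lower_of_ne hpx]; exact if_neg hpV
  have hlq : lower w₁ x q = 0 := by rw [lower_of_ne hqx]; exact if_neg hqV
  refine ⟨_, _, _, (ht'.saturated hx hwx').attach_tight (fun a ha c => ?_) hpV hqV hpq hpx hqx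
    hlp hlq hb, ?_, ?_⟩
  · exact glue_m_eq_zero G G (by simpa using ha) c
  · rw [Finset.card_insert_of_notMem (by simp [hpq, hpV]), Finset.card_insert_of_notMem hqV, hn]
  · rw [Finset.sum_insert (by simp [hpq, hpV]), Finset.sum_insert hqV, hlp, hlq]
    have := sum_lower hx hwx'
    rw [Finset.sum_congr rfl hw1, hs] at this
    omega

/-- One gadget joins two tight multigraphs, consuming a unit of weight in each. The second must be
available on every vertex set of size `n₂`, so that a disjoint copy can be chosen. -/
theorem ExistsTight.grow {n s n₂ s₂ : ℕ} (hb : 2 ≤ b) (h : ExistsTight D b n (s + 1))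
    {G₂ : MGraph ℕ} {w₂ : ℕ → ℕ}
    (h2 : ∀ V : Finset ℕ, V.card = n₂ → Tight D b G₂ w₂ V ∧ ∑ v ∈ V, w₂ v = s₂ + 1) :
    ExistsTight D b (n + n₂ + 2) (s + s₂) := by
  obtain ⟨G, w, V, ht, hn, hs⟩ := h
  have pick : ∀ {w : ℕ → ℕ} {V : Finset ℕ} {s : ℕ}, ∑ v ∈ V, w v = s + 1 →
      ∃ x ∈ V, 1 ≤ w x := by
    intro w V s hs
    by_contra hcon
    push Not at hcon
    have : ∑ v ∈ V, w v = 0 := Finset.sum_eq_zero fun v hv => by have := hcon v hv; omega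
    omega
  obtain ⟨x, hx, hwx⟩ := pick hs
  obtain ⟨V₂, hn2, hd⟩ := exists_fresh V n₂
  obtain ⟨ht2, hs2⟩ := h2 V₂ hn2
  obtain ⟨y, hy, hwy⟩ := pick hs2
  obtain ⟨W, hW, hdW⟩ := exists_fresh (V ∪ V₂) 2
  obtain ⟨p, q, hpq, rfl⟩ := Finset.card_eq_two.1 hW
  have hpV : p ∉ V ∪ V₂ := Finset.disjoint_right.1 hdW (by simp)
  have hqV : q ∉ V ∪ V₂ := Finset.disjoint_right.1 hdW (by simp)
  have hd1 : ∀ {a}, a ∈ V → a ∉ V₂ := fun ha => Finset.disjoint_left.1 hd ha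
  have hd2 : ∀ {a}, a ∈ V₂ → a ∉ V := fun ha => Finset.disjoint_right.1 hd ha
  set w' : ℕ → ℕ := fun a => if a ∈ V then lower w x a else if a ∈ V₂ then lower w₂ y a else 0
  have hw1 : ∀ a ∈ V, w' a = lower w x a := fun a ha => if_pos ha
  have hw2 : ∀ a ∈ V₂, w' a = lower w₂ y a := fun a ha => by
    simp only [w', if_neg (hd2 ha), if_pos ha]
  have hw0 : ∀ a ∉ V ∪ V₂, w' a = 0 := fun a ha => by
    rw [Finset.mem_union, not_or] at ha
    simp only [w', if_neg ha.1, if_neg ha.2]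
  have S1 : Saturated D b (glue G G₂ V V₂) w' V x x :=
    (ht.saturated hx hwx).congr hw1 fun T hT => glue_e_left G G₂ hT
  have S2 : Saturated D b (glue G G₂ V V₂) w' V₂ y y :=
    (ht2.saturated hy hwy).congr hw2 fun T hT => glue_e_right G G₂ hd hT
  have S3 := S1.union S2 hd (glue_cross G G₂ hd)
  have hpx : p ≠ x := fun hh => hpV (hh ▸ Finset.mem_union_left _ hx)
  have hqy : q ≠ y := fun hh => hqV (hh ▸ Finset.mem_union_right _ hy)
  refine ⟨_, _, _, S3.attach_tight (fun a ha c => glue_m_eq_zero G G₂ ha c) hpV hqV hpq hpx hqy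
    (hw0 p hpV) (hw0 q hqV) hb, ?_, ?_⟩
  · rw [Finset.card_insert_of_notMem (by rw [Finset.mem_insert, not_or]; exact ⟨hpq, hpV⟩),
      Finset.card_insert_of_notMem hqV, Finset.card_union_of_disjoint hd, hn, hn2]
  · rw [Finset.sum_insert (by rw [Finset.mem_insert, not_or]; exact ⟨hpq, hpV⟩),
      Finset.sum_insert hqV, hw0 p hpV, hw0 q hqV, Finset.sum_union hd,
      Finset.sum_congr rfl hw1, Finset.sum_congr rfl hw2]
    change 0 + (0 + (∑ v ∈ V, lower w x v + ∑ v ∈ V₂, lower w₂ y v)) = _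
    have := sum_lower hx hwx
    have := sum_lower hy hwy
    omega

end MGraph

/-! ### Sharpness: starting examples and arbitrarily large order -/

namespace MGraph

/-- The complete multigraph in which any two vertices are joined by `c` edges. -/
def complete (α : Type*) [DecidableEq α] (c : ℕ) : MGraph α where
  m x y := if x = y then 0 else c
  symm x y := by simp only [eq_comm]
  irrefl x := if_pos rfl

theorem two_mul_complete_e {α : Type*} [DecidableEq α] (c : ℕ) (T : Finset α) :
    2 * (complete α c).e T = c * (T.card * (T.card - 1)) := by
  have hd : ∀ v ∈ T, (complete α c).deg v T = c * (T.card - 1) := by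
    intro v hv
    rw [← deg_erase_self, ← Finset.card_erase_of_mem hv, mul_comm, ← smul_eq_mul,
      ← Finset.sum_const]
    exact Finset.sum_congr rfl fun a ha => if_neg (Finset.ne_of_mem_erase ha).symm
  rw [two_mul_e, Finset.sum_congr rfl hd, Finset.sum_const, smul_eq_mul]
  ring

theorem lin_complete {α : Type*} [DecidableEq α] (b c j : ℕ) (T : Finset α) :
    2 * lin b (complete α c) (fun _ => j) T =
      2 * T.card * (2 * b - 1 - 2 * j) - b * ((c * (T.card * (T.card - 1)) : ℕ) : ℤ) := by
  rw [← two_mul_complete_e]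
  unfold lin pot
  rw [Finset.sum_const, nsmul_eq_mul]
  push_cast
  ring

/-- Weight `D + 1` forces both vertices into `F`, where their double edge is a cycle. -/
theorem tight_complete_odd (k : ℕ) {V : Finset ℕ} (hV : V.card = 2) :
    Tight (2 * k + 1) (4 * k + 4) (complete ℕ 2) (fun _ => 2 * k + 2) V := by
  refine ⟨?_, ?_, fun S hS => ?_⟩
  · rintro ⟨M, F, hU, hc⟩
    have hM : M = ∅ := by
      rw [Finset.eq_empty_iff_forall_notMem]
      intro a ha
      have := hc.bdd.weight_le ha
      omega
    rw [hM, Finset.empty_union] at hU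
    subst hU
    have h1 := hc.forest F (Finset.Subset.refl _) (Finset.card_pos.1 (by omega))
    have h2 := two_mul_complete_e 2 F
    rw [hV] at h1 h2
    omega
  · have := lin_complete (4 * k + 4) 2 (2 * k + 2) V
    rw [hV] at this
    push_cast at this
    linarith
  · have h1 := Finset.card_lt_card hS
    have h2 := lin_complete (4 * k + 4) 2 (2 * k + 2) S
    obtain h | h : S.card = 0 ∨ S.card = 1 := by omega
    all_goals
      rw [h] at h2
      push_cast at h2
      linarith

/-- Forests in the complete graph on four vertices have at most two vertices, so `M` is an edge;
with its weights it totals `2t + 1 > D`. -/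
theorem tight_complete_even {t : ℕ} (ht : 1 ≤ t) {V : Finset ℕ} (hV : V.card = 4) :
    Tight (2 * t) (4 * t + 1) (complete ℕ 1) (fun _ => t) V := by
  refine ⟨?_, ?_, fun S hS => ?_⟩
  · rintro ⟨M, F, hU, hc⟩
    have hle : ∀ T : Finset ℕ, (complete ℕ 1).Forest T → T.card ≤ 2 := by
      intro T hT
      by_contra hlt
      obtain ⟨T', hT', hcard⟩ := Finset.exists_subset_card_eq (show 3 ≤ T.card by omega)
      have h1 := hT T' hT' (Finset.card_pos.1 (by omega))
      have h2 := two_mul_complete_e 1 T'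
      rw [hcard] at h1 h2
      omega
    have h1 := hle M hc.bdd.forest
    have h2 := hle F hc.forest
    have h3 := Finset.card_union_of_disjoint hc.disj
    rw [hU, hV] at h3
    have h4 : M.card = 2 := by omega
    have h5 := two_mul_complete_e 1 M
    have h6 := (hc.bdd M (Finset.Subset.refl _) (Finset.card_pos.1 (by omega))).2
    rw [Finset.sum_const, smul_eq_mul, h4] at h6
    rw [h4] at h5
    omega
  · have := lin_complete (4 * t + 1) 1 t V
    rw [hV] at this
    push_cast at this
    linarith
  · have h1 := Finset.card_lt_card hS
    have h2 := lin_complete (4 * t + 1) 1 t S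
    have ht' : (1 : ℤ) ≤ t := by exact_mod_cast ht
    obtain h | h | h | h : S.card = 0 ∨ S.card = 1 ∨ S.card = 2 ∨ S.card = 3 := by omega
    all_goals
      rw [h] at h2
      push_cast at h2
      linarith

theorem ExistsTight.weight_zero {D b s : ℕ} (hb : 2 ≤ b) {n : ℕ} (h : ExistsTight D b n s) :
    ∃ n' ≥ n, ExistsTight D b n' 0 := by
  induction s generalizing n with
  | zero => exact ⟨n, le_rfl, h⟩
  | succ s ih =>
    obtain ⟨n', hn, h'⟩ := ih (h.lower_weight hb)
    exact ⟨n', by omega, h'⟩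

/-- Joining copies first makes the order large; `1 ≤ s₂` keeps the total weight positive throughout.
The remaining weight is then removed unit by unit. -/
theorem exists_tight_ge {D b n₂ s₂ : ℕ} (hb : 2 ≤ b) {G₂ : MGraph ℕ} {w₂ : ℕ → ℕ} (hs : 1 ≤ s₂)
    (h2 : ∀ V : Finset ℕ, V.card = n₂ → Tight D b G₂ w₂ V ∧ ∑ v ∈ V, w₂ v = s₂ + 1) (N : ℕ) :
    ∃ n ≥ N, ExistsTight D b n 0 := by
  have grow : ∃ n ≥ N, ∃ s, ExistsTight D b n (s + 1) := by
    induction N with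
    | zero =>
      have := h2 (Finset.range n₂) (by simp)
      exact ⟨n₂, Nat.zero_le _, s₂, _, _, _, this.1, by simp, this.2⟩
    | succ N ih =>
      obtain ⟨n, hn, s, h⟩ := ih
      refine ⟨n + n₂ + 2, by omega, s + s₂ - 1, ?_⟩
      rw [show s + s₂ - 1 + 1 = s + s₂ by omega]
      exact h.grow hb h2
  obtain ⟨n, hn, s, h⟩ := grow
  obtain ⟨n', hn', h'⟩ := h.weight_zero hb
  exact ⟨n', by omega, h'⟩

theorem exists_tight {D : ℕ} (hD : 1 ≤ D) (N : ℕ) : ∃ n ≥ N, ExistsTight D (edgeCost D) n 0 := by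
  rcases Nat.even_or_odd' D with ⟨t, rfl | rfl⟩
  · have hb : edgeCost (2 * t) = 4 * t + 1 := by
      unfold edgeCost; rw [if_pos (even_two_mul t)]; ring
    rw [hb]
    refine exists_tight_ge (n₂ := 4) (s₂ := 4 * t - 1) (by omega) (by omega)
      (fun V hV => ⟨tight_complete_even (by omega) hV, ?_⟩) N
    rw [Finset.sum_const, hV, smul_eq_mul]
    omega
  · have hb : edgeCost (2 * t + 1) = 4 * t + 4 := by
      unfold edgeCost; rw [if_neg (by simp)]; ring
    rw [hb]
    refine exists_tight_ge (n₂ := 2) (s₂ := 4 * t + 3) (by omega) (by omega)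
      (fun V hV => ⟨tight_complete_odd t hV, ?_⟩) N
    rw [Finset.sum_const, hV, smul_eq_mul]
    omega

/-! ### Sharpness: realization and criticality -/

/-- Realize multiplicities as a multigraph with vertex set `V`. -/
def toGraph (G : MGraph ℕ) (V : Finset ℕ) : Graph ℕ ℕ where
  vertexSet := V
  IsLink e x y := x ∈ V ∧ y ∈ V ∧
    -- The label encodes the unordered pair of ends and a number `i` distinguishing parallel edges.
    ∃ i < G.m x y, e = Nat.pair (min x y) (Nat.pair (max x y) i)
  isLink_symm e _ := ⟨fun x y ⟨hx, hy, i, hi, he⟩ =>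
    ⟨hy, hx, i, by rwa [G.symm], by rwa [min_comm, max_comm]⟩⟩
  eq_or_eq_of_isLink_of_isLink := by
    rintro e x y v z ⟨-, -, i, -, rfl⟩ ⟨-, -, j, -, h⟩
    rw [Nat.pair_eq_pair, Nat.pair_eq_pair] at h
    omega
  left_mem_of_isLink e x y h := h.1

variable (G : MGraph ℕ) (V : Finset ℕ)

theorem toGraph_loopless : (G.toGraph V).Loopless :=
  ⟨fun e x ⟨_, _, i, hi, _⟩ => by rw [G.irrefl] at hi; omega⟩

theorem toGraph_edgeSet_finite : E(G.toGraph V).Finite := by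
  refine (Finset.finite_toSet ((V ×ˢ V).biUnion fun p => (Finset.range (G.m p.1 p.2)).image
    fun i => Nat.pair (min p.1 p.2) (Nat.pair (max p.1 p.2) i))).subset ?_
  rintro e ⟨x, y, hx, hy, i, hi, rfl⟩
  simp only [Finset.coe_biUnion, Set.mem_iUnion]
  refine ⟨(x, y), by simp [hx, hy], ?_⟩
  simp only [Finset.coe_image, Set.mem_image]
  exact ⟨i, by simpa using hi, rfl⟩

theorem toGraph_e {T : Finset ℕ} (hT : T ⊆ V) :
    ((G.toGraph V).toMGraph (G.toGraph_loopless V)).e T = G.e T := by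
  refine e_congr fun a ha c hc => ?_
  change Set.ncard {e | (G.toGraph V).IsLink e a c} = _
  have : {e | (G.toGraph V).IsLink e a c} =
      ((Finset.range (G.m a c)).image fun i => Nat.pair (min a c) (Nat.pair (max a c) i) :
        Finset ℕ) := by
    ext e
    simp only [Set.mem_ofPred_eq, toGraph, Finset.coe_image, Set.mem_image, Finset.coe_range,
      Set.mem_Iio, hT ha, hT hc, true_and]
    exact ⟨fun ⟨i, hi, h⟩ => ⟨i, hi, h.symm⟩, fun ⟨i, hi, h⟩ => ⟨i, hi, h.symm⟩⟩
  rw [this, Set.ncard_coe_finset, Finset.card_image_of_injective, Finset.card_range]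
  intro i j h
  simp only [Nat.pair_eq_pair, true_and] at h
  exact h

variable {G V}

/-- By `exists_dense`, a proper subgraph without colouring has a set `S` of potential at most `-2`.
In the whole graph, proper subsets have nonnegative potential, so `S = V`; but then an edge is
missing and the potential is at least `-2 + b`. -/
theorem Tight.edgeCritical {D : ℕ} (hD : 1 ≤ D) (h : Tight D (edgeCost D) G 0 V) :
    (G.toGraph V).EdgeCritical D := by
  have hL := G.toGraph_loopless V
  have hE := G.toGraph_edgeSet_finite V
  have hlin : ∀ S, lin (edgeCost D) G 0 S =
      S.card * (2 * edgeCost D - 1) - edgeCost D * G.e S := by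
    intro S
    unfold lin pot
    simp
    ring
  have hb : 1 ≤ edgeCost D := by unfold edgeCost; split_ifs <;> omega
  obtain ⟨c, hc⟩ : ∃ c, edgeCost D = c + 1 := ⟨edgeCost D - 1, by omega⟩
  constructor
  · rw [Graph.edgeColorable_iff (hL := hL) hE (V := V) rfl]
    rintro ⟨M, F, hU, hcol⟩
    exact h.not_colorable ⟨M, F, hU, hcol.congr (fun _ _ => rfl) fun T hT =>
      (G.toGraph_e V (hU ▸ hT)).symm⟩
  · intro H hH
    have hHL : H.Loopless := Graph.Loopless.anti (hG := hL) hH.le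
    have hHE : E(H).Finite := hE.subset (Graph.IsSubgraph.edgeSet_mono hH.le)
    have hVH : V(H) ⊆ (V : Set ℕ) := hH.le.vertexSet_mono
    have hHV : V(H).Finite := V.finite_toSet.subset hVH
    have hcoe : (hHV.toFinset : Set ℕ) = V(H) := hHV.coe_toFinset
    by_contra hnc
    rw [Graph.edgeColorable_iff (hL := hHL) hHE hcoe] at hnc
    obtain ⟨S, hS, hne, hdense⟩ := exists_dense hD hnc
    have hSV : S ⊆ V := by
      have : (S : Set ℕ) ⊆ V := (Finset.coe_subset.2 hS).trans (hcoe.subset.trans hVH)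
      exact_mod_cast this
    have hle : E(H.induce S) ⊆ E((G.toGraph V).induce S) := by
      rintro e ⟨x, y, hl, hx, hy⟩
      exact ⟨x, y, hl.mono hH.le, hx, hy⟩
    have hfin : E((G.toGraph V).induce S).Finite := hE.subset fun e ⟨x, y, hl, _⟩ => hl.edge_mem
    rw [← Graph.ncard_edgeSet_induce hHE] at hdense
    have he := G.toGraph_e V hSV
    rw [← Graph.ncard_edgeSet_induce hE] at he
    have h1 := Set.ncard_le_ncard hle hfin
    rw [hc] at hdense
    rw [show 2 * (c + 1) - 1 = 2 * c + 1 by omega] at hdense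
    have h2 := hlin S
    rw [hc] at h2
    rw [← he] at h2
    rcases eq_or_ne S V with rfl | hneS
    · have hlt : E(H) ⊂ E(G.toGraph S) := by
        refine (Graph.vertexSet_ssubset_or_edgeSet_ssubset_of_lt hH).resolve_left fun hss => ?_
        refine hss.2 ?_
        have : (S : Set ℕ) ⊆ V(H) := by rw [← hcoe]; exact_mod_cast hS
        exact this
      have hHS : V(H) = S := Set.Subset.antisymm hVH (by rw [← hcoe]; exact_mod_cast hS)
      have h3 := Set.ncard_lt_ncard hlt hE
      have h4 : H.induce S = H := by rw [← hHS, Graph.induce_vertexSet]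
      have h5 : (G.toGraph S).induce S = G.toGraph S := Graph.induce_vertexSet (G.toGraph S)
      rw [h4] at hdense
      rw [h5, ← hc, h.lin_eq] at h2
      rw [hc] at h2
      have h6 : (c + 1) * (E(H).ncard + 1) ≤ (c + 1) * E(G.toGraph S).ncard :=
        Nat.mul_le_mul_left _ h3
      zify at hdense h6
      push_cast at h2
      linarith
    · have h3 := h.lin_nonneg S (Finset.ssubset_iff_subset_ne.2 ⟨hSV, hneS⟩)
      rw [hc, h2] at h3
      have h6 : (c + 1) * E(H.induce S).ncard ≤ (c + 1) * E((G.toGraph V).induce S).ncard :=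
        Nat.mul_le_mul_left _ h1
      zify at hdense h6
      push_cast at h3
      linarith

theorem exists_edgeCritical {D : ℕ} (hD : 1 ≤ D) (N : ℕ) : ∃ G : Graph ℕ ℕ, V(G).Finite ∧
    E(G).Finite ∧ G.Loopless ∧ G.EdgeCritical D ∧ N ≤ V(G).ncard ∧
      edgeCost D * E(G).ncard = (2 * edgeCost D - 1) * V(G).ncard + 2 := by
  obtain ⟨n, hn, G, w, V, ht, hV, hw⟩ := exists_tight hD N
  have ht : Tight D (edgeCost D) G 0 V := ht.congr
    (fun v hv => (Finset.sum_eq_zero_iff.1 hw v hv).symm) fun _ _ => rfl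
  have hcard : V(G.toGraph V).ncard = V.card := Set.ncard_coe_finset V
  refine ⟨G.toGraph V, V.finite_toSet, G.toGraph_edgeSet_finite V, G.toGraph_loopless V,
    ht.edgeCritical hD, by omega, ?_⟩
  have h1 := G.toGraph_e V (Finset.Subset.refl V)
  have h2 : (G.toGraph V).induce V = G.toGraph V := Graph.induce_vertexSet (G.toGraph V)
  rw [← Graph.ncard_edgeSet_induce (G.toGraph_edgeSet_finite V), h2] at h1
  rw [hcard, h1]
  have h3 := ht.lin_eq
  unfold lin pot at h3
  have hb : 1 ≤ edgeCost D := by unfold edgeCost; split_ifs <;> omega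
  obtain ⟨c, hc⟩ : ∃ c, edgeCost D = c + 1 := ⟨edgeCost D - 1, by omega⟩
  rw [hc] at h3 ⊢
  rw [show 2 * (c + 1) - 1 = 2 * c + 1 by omega]
  simp only [Pi.zero_apply, mul_zero, Finset.sum_const, nsmul_eq_mul] at h3
  zify
  push_cast at h3
  linarith

end MGraph

/-! ### The two bounds and their sharpness -/

theorem mainTheorem3 (D : ℕ) :
    (Odd D →
      (∀ (α β : Type*) (G : Graph α β), V(G).Finite → E(G).Finite → G.Loopless →
        Graph.EdgeCritical D G → 3 ≤ V(G).ncard →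
        ((4 * (D : ℝ) + 3) * (V(G).ncard : ℝ) + 2) / (2 * ((D : ℝ) + 1)) ≤ (E(G).ncard : ℝ)) ∧
      (∀ N : ℕ, ∃ G : Graph ℕ ℕ, V(G).Finite ∧ E(G).Finite ∧ G.Loopless ∧
        Graph.EdgeCritical D G ∧ 3 ≤ V(G).ncard ∧ N ≤ V(G).ncard ∧
        (E(G).ncard : ℝ) = ((4 * (D : ℝ) + 3) * (V(G).ncard : ℝ) + 2) / (2 * ((D : ℝ) + 1)))) ∧
    (Even D → 2 ≤ D →
      (∀ (α β : Type*) (G : Graph α β), V(G).Finite → E(G).Finite → G.Loopless →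
        Graph.EdgeCritical D G → 3 ≤ V(G).ncard →
        ((4 * (D : ℝ) + 1) * (V(G).ncard : ℝ) + 2) / (2 * (D : ℝ) + 1) ≤ (E(G).ncard : ℝ)) ∧
      (∀ N : ℕ, ∃ G : Graph ℕ ℕ, V(G).Finite ∧ E(G).Finite ∧ G.Loopless ∧
        Graph.EdgeCritical D G ∧ 3 ≤ V(G).ncard ∧ N ≤ V(G).ncard ∧
        (E(G).ncard : ℝ) = ((4 * (D : ℝ) + 1) * (V(G).ncard : ℝ) + 2) / (2 * (D : ℝ) + 1))) := by
  constructor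
  · intro hodd
    have hD : 1 ≤ D := hodd.pos
    have hb : MGraph.edgeCost D = 2 * D + 2 := if_neg (Nat.not_even_iff_odd.2 hodd)
    have hpos : (0 : ℝ) < 2 * ((D : ℝ) + 1) := by positivity
    constructor
    · intro α β G hV hE hL hc _
      have h := hc.dense hD hV hE hL
      rw [hb, show 2 * (2 * D + 2) - 1 = 4 * D + 3 by omega] at h
      rw [div_le_iff₀ hpos]
      have h' : ((4 * D + 3 : ℝ)) * V(G).ncard + 2 ≤ (2 * D + 2) * E(G).ncard := by
        exact_mod_cast h
      linarith
    · intro N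
      obtain ⟨G, hV, hE, hL, hc, hN, h⟩ := MGraph.exists_edgeCritical hD (max N 3)
      refine ⟨G, hV, hE, hL, hc, (le_max_right _ _).trans hN, (le_max_left _ _).trans hN, ?_⟩
      rw [hb, show 2 * (2 * D + 2) - 1 = 4 * D + 3 by omega] at h
      rw [eq_div_iff hpos.ne']
      have h' : (2 * D + 2 : ℝ) * E(G).ncard = (4 * D + 3) * V(G).ncard + 2 := by
        exact_mod_cast h
      linarith
  · intro heven h2
    have hD : 1 ≤ D := by omega
    have hb : MGraph.edgeCost D = 2 * D + 1 := if_pos heven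
    have hpos : (0 : ℝ) < 2 * (D : ℝ) + 1 := by positivity
    constructor
    · intro α β G hV hE hL hc _
      have h := hc.dense hD hV hE hL
      rw [hb, show 2 * (2 * D + 1) - 1 = 4 * D + 1 by omega] at h
      rw [div_le_iff₀ hpos]
      have h' : ((4 * D + 1 : ℝ)) * V(G).ncard + 2 ≤ (2 * D + 1) * E(G).ncard := by
        exact_mod_cast h
      linarith
    · intro N
      obtain ⟨G, hV, hE, hL, hc, hN, h⟩ := MGraph.exists_edgeCritical hD (max N 3)
      refine ⟨G, hV, hE, hL, hc, (le_max_right _ _).trans hN, (le_max_left _ _).trans hN, ?_⟩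
      rw [hb, show 2 * (2 * D + 1) - 1 = 4 * D + 1 by omega] at h
      rw [eq_div_iff hpos.ne']
      have h' : (2 * D + 1 : ℝ) * E(G).ncard = (4 * D + 1) * V(G).ncard + 2 := by
        exact_mod_cast h
      linarith
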